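/- Let $(X,\omega)$ be a connected symplectic $4$-manifold with an effective Hamiltonian action of $\mathbb T^2=\mathbb R^2/2\pi\mathbb Z^2$ whose moment map $\mu:X\to\mathbb R^2$ is proper onto its convex image $P=\mu(X)$. Assume that $P$ is an unbounded moment polygon with finitely many vertices and at least one vertex. That is, $P=\{x:\ell_i(x)=\langle x,\nu_i\rangle+\lambda_i\ge 0,\ i=1,\dots,d\}$ has edges $E_i=\{x\in P:\ell_i(x)=0\}$, $d\ge 2$, with primitive interior normals $\nu_i=(\alpha_i,\beta_i)\in\mathbb Z^2$ such that the normals of any two intersecting edges form a $\mathbb Z$-basis of $\mathbb Z^2$; the edges are ordered so that $E_1,E_d$ are the unbounded ones, and $E_{i-1}\cap E_i\neq\emptyset$, $\det(\nu_{i-1},\nu_i)=-1$ for $i=2,\dots,d$. Call $P$ strictly unbounded if its unbounded edges $E_1$ and $E_d$ are not parallel. Let $\nu=(\alpha,\beta)\in\mathbb R^2$ satisfy $\det(\nu,\nu_i)\ge 0$ for $i=1,\dots,d$. For real numbers $a_1<\dots<a_{d-1}$ define, on the half-plane $\mathbb H=\{(H,r):r>0\}$, $$(\xi_1,\xi_2)=\xi=\nu_1\log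 r+\frac12\sum_{i=1}^{d-1}(\nu_{i+1}-\nu_i)\log\Big(H+a_i+\sqrt{(H+a_i)^2+r^2}\Big)+\nu H ,$$ and let $x=(x_1,x_2)$ be primitives on $\mathbb H$ of the closed $1$-forms $$\epsilon_1=r\Big(\frac{\partial\xi_2}{\partial r}dH-\frac{\partial\xi_2}{\partial H}dr\Big),\qquad \epsilon_2=-r\Big(\frac{\partial\xi_1}{\partial r}dH-\frac{\partial\xi_1}{\partial H}dr\Big),$$ extended continuously to $\overline{\mathbb H}$, where the $a_i$ and the constants of integration are such that $x(-a_i,0)$ is the vertex $E_i\cap E_{i+1}$ of $P$ for $i=1,\dots,d-1$. Let ${\bf u}$ be a smooth function on the interior $\breve P$ of $P$ with $d{\bf u}=\xi_1\,dx_1+\xi_2\,dx_2$, and let $J$ be the toric compatible complex structure on $X$ with symplectic potential ${\bf u}$; that is, $J$ is a smooth integrable $\mathbb T^2$-invariant complex structure on $X$ such that $\omega(\cdot,J\cdot)$ is a Riemannian metric, and in some action-angle coordinates $(x,\theta)$ on $\mu^{-1}(\breve P)\cong\breve P\times\mathbb T^2$ (so $\mu=x$ and $\omega=dx_1\wedge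 d\theta_1+dx_2\wedge d\theta_2$) it is given by the matrix $$\begin{pmatrix}0&-U^{-1}\\ U&0\end{pmatrix},\qquad U=\mathrm{Hess}_x({\bf u}).$$ Let $Y_1,Y_2$ be the vector fields on $X$ generating the $\mathbb T^2$-action. Then $J$ is complete, meaning that the vector fields $JY_1$ and $JY_2$ on $X$ are complete, if and only if $P$ is strictly unbounded. -/

import Mathlib

open scoped Manifold ContDiff Topology

noncomputable section

namespace ToricKahler

/-! ### Planar linear algebra and moment polygons -/

/-- `ℝ²` with coordinates indexed by `Fin 2`. -/
abbrev Plane : Type := Fin 2 → ℝ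

/-- The determinant `det (v, w)` of two vectors of `R²`. -/
def det2 {R : Type*} [CommRing R] (v w : Fin 2 → R) : R := v 0 * w 1 - v 1 * w 0

/-- An integer vector viewed in `ℝ²`. -/
def toPlane (m : Fin 2 → ℤ) : Plane := fun k => (m k : ℝ)

/-- The affine functional `ℓ(x) = ⟨x, m⟩ + c`. -/
def affineForm (m : Fin 2 → ℤ) (c : ℝ) (x : Plane) : ℝ := ∑ k, x k * (m k : ℝ) + c

/-- The region `{x : ℓ_i(x) ≥ 0 for all i}`, where `ℓ_i(x) = ⟨x, m_i⟩ + c_i`. -/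
def region {d : ℕ} (m : Fin d → Fin 2 → ℤ) (c : Fin d → ℝ) : Set Plane :=
  {x | ∀ i, 0 ≤ affineForm (m i) (c i) x}

/-- The `i`-th edge `{x ∈ P : ℓ_i(x) = 0}` of the region. -/
def edge {d : ℕ} (m : Fin d → Fin 2 → ℤ) (c : Fin d → ℝ) (i : Fin d) : Set Plane :=
  {x | x ∈ region m c ∧ affineForm (m i) (c i) x = 0}

/-- The inequalities `ℓ_i ≥ 0` describe a moment polygon with (exactly) `d` edges: every `ℓ_i`
cuts out a genuine edge, the interior normals `m_i` are primitive lattice vectors, and the normals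
of any two intersecting edges form a `ℤ`-basis of `ℤ²`. -/
structure IsMomentPolygon {d : ℕ} (m : Fin d → Fin 2 → ℤ) (c : Fin d → ℝ) : Prop where
  nonempty_interior : (interior (region m c)).Nonempty
  edge_nontrivial : ∀ i, (edge m c i).Nontrivial
  primitive : ∀ i, IsCoprime (m i 0) (m i 1)
  basis : ∀ i j, i ≠ j → (edge m c i ∩ edge m c j).Nonempty → IsUnit (det2 (m i) (m j))

/-- The moment polygon of an unbounded symplectic toric 4-manifold, with at least one vertex and
with its `n + 1` edges in the standard order: the first and the last edge are the unbounded ones,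
and consecutive edges intersect, with `det (ν_{i-1}, ν_i) = -1`. -/
structure IsOrderedUnboundedPolygon {n : ℕ} (m : Fin (n + 1) → Fin 2 → ℤ)
    (c : Fin (n + 1) → ℝ) : Prop extends IsMomentPolygon m c where
  one_le : 1 ≤ n
  first_unbounded : ¬ Bornology.IsBounded (edge m c 0)
  last_unbounded : ¬ Bornology.IsBounded (edge m c (Fin.last n))
  consecutive : ∀ i : Fin n, (edge m c i.castSucc ∩ edge m c i.succ).Nonempty
  det_eq : ∀ i : Fin n, det2 (m i.castSucc) (m i.succ) = -1

/-- The two unbounded edges (the first and the last one) are not parallel, that is, their normals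
are linearly independent. -/
def IsStrictlyUnbounded {n : ℕ} (m : Fin (n + 1) → Fin 2 → ℤ) : Prop :=
  det2 (m 0) (m (Fin.last n)) ≠ 0

/-! ### Symplectic toric 4-manifolds -/

section Manifold

variable (X : Type*) [TopologicalSpace X] [ChartedSpace (EuclideanSpace ℝ (Fin 4)) X]
  [IsManifold (𝓡 4) ∞ X]

/-- Vector fields on `X` (no smoothness required). -/
abbrev VField : Type _ := ∀ p : X, TangentSpace (𝓡 4) p

/-- Smooth vector fields. -/
def SmoothVField (V : VField X) : Prop :=
  ContMDiff (𝓡 4) (𝓡 4).tangent ∞ (fun p => (⟨p, V p⟩ : TangentBundle (𝓡 4) X))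

variable {X} in
/-- The derivative `V f` of a function `f` along a vector field `V`. -/
def dirDeriv (V : VField X) (f : X → ℝ) (p : X) : ℝ := mfderiv (𝓡 4) 𝓘(ℝ, ℝ) f p (V p)

/-- Symplectic forms: smooth, alternating, nondegenerate, closed 2-forms. Closedness is expressed
by the invariant formula for `dω (U, V, W)`. -/
structure SymplecticForm where
  form : ∀ p : X, TangentSpace (𝓡 4) p →L[ℝ] TangentSpace (𝓡 4) p →L[ℝ] ℝ
  smooth : ContMDiff (𝓡 4)
    ((𝓡 4).prod 𝓘(ℝ, EuclideanSpace ℝ (Fin 4) →L[ℝ] EuclideanSpace ℝ (Fin 4) →L[ℝ] ℝ)) ∞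
    (fun p => Bundle.TotalSpace.mk'
      (EuclideanSpace ℝ (Fin 4) →L[ℝ] EuclideanSpace ℝ (Fin 4) →L[ℝ] ℝ) p (form p))
  alternating : ∀ p v, form p v v = 0
  nondegenerate : ∀ p v, (∀ w, form p v w = 0) → v = 0
  closed : ∀ U V W : VField X, SmoothVField X U → SmoothVField X V → SmoothVField X W → ∀ p : X,
    dirDeriv U (fun q => form q (V q) (W q)) p
      + dirDeriv V (fun q => form q (W q) (U q)) p
      + dirDeriv W (fun q => form q (U q) (V q)) p
      - form p (VectorField.mlieBracket (𝓡 4) U V p) (W p)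
      - form p (VectorField.mlieBracket (𝓡 4) V W p) (U p)
      - form p (VectorField.mlieBracket (𝓡 4) W U p) (V p) = 0

/-- Smooth effective actions of the torus `𝕋² = ℝ² / 2πℤ²`, written as actions of `ℝ²` for which
exactly the elements of `2πℤ²` act trivially. -/
structure TorusAction where
  act : Plane → X → X
  zero_act : ∀ p, act 0 p = p
  add_act : ∀ s t p, act (s + t) p = act s (act t p)
  smooth : ContMDiff (𝓘(ℝ, Plane).prod (𝓡 4)) (𝓡 4) ∞ (fun q : Plane × X => act q.1 q.2)
  effective : ∀ t, (∀ p, act t p = p) ↔ ∃ n : Fin 2 → ℤ, t = fun k => 2 * Real.pi * (n k : ℝ)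

variable {X}

/-- The vector field `Y_k` that generates the action of the `k`-th circle. -/
def TorusAction.generator (τ : TorusAction X) (k : Fin 2) : VField X := fun p =>
  mfderiv 𝓘(ℝ, ℝ) (𝓡 4) (fun s : ℝ => τ.act (Pi.single k s) p) 0 (1 : ℝ)

variable (X)

/-- Symplectic toric structures on the 4-manifold `X`: a symplectic form, an effective torus action
by symplectomorphisms and a moment map `μ`, proper onto its convex image. The sign convention is
`dμ_k = ω(·, Y_k)`, so that `ω = ∑ dμ_k ∧ dθ_k` in action-angle coordinates. -/
structure SymplecticToric where
  symp : SymplecticForm X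
  τ : TorusAction X
  invariant : ∀ t p (v w : TangentSpace (𝓡 4) p),
    symp.form (τ.act t p) (mfderiv (𝓡 4) (𝓡 4) (τ.act t) p v) (mfderiv (𝓡 4) (𝓡 4) (τ.act t) p w)
      = symp.form p v w
  μ : X → Plane
  μ_smooth : ContMDiff (𝓡 4) 𝓘(ℝ, Plane) ∞ μ
  hamiltonian : ∀ p (v : TangentSpace (𝓡 4) p) (k : Fin 2),
    (mfderiv (𝓡 4) 𝓘(ℝ, Plane) μ p v : Plane) k = symp.form p v (τ.generator k p)
  convex_image : Convex ℝ (Set.range μ)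
  proper : IsProperMap (Set.rangeFactorization μ)

variable {X}

/-- Toric compatible complex structures: smooth `J` with `J² = -1` and vanishing Nijenhuis tensor,
such that `ω(·, J·)` is a Riemannian metric, invariant under the torus action. -/
structure IsToricComplexStructure (S : SymplecticToric X)
    (J : ∀ p : X, TangentSpace (𝓡 4) p →L[ℝ] TangentSpace (𝓡 4) p) : Prop where
  smooth : ContMDiff (𝓡 4)
    ((𝓡 4).prod 𝓘(ℝ, EuclideanSpace ℝ (Fin 4) →L[ℝ] EuclideanSpace ℝ (Fin 4))) ∞
    (fun p => Bundle.TotalSpace.mk'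
      (E := fun p : X => TangentSpace (𝓡 4) p →L[ℝ] TangentSpace (𝓡 4) p)
      (EuclideanSpace ℝ (Fin 4) →L[ℝ] EuclideanSpace ℝ (Fin 4)) p (J p))
  sq : ∀ p v, J p (J p v) = -v
  integrable : ∀ V W : VField X, SmoothVField X V → SmoothVField X W → ∀ p : X,
    VectorField.mlieBracket (𝓡 4) (fun q => J q (V q)) (fun q => J q (W q)) p
      - J p (VectorField.mlieBracket (𝓡 4) (fun q => J q (V q)) W p)
      - J p (VectorField.mlieBracket (𝓡 4) V (fun q => J q (W q)) p)
      - VectorField.mlieBracket (𝓡 4) V W p = 0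
  symm : ∀ p v w, S.symp.form p v (J p w) = S.symp.form p w (J p v)
  pos : ∀ p v, v ≠ 0 → 0 < S.symp.form p v (J p v)
  invariant : ∀ t p (v : TangentSpace (𝓡 4) p),
    mfderiv (𝓡 4) (𝓡 4) (S.τ.act t) p (J p v)
      = J (S.τ.act t p) (mfderiv (𝓡 4) (𝓡 4) (S.τ.act t) p v)

/-- A vector field is complete if through every point there is an integral curve defined for all
times. -/
def IsCompleteVField (V : VField X) : Prop :=
  ∀ p : X, ∃ γ : ℝ → X, γ 0 = p ∧ IsMIntegralCurve (I := 𝓡 4) γ V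

/-- `J` is complete if the vector fields `J Y₁` and `J Y₂` are complete. -/
def IsCompleteComplexStructure (S : SymplecticToric X)
    (J : ∀ p : X, TangentSpace (𝓡 4) p →L[ℝ] TangentSpace (𝓡 4) p) : Prop :=
  ∀ k : Fin 2, IsCompleteVField (fun p => J p (S.τ.generator k p))

/-- Action-angle coordinates: an equivariant symplectomorphism from
`(interior P) × ℝ² / 2πℤ²` onto `μ⁻¹ (interior P)`, where `P` is the image of `μ`,
with `μ = x` and `ω = dx₁ ∧ dθ₁ + dx₂ ∧ dθ₂`. It is written as a map of `(x, θ)` with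
`θ ∈ ℝ²`; being symplectic it is a local diffeomorphism. -/
structure IsActionAngle (S : SymplecticToric X) (Φ : Plane × Plane → X) : Prop where
  smooth : ContMDiffOn 𝓘(ℝ, Plane × Plane) (𝓡 4) ∞ Φ (interior (Set.range S.μ) ×ˢ Set.univ)
  moment : ∀ x ∈ interior (Set.range S.μ), ∀ θ, S.μ (Φ (x, θ)) = x
  equivariant : ∀ x ∈ interior (Set.range S.μ), ∀ θ t, Φ (x, θ + t) = S.τ.act t (Φ (x, θ))
  injective : ∀ x ∈ interior (Set.range S.μ), ∀ θ θ', Φ (x, θ) = Φ (x, θ') →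
    ∃ n : Fin 2 → ℤ, θ - θ' = fun k => 2 * Real.pi * (n k : ℝ)
  surjective : ∀ p, S.μ p ∈ interior (Set.range S.μ) → ∃ θ, Φ (S.μ p, θ) = p
  symplectic : ∀ x ∈ interior (Set.range S.μ), ∀ θ, ∀ v w : Plane × Plane,
    S.symp.form (Φ (x, θ)) (mfderiv 𝓘(ℝ, Plane × Plane) (𝓡 4) Φ (x, θ) v)
        (mfderiv 𝓘(ℝ, Plane × Plane) (𝓡 4) Φ (x, θ) w)
      = ∑ k, (v.1 k * w.2 k - v.2 k * w.1 k)

/-- The Hessian matrix of a function on `ℝ²`. -/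
def hessian (u : Plane → ℝ) (x : Plane) : Matrix (Fin 2) (Fin 2) ℝ :=
  Matrix.of fun j k => fderiv ℝ (fun y => fderiv ℝ u y (Pi.single k 1)) x (Pi.single j 1)

/-- `u` is a symplectic potential of `J`: in some action-angle coordinates `(x, θ)`, the matrix of
`J` is `[[0, -U⁻¹], [U, 0]]`, where `U` is the Hessian of `u`. -/
def IsSymplecticPotential (S : SymplecticToric X)
    (J : ∀ p : X, TangentSpace (𝓡 4) p →L[ℝ] TangentSpace (𝓡 4) p) (u : Plane → ℝ) : Prop :=
  ContDiffOn ℝ ∞ u (interior (Set.range S.μ)) ∧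
  ∃ Φ : Plane × Plane → X, IsActionAngle S Φ ∧
    ∀ x ∈ interior (Set.range S.μ), ∀ θ, ∀ v : Plane × Plane,
      J (Φ (x, θ)) (mfderiv 𝓘(ℝ, Plane × Plane) (𝓡 4) Φ (x, θ) v)
        = mfderiv 𝓘(ℝ, Plane × Plane) (𝓡 4) Φ (x, θ)
            ((-((hessian u x)⁻¹.mulVec v.2), (hessian u x).mulVec v.1) : Plane × Plane)

end Manifold

/-! ### The potentials -/

/-- The function `ξ_k (H, r)`, `k = 1, 2`:
`ν₁ log r + ½ ∑ (ν_{i+1} - ν_i) log (H + a_i + √((H + a_i)² + r²)) + ν H`, with `p = (H, r)`. -/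
def xi {n : ℕ} (m : Fin (n + 1) → Fin 2 → ℤ) (a : Fin n → ℝ) (ν : Plane) (k : Fin 2)
    (p : ℝ × ℝ) : ℝ :=
  (m 0 k : ℝ) * Real.log p.2
    + 1 / 2 * ∑ i : Fin n, ((m i.succ k : ℝ) - (m i.castSucc k : ℝ))
        * Real.log (p.1 + a i + Real.sqrt ((p.1 + a i) ^ 2 + p.2 ^ 2))
    + ν k * p.1

/-- For a function `f (H, r)`, the 1-form `r (∂f/∂r dH - ∂f/∂H dr)`. -/
def conjForm (f : ℝ × ℝ → ℝ) (p : ℝ × ℝ) : ℝ × ℝ →L[ℝ] ℝ :=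
  p.2 • (fderiv ℝ f p (0, 1) • ContinuousLinearMap.fst ℝ ℝ ℝ
    - fderiv ℝ f p (1, 0) • ContinuousLinearMap.snd ℝ ℝ ℝ)

/-- The data of the construction: `x₁`, `x₂` are primitives on the half-plane `r > 0` of
`ε₁ = r (∂ξ₂/∂r dH - ∂ξ₂/∂H dr)` and `ε₂ = -r (∂ξ₁/∂r dH - ∂ξ₁/∂H dr)`, extended continuously to
`r = 0`; the numbers `a_1 < ... < a_{d-1}` and the constants of integration are adjusted to the
polygon by requiring `x(-a_i, 0)` to be the `i`-th vertex (the common point of the edges `E_i` and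
`E_{i+1}`). -/
structure IsJoyceCoordinates {n : ℕ} (m : Fin (n + 1) → Fin 2 → ℤ) (c : Fin (n + 1) → ℝ)
    (ν : Plane) (a : Fin n → ℝ) (x : ℝ × ℝ → Plane) : Prop where
  strictMono : StrictMono a
  primitive_zero : ∀ p : ℝ × ℝ, 0 < p.2 →
    HasFDerivAt (fun q => x q 0) (conjForm (xi m a ν 1) p) p
  primitive_one : ∀ p : ℝ × ℝ, 0 < p.2 →
    HasFDerivAt (fun q => x q 1) (-conjForm (xi m a ν 0) p) p
  continuous : ContinuousOn x {p | 0 ≤ p.2}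
  vertex : ∀ i : Fin n, x (-a i, 0) ∈ edge m c i.castSucc ∩ edge m c i.succ

/-- `u` satisfies `du = ξ₁ dx₁ + ξ₂ dx₂` in the coordinates `x` of the construction with
parameter `ν`. -/
def IsJoycePotential {n : ℕ} (m : Fin (n + 1) → Fin 2 → ℤ) (c : Fin (n + 1) → ℝ)
    (ν : Plane) (u : Plane → ℝ) : Prop :=
  ∃ (a : Fin n → ℝ) (x : ℝ × ℝ → Plane), IsJoyceCoordinates m c ν a x ∧
    ∀ p : ℝ × ℝ, 0 < p.2 →
      HasFDerivAt u (∑ k, xi m a ν k p • ContinuousLinearMap.proj (R := ℝ) k) (x p)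

end ToricKahler

end

/-!
Over the interior of the polygon the vector field `J Y_k` becomes a translation: in action-angle
coordinates it projects to `-U⁻¹ e_k`, so along its integral curves the gradient `∇u` of the
symplectic potential moves with constant velocity `-e_k` (`hasDerivAt_gradient_comp`). Integral
curves that start over the interior stay there, since the stabilizers of the torus action are
constant along them (`IsToricComplexStructure.mem_interior_of_isMIntegralCurveOn`). Completeness
therefore is a question about the range and the properness of `∇u = ξ`, as a function
of a point of the polygon.

The coordinates `x` are explicit up to constants: each `ℓ_i ∘ x` is the function `axialConjugate`,
piecewise linear on the boundary `r = 0` of the half-plane. As `√(h² + r²)` is an average of the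
values `|h + r tan θ|`, inequalities between boundary values extend to the half-plane
(`average_nonneg`). Thus `x` maps the open half-plane into the interior of the polygon and is proper
(`IsJoyceCoordinates.sqrt_le`); it is a local diffeomorphism, because `dx` is obtained from
`dξ` by a rotation and `ξ` is the gradient of `u` (`IsJoyceCoordinates.map_nhds`). Hence it is onto
the interior (`IsJoyceCoordinates.exists_eq`), and `∇u` is known everywhere.

If the unbounded edges are parallel, then `det (∇u, ν_1) < 0` on the whole interior, by Abel
summation (`IsJoyceCoordinates.det2_grad_neg`), while a translation by a multiple of `e_k` with
`det (e_k, ν_1) ≠ 0` leaves this half-plane: `J Y_k` is not complete.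

If they are not parallel, then `det (∇u, ν_1)` and `det (ν_d, ∇u)` are locally bounded above, up to
the boundary of the polygon, and their common sublevel sets are relatively compact
(`IsJoyceCoordinates.exists_eventually_grad_le`, `IsJoyceCoordinates.exists_isCompact_of_grad_le`).
As the moment map is proper, integral curves over the interior stay in a compact set for
bounded times. The same holds for curves through points over the edges, since the open orbits are
dense (`SymplecticToric.dense_preimage_interior`); this is the content of
`exists_isMIntegralCurve_of_dense_translation`.
-/

noncomputable section

namespace ToricKahler

/-! ### Flows of vector fields on manifolds -/

section Flow

open Set Function

variable {E : Type*} [NormedAddCommGroup E] [NormedSpace ℝ E]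
  {H : Type*} [TopologicalSpace H] {I : ModelWithCorners ℝ E H}
  {M : Type*} [TopologicalSpace M] [ChartedSpace H M] [IsManifold I 1 M]
  {v : (x : M) → TangentSpace I x}

theorem hasMFDerivAt_extChartAt_symm_comp {x₀ : M} {f : ℝ → E} {t : ℝ}
    (hf : f t ∈ interior (extChartAt I x₀).target)
    (h : HasDerivAt f (tangentCoordChange I ((extChartAt I x₀).symm (f t)) x₀
      ((extChartAt I x₀).symm (f t)) (v ((extChartAt I x₀).symm (f t)))) t) :
    HasMFDerivAt 𝓘(ℝ, ℝ) I ((extChartAt I x₀).symm ∘ f) t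
      ((1 : ℝ →L[ℝ] ℝ).smulRight (v (((extChartAt I x₀).symm ∘ f) t))) := by
  let xₜ : M := (extChartAt I x₀).symm (f t)
  have hf3' := mem_of_mem_of_subset hf interior_subset
  have hft1 := mem_preimage.mp <|
    mem_of_mem_of_subset hf3' (extChartAt I x₀).target_subset_preimage_source
  have hft2 := mem_extChartAt_source (I := I) xₜ
  have hcoord : HasFDerivAt (extChartAt I xₜ ∘ (extChartAt I x₀).symm)
      (tangentCoordChange I x₀ xₜ xₜ : E →L[ℝ] E) (f t) := by
    rw [← (extChartAt I x₀).right_inv hf3']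
    refine (hasFDerivWithinAt_tangentCoordChange ⟨hft1, hft2⟩).hasFDerivAt ?_
    rw [(extChartAt I x₀).right_inv hf3']
    exact mem_nhds_iff.mpr ⟨interior (extChartAt I x₀).target,
      subset_trans interior_subset (extChartAt_target_subset_range ..), isOpen_interior, hf⟩
  have hw : tangentCoordChange I x₀ xₜ xₜ (tangentCoordChange I xₜ x₀ xₜ (v xₜ)) = (v xₜ : E) :=
    (tangentCoordChange_comp ⟨⟨hft2, hft1⟩, hft2⟩).trans (tangentCoordChange_self hft2)
  have hderiv : HasDerivAt ((extChartAt I xₜ ∘ (extChartAt I x₀).symm) ∘ f) (v xₜ : E) t :=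
    (hcoord.comp_hasDerivAt t h).congr_deriv hw
  refine ⟨(continuousAt_extChartAt_symm'' hf3').comp h.continuousAt, ?_⟩
  exact hderiv.hasFDerivAt.hasFDerivWithinAt

/-- If integral curves through all points of a curve exist for the uniform time `ε`, then the curve
extends by `ε / 2` in both directions. -/
theorem exists_isMIntegralCurveOn_extension [T2Space M] [BoundarylessManifold I M]
    (hv : ContMDiff I I.tangent 1 (fun x ↦ (⟨x, v x⟩ : TangentBundle I M)))
    {a ε : ℝ} (ha : 0 < a) (hε : 0 < ε) {γ : ℝ → M} (hγ : IsMIntegralCurveOn γ v (Ioo (-a) a))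
    (h : ∀ t ∈ Ioo (-a) a, ∃ γ' : ℝ → M, γ' 0 = γ t ∧ IsMIntegralCurveOn γ' v (Ioo (-ε) ε)) :
    ∃ γ' : ℝ → M, γ' 0 = γ 0 ∧
      IsMIntegralCurveOn γ' v (Ioo (-(a + ε / 2)) (a + ε / 2)) := by
  set δ := min (ε / 2) (a / 2) with hδ
  have hδ0 : 0 < δ := lt_min (by linarith) (by linarith)
  have hδε : δ ≤ ε / 2 := min_le_left _ _
  have hδa : δ ≤ a / 2 := min_le_right _ _
  set t₁ := a - δ with ht₁
  obtain ⟨g₁, hg₁0, hg₁⟩ := h (-t₁) ⟨by linarith, by linarith⟩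
  obtain ⟨g₂, hg₂0, hg₂⟩ := h t₁ ⟨by linarith, by linarith⟩
  have hc₁ : IsMIntegralCurveOn (g₁ ∘ (· + t₁)) v (Ioo (-t₁ - ε) (-t₁ + ε)) := by
    refine (hg₁.comp_add t₁).mono fun t ht ↦ ?_
    exact ⟨by linarith [ht.1], by linarith [ht.2]⟩
  have hc₂ : IsMIntegralCurveOn (g₂ ∘ (· + (-t₁))) v (Ioo (t₁ - ε) (t₁ + ε)) := by
    refine (hg₂.comp_add (-t₁)).mono fun t ht ↦ ?_
    exact ⟨by linarith [ht.1], by linarith [ht.2]⟩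
  have hp₁ := isMIntegralCurveOn_piecewise (t₀ := -t₁) hv hγ hc₁
    ⟨⟨by linarith, by linarith⟩, ⟨by linarith, by linarith⟩⟩ (by simp [hg₁0])
  have hp₁' : IsMIntegralCurveOn (piecewise (Ioo (-a) a) γ (g₁ ∘ (· + t₁))) v
      (Ioo (-(a + ε / 2)) a) :=
    hp₁.mono (union_comm _ _ ▸ fun t ht ↦ by
      by_cases h1 : -a < t
      · exact Or.inr ⟨h1, ht.2⟩
      · exact Or.inl ⟨by linarith [ht.1], by linarith⟩)
  have hp₂ := isMIntegralCurveOn_piecewise (t₀ := t₁) hv hp₁' hc₂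
    ⟨⟨by linarith, by linarith⟩, ⟨by linarith, by linarith⟩⟩
    (by rw [piecewise, if_pos ⟨by linarith, by linarith⟩]; simp [hg₂0])
  refine ⟨_, ?_, hp₂.mono fun t ht ↦ ?_⟩
  · rw [piecewise, if_pos ⟨by linarith, by linarith⟩, piecewise, if_pos ⟨by linarith, by linarith⟩]
  · by_cases h1 : t < a
    · exact Or.inl ⟨ht.1, h1⟩
    · exact Or.inr ⟨by linarith, by linarith [ht.2]⟩

variable [CompleteSpace E] [BoundarylessManifold I M]

/-- The local flow of a `C¹` vector field near a point, jointly continuous in the initial value and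
in time. -/
theorem exists_localFlow
    (hv : ContMDiff I I.tangent 1 (fun x ↦ (⟨x, v x⟩ : TangentBundle I M))) (p : M) :
    ∃ ε > 0, ∃ W : Set M, IsOpen W ∧ p ∈ W ∧ ∃ Ψ : M → ℝ → M,
      (∀ q ∈ W, Ψ q 0 = q ∧ IsMIntegralCurveOn (Ψ q) v (Ioo (-ε) ε)) ∧
      ContinuousOn (uncurry Ψ) (W ×ˢ Ioo (-ε) ε) := by
  have hv' := hv p
  have hp : I.IsInteriorPoint p := BoundarylessManifold.isInteriorPoint
  rw [contMDiffAt_iff] at hv'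
  obtain ⟨_, hv'⟩ := hv'
  obtain ⟨ε₀, hε₀, a, r, _, _, hr, hpl⟩ := IsPicardLindelof.of_contDiffAt_one
    (hv'.contDiffAt (range_mem_nhds_isInteriorPoint hp)).snd
  obtain ⟨α, hα, hαc⟩ :=
    (hpl 0).exists_forall_mem_closedBall_eq_hasDerivWithinAt_continuousOn
  have hx₀ : extChartAt I p p ∈ Metric.closedBall (extChartAt I p p) (r : ℝ) :=
    Metric.mem_closedBall_self r.2
  have hcont : ContinuousAt α (extChartAt I p p, 0) := by
    refine hαc.continuousAt (prod_mem_nhds (Metric.closedBall_mem_nhds _ hr) ?_)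
    exact Icc_mem_nhds (by linarith) (by linarith)
  have hα0 : α (extChartAt I p p, 0) = extChartAt I p p := (hα _ hx₀).1
  have hmem : α ⁻¹' interior (extChartAt I p).target ∈ 𝓝 (extChartAt I p p, (0 : ℝ)) := by
    refine hcont.preimage_mem_nhds ?_
    rw [hα0]
    exact isOpen_interior.mem_nhds (I.isInteriorPoint_iff.mp hp)
  rw [Metric.mem_nhds_iff] at hmem
  obtain ⟨δ, hδ, hball⟩ := hmem
  set ε := min δ ε₀ with hε
  have hεpos : 0 < ε := lt_min hδ hε₀
  set ρ := min δ r with hρ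
  have hρpos : 0 < ρ := lt_min hδ hr
  set W := (chartAt H p).source ∩ extChartAt I p ⁻¹' Metric.ball (extChartAt I p p) ρ with hW
  have hWopen : IsOpen W := by
    rw [hW, ← extChartAt_source I p]
    exact isOpen_extChartAt_preimage' p Metric.isOpen_ball
  have hsub : ∀ q ∈ W, ∀ t ∈ Ioo (-ε) ε,
      α (extChartAt I p q, t) ∈ interior (extChartAt I p).target := by
    intro q hq t ht
    apply hball
    rw [Metric.mem_ball, Prod.dist_eq]
    refine max_lt (lt_of_lt_of_le hq.2 (min_le_left _ _)) ?_
    rw [Real.dist_eq, sub_zero]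
    exact lt_of_lt_of_le (abs_lt.2 ht) (min_le_left _ _)
  have hWball : ∀ q ∈ W, extChartAt I p q ∈ Metric.closedBall (extChartAt I p p) (r : ℝ) :=
    fun q hq ↦ Metric.ball_subset_closedBall
      (Metric.ball_subset_ball (min_le_right _ _) hq.2)
  have hIoo : Ioo (-ε) ε ⊆ Icc (0 - ε₀) (0 + ε₀) := fun t ht ↦
    ⟨by linarith [ht.1, min_le_right δ ε₀], by linarith [ht.2, min_le_right δ ε₀]⟩
  refine ⟨ε, hεpos, W, hWopen, ⟨mem_chart_source H p, Metric.mem_ball_self hρpos⟩,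
    fun q t ↦ (extChartAt I p).symm (α (extChartAt I p q, t)), ?_, ?_⟩
  · intro q hq
    refine ⟨?_, ?_⟩
    · have := (hα _ (hWball q hq)).1
      simp only at this ⊢
      rw [this]
      exact (extChartAt I p).left_inv (by rw [extChartAt_source]; exact hq.1)
    · intro t ht
      apply HasMFDerivAt.hasMFDerivWithinAt
      refine hasMFDerivAt_extChartAt_symm_comp (f := fun t ↦ α (extChartAt I p q, t))
        (hsub q hq t ht) ?_
      refine ((hα _ (hWball q hq)).2 t (hIoo ht)).hasDerivAt (Icc_mem_nhds ?_ ?_)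
      · linarith [ht.1, min_le_right δ ε₀]
      · linarith [ht.2, min_le_right δ ε₀]
  · refine (continuousOn_extChartAt_symm p).comp (t := (extChartAt I p).target)
      (f := fun z : M × ℝ ↦ α (extChartAt I p z.1, z.2)) ?_ ?_
    · refine hαc.comp (f := fun z : M × ℝ ↦ (extChartAt I p z.1, z.2)) ?_ ?_
      · refine ContinuousOn.prodMk ?_ continuousOn_snd
        refine (continuousOn_extChartAt p).comp continuousOn_fst ?_
        intro z hz
        rw [extChartAt_source]
        exact hz.1.1
      · exact fun z hz ↦ ⟨hWball _ hz.1, hIoo hz.2⟩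
    · exact fun z hz ↦ interior_subset (hsub _ hz.1 _ hz.2)

theorem exists_uniform_time_of_isCompact
    (hv : ContMDiff I I.tangent 1 (fun x ↦ (⟨x, v x⟩ : TangentBundle I M)))
    {K : Set M} (hK : IsCompact K) :
    ∃ ε > 0, ∀ q ∈ K, ∃ γ : ℝ → M, γ 0 = q ∧ IsMIntegralCurveOn γ v (Ioo (-ε) ε) := by
  refine hK.induction_on
    (p := fun s ↦ ∃ ε > 0, ∀ q ∈ s, ∃ γ : ℝ → M, γ 0 = q ∧ IsMIntegralCurveOn γ v (Ioo (-ε) ε))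
    ⟨1, one_pos, by simp⟩ ?_ ?_ ?_
  · rintro s t hst ⟨ε, hε, h⟩
    exact ⟨ε, hε, fun q hq ↦ h q (hst hq)⟩
  · rintro s t ⟨ε, hε, h⟩ ⟨ε', hε', h'⟩
    refine ⟨min ε ε', lt_min hε hε', ?_⟩
    have h1 : Ioo (-min ε ε') (min ε ε') ⊆ Ioo (-ε) ε :=
      Ioo_subset_Ioo (neg_le_neg (min_le_left _ _)) (min_le_left _ _)
    have h2 : Ioo (-min ε ε') (min ε ε') ⊆ Ioo (-ε') ε' :=
      Ioo_subset_Ioo (neg_le_neg (min_le_right _ _)) (min_le_right _ _)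
    rintro q (hq | hq)
    · obtain ⟨γ, h0, hγ⟩ := h q hq
      exact ⟨γ, h0, hγ.mono h1⟩
    · obtain ⟨γ, h0, hγ⟩ := h' q hq
      exact ⟨γ, h0, hγ.mono h2⟩
  · intro p _
    obtain ⟨ε, hε, W, hW, hpW, Ψ, hΨ, -⟩ := exists_localFlow hv p
    exact ⟨W, mem_nhdsWithin_of_mem_nhds (hW.mem_nhds hpW), ε, hε, fun q hq ↦ ⟨Ψ q, hΨ q hq⟩⟩

variable [T2Space M]

/-- An integral curve that stays in a compact set for every bounded time exists for all times. -/
theorem exists_isMIntegralCurve_of_forall_mem_isCompact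
    (hv : ContMDiff I I.tangent 1 (fun x ↦ (⟨x, v x⟩ : TangentBundle I M))) (p : M)
    (h : ∀ T : ℝ, ∃ K : Set M, IsCompact K ∧ ∀ (a : ℝ) (γ : ℝ → M), 0 < a → a ≤ T → γ 0 = p →
      IsMIntegralCurveOn γ v (Ioo (-a) a) → ∀ t ∈ Ioo (-a) a, γ t ∈ K) :
    ∃ γ : ℝ → M, γ 0 = p ∧ IsMIntegralCurve γ v := by
  rw [exists_isMIntegralCurve_iff_exists_isMIntegralCurveOn_Ioo hv]
  intro T
  obtain ⟨K, hK, hKγ⟩ := h T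
  obtain ⟨ε, hε, hεK⟩ := exists_uniform_time_of_isCompact hv hK
  obtain ⟨ε', hε', W, -, hpW, Ψ, hΨ, -⟩ := exists_localFlow hv p
  have key : ∀ n : ℕ, ∃ a : ℝ, 0 < a ∧ min T (n * (ε / 2)) ≤ a ∧
      ∃ γ : ℝ → M, γ 0 = p ∧ IsMIntegralCurveOn γ v (Ioo (-a) a) := by
    intro n
    induction n with
    | zero => exact ⟨ε', hε', (min_le_right _ _).trans (by simpa using hε'.le), Ψ p, hΨ p hpW⟩
    | succ n ih =>
      obtain ⟨a, ha, hna, γ, h0, hγ⟩ := ih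
      by_cases haT : a ≤ T
      · obtain ⟨γ', h0', hγ'⟩ := exists_isMIntegralCurveOn_extension hv ha hε hγ
          fun t ht ↦ hεK _ (hKγ a γ ha haT h0 hγ t ht)
        refine ⟨a + ε / 2, by positivity, ?_, γ', h0'.trans h0, hγ'⟩
        rcases min_le_iff.1 hna with h1 | h1
        · exact (min_le_left _ _).trans (by linarith)
        · refine (min_le_right _ _).trans ?_
          push_cast
          linarith
      · exact ⟨a, ha, (min_le_left _ _).trans (not_le.1 haT).le, γ, h0, hγ⟩
  obtain ⟨n, hn⟩ := exists_nat_ge (T / (ε / 2))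
  obtain ⟨a, -, hna, γ, h0, hγ⟩ := key n
  rw [div_le_iff₀ (by positivity)] at hn
  rw [min_eq_left hn] at hna
  exact ⟨γ, h0, hγ.mono (Ioo_subset_Ioo (neg_le_neg hna) hna)⟩

/-- Suppose that on a flow-invariant set `U` the flow is the translation by `w` in the values of
`G`. If `G` takes values in `A` on the points of `U` near `γ 0`, then it takes values in `A + t • w`
on those near `γ t`. This does not require `γ` itself to meet `U`: it propagates along `γ` through
nearby curves that lie in `U`. -/
theorem eventually_sub_smul_mem_of_isMIntegralCurveOn
    (hv : ContMDiff I I.tangent 1 (fun x ↦ (⟨x, v x⟩ : TangentBundle I M)))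
    {F : Type*} [AddCommGroup F] [Module ℝ F] {U : Set M} {G : M → F} {w : F}
    (hG : ∀ (a b : ℝ) (γ : ℝ → M), IsMIntegralCurveOn γ v (Ioo a b) → ∀ t₀ ∈ Ioo a b, γ t₀ ∈ U →
      ∀ t ∈ Ioo a b, γ t ∈ U ∧ G (γ t) = G (γ t₀) + (t - t₀) • w)
    {A : Set F} {a : ℝ} {γ : ℝ → M} (ha : 0 < a) (hγ : IsMIntegralCurveOn γ v (Ioo (-a) a))
    (hA : ∀ᶠ q in 𝓝 (γ 0), q ∈ U → G q ∈ A) {t : ℝ} (ht : t ∈ Ioo (-a) a) :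
    ∀ᶠ q in 𝓝 (γ t), q ∈ U → G q - t • w ∈ A := by
  set Q : ℝ → Prop := fun t ↦ ∀ᶠ q in 𝓝 (γ t), q ∈ U → G q - t • w ∈ A with hQ
  have hQ0 : Q 0 := by simpa [hQ] using hA
  have hloc : ∀ t₀ ∈ Ioo (-a) a, ∀ᶠ t in 𝓝[Ioo (-a) a] t₀, (Q t₀ → Q t) ∧ (Q t → Q t₀) := by
    intro t₀ ht₀
    obtain ⟨ε, hε, W, hWo, hW, Ψ, hΨ, hΨc⟩ := exists_localFlow hv (γ t₀)
    have hnhds : γ ⁻¹' W ∩ Ioo (-a) a ∈ 𝓝 t₀ :=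
      Filter.inter_mem ((hγ.isMIntegralCurveAt (Ioo_mem_nhds ht₀.1 ht₀.2)).continuousAt
        (hWo.mem_nhds hW)) (Ioo_mem_nhds ht₀.1 ht₀.2)
    obtain ⟨δ₀, hδ₀, hball⟩ := Metric.mem_nhds_iff.1 hnhds
    set δ := min δ₀ (ε / 2) with hδ
    have hδ0 : 0 < δ := lt_min hδ₀ (by linarith)
    have hδε : δ ≤ ε / 2 := min_le_right _ _
    have hin : ∀ s ∈ Ioo (t₀ - δ) (t₀ + δ), γ s ∈ W ∧ s ∈ Ioo (-a) a := by
      intro s hs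
      apply hball
      rw [Metric.mem_ball, Real.dist_eq]
      exact lt_of_lt_of_le (abs_lt.2 ⟨by linarith [hs.1], by linarith [hs.2]⟩) (min_le_left _ _)
    have key : ∀ s ∈ Ioo (t₀ - δ) (t₀ + δ), ∀ t ∈ Ioo (t₀ - δ) (t₀ + δ), Q s → Q t := by
      intro s hs t ht hQs
      have hst : s - t ∈ Ioo (-ε) ε := ⟨by linarith [hs.1, ht.2], by linarith [hs.2, ht.1]⟩
      -- the local flow carries `γ t` to `γ s`
      have hflow : Ψ (γ t) (s - t) = γ s := by
        have h1 : IsMIntegralCurveOn (γ ∘ (· + t)) v (Ioo (t₀ - δ - t) (t₀ + δ - t)) := by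
          refine (hγ.comp_add t).mono fun u hu ↦ ?_
          exact (hin (u + t) ⟨by linarith [hu.1], by linarith [hu.2]⟩).2
        have h2 : IsMIntegralCurveOn (Ψ (γ t)) v (Ioo (t₀ - δ - t) (t₀ + δ - t)) :=
          ((hΨ _ (hin t ht).1).2).mono
            (Ioo_subset_Ioo (by linarith [ht.2]) (by linarith [ht.1]))
        have h3 := isMIntegralCurveOn_Ioo_eqOn_of_contMDiff_boundaryless (t₀ := 0)
          ⟨by linarith [ht.1], by linarith [ht.2]⟩ hv h2 h1
          (by simp [(hΨ _ (hin t ht).1).1])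
        have h4 := h3 (x := s - t) ⟨by linarith [hs.1], by linarith [hs.2]⟩
        simpa using h4
      have hcont : ContinuousAt (fun q ↦ Ψ q (s - t)) (γ t) := by
        have h1 : ContinuousAt (uncurry Ψ) (γ t, s - t) :=
          hΨc.continuousAt (prod_mem_nhds (hWo.mem_nhds (hin t ht).1)
            (Ioo_mem_nhds hst.1 hst.2))
        exact h1.comp (f := fun q ↦ (q, s - t)) (continuousAt_id.prodMk continuousAt_const)
      have hev : ∀ᶠ q in 𝓝 (γ t), Ψ q (s - t) ∈ U → G (Ψ q (s - t)) - s • w ∈ A := by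
        have h1 : Filter.Tendsto (fun q ↦ Ψ q (s - t)) (𝓝 (γ t)) (𝓝 (γ s)) := by
          rw [← hflow]
          exact hcont
        exact h1.eventually hQs
      filter_upwards [hev, hWo.mem_nhds (hin t ht).1] with q hq hqW hqU
      have hc := hG _ _ _ (hΨ q hqW).2 0 ⟨by linarith, by linarith⟩
        (by rw [(hΨ q hqW).1]; exact hqU) (s - t) hst
      rw [(hΨ q hqW).1] at hc
      have h1 := hq hc.1
      rw [hc.2] at h1
      convert h1 using 1
      module
    have ht₀δ : t₀ ∈ Ioo (t₀ - δ) (t₀ + δ) := ⟨by linarith, by linarith⟩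
    filter_upwards [mem_nhdsWithin_of_mem_nhds (Ioo_mem_nhds ht₀δ.1 ht₀δ.2)] with t ht
    exact ⟨key t₀ ht₀δ t ht, key t ht t₀ ht₀δ⟩
  exact isPreconnected_Ioo.induction₂' (fun s t ↦ Q s → Q t) hloc
    (fun x y z _ _ _ h1 h2 h3 ↦ h2 (h1 h3)) (x := 0) (y := t) ⟨by linarith, ha⟩ ht hQ0

/-- A completeness criterion. On a dense flow-invariant set `U` the flow is the translation by `w`
in the values of `G`, and the translates of `A` by `t • w` with `|t| ≤ T` have relatively compact
preimage in `U`. Then the integral curve exists for all times through every point near which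
`G` takes values in `A` on `U`; the point itself may lie outside `U`. -/
theorem exists_isMIntegralCurve_of_dense_translation
    (hv : ContMDiff I I.tangent 1 (fun x ↦ (⟨x, v x⟩ : TangentBundle I M)))
    {F : Type*} [AddCommGroup F] [Module ℝ F] {U : Set M} (hU : Dense U) {G : M → F} {w : F}
    (hG : ∀ (a b : ℝ) (γ : ℝ → M), IsMIntegralCurveOn γ v (Ioo a b) → ∀ t₀ ∈ Ioo a b, γ t₀ ∈ U →
      ∀ t ∈ Ioo a b, γ t ∈ U ∧ G (γ t) = G (γ t₀) + (t - t₀) • w)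
    {p : M} {A : Set F} (hA : ∀ᶠ q in 𝓝 p, q ∈ U → G q ∈ A)
    (hK : ∀ T : ℝ, ∃ K : Set M, IsCompact K ∧
      ∀ q ∈ U, ∀ t : ℝ, |t| ≤ T → G q - t • w ∈ A → q ∈ K) :
    ∃ γ : ℝ → M, γ 0 = p ∧ IsMIntegralCurve γ v := by
  refine exists_isMIntegralCurve_of_forall_mem_isCompact hv p fun T ↦ ?_
  obtain ⟨K, hKc, hK⟩ := hK T
  refine ⟨K, hKc, fun a γ ha haT h0 hγ t ht ↦ ?_⟩
  have hQ := eventually_sub_smul_mem_of_isMIntegralCurveOn hv hG ha hγ (by rwa [h0]) ht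
  have hcl : γ t ∈ closure K := by
    rw [mem_closure_iff_nhds]
    intro V hV
    obtain ⟨q, hqV, hqU⟩ := (mem_closure_iff_nhds.1 (hU (γ t))) _ (Filter.inter_mem hV hQ)
    exact ⟨q, hqV.1, hK q hqU t ((abs_lt.2 ht).le.trans haT) (hqV.2 hqU)⟩
  rwa [hKc.isClosed.closure_eq] at hcl

end Flow

/-! ### Smooth involutions -/

section Involution

variable {X : Type*} [TopologicalSpace X] [ChartedSpace (EuclideanSpace ℝ (Fin 4)) X]

/-- A `C¹` involution `g` is the identity near any limit `q` of interior fixed points: in a chart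
its derivative at `q` is the identity, and comparing `g z` with `g (g z) = z` to first order gives
`2 ‖g z - z‖ ≤ ‖g z - z‖` for `z` near `q`. -/
theorem eventually_eq_self_of_involutive [T2Space X] {g : X → X} (hg : ContMDiff (𝓡 4) (𝓡 4) 1 g)
    (hinv : Function.Involutive g) {q : X} (hq : q ∈ closure (interior {p | g p = p})) :
    ∀ᶠ p in 𝓝 q, g p = p := by
  have hgq : g q = q :=
    closure_minimal interior_subset (isClosed_eq hg.continuous continuous_id) hq
  set e := extChartAt (𝓡 4) q with he
  set f : EuclideanSpace ℝ (Fin 4) → EuclideanSpace ℝ (Fin 4) := e ∘ g ∘ e.symm with hf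
  have hqs : q ∈ e.source := mem_extChartAt_source q
  have hsrc : e.source ∈ 𝓝 q := extChartAt_source_mem_nhds q
  have hecont : ContinuousAt e q := continuousAt_extChartAt q
  have hgcont : Filter.Tendsto g (𝓝 q) (𝓝 q) := by
    simpa only [hgq] using (hg.continuous.continuousAt (x := q)).tendsto
  have hsm : ContDiffAt ℝ 1 f (e q) := by
    have h := (contMDiffAt_iff.1 (hg q)).2
    rw [hgq] at h
    have h' : ContDiffWithinAt ℝ 1 f (Set.range (𝓡 4)) (e q) := h
    rwa [ModelWithCorners.range_eq_univ, contDiffWithinAt_univ] at h'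
  -- on the interior of the fixed point set the derivative in the chart is the identity
  have hid : ∀ p ∈ interior {p | g p = p} ∩ e.source,
      fderiv ℝ f (e p) = ContinuousLinearMap.id ℝ _ := by
    rintro p ⟨hp, hps⟩
    have hpt : e p ∈ e.target := e.map_source hps
    have h1 : ∀ᶠ z in 𝓝 (e p), g (e.symm z) = e.symm z := by
      have hc : Filter.Tendsto e.symm (𝓝 (e p)) (𝓝 p) := by
        have := continuousAt_extChartAt_symm'' (I := 𝓡 4) hpt
        rwa [ContinuousAt, ← he, e.left_inv hps] at this
      exact hc.eventually (mem_interior_iff_mem_nhds.1 hp)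
    have h2 : ∀ᶠ z in 𝓝 (e p), z ∈ e.target := (isOpen_extChartAt_target q).mem_nhds hpt
    have h3 : f =ᶠ[𝓝 (e p)] id := by
      filter_upwards [h1, h2] with z hz1 hz2
      simp only [hf, Function.comp_apply, hz1, id, e.right_inv hz2]
    rw [h3.fderiv_eq, fderiv_id]
  have hfd : fderiv ℝ f (e q) = ContinuousLinearMap.id ℝ _ := by
    by_contra hne
    have hc : ContinuousAt (fun p ↦ fderiv ℝ f (e p)) q :=
      ContinuousAt.comp (g := fderiv ℝ f)
        (hsm.fderiv_right (m := 0) (by norm_num)).continuousAt hecont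
    have hev : ∀ᶠ p in 𝓝 q, fderiv ℝ f (e p) ≠ ContinuousLinearMap.id ℝ _ :=
      hc.eventually_ne hne
    obtain ⟨p, ⟨hp1, hp2⟩, hp3⟩ := mem_closure_iff_nhds.1 hq _ (Filter.inter_mem hev hsrc)
    exact hp1 (hid p ⟨hp3, hp2⟩)
  have hstrict : HasStrictFDerivAt f (ContinuousLinearMap.id ℝ _) (e q) := by
    rw [← hfd]
    exact hsm.hasStrictFDerivAt one_ne_zero
  have hO := hstrict.isLittleO.def one_pos
  have htend : Filter.Tendsto (fun p ↦ (e p, e (g p))) (𝓝 q) (𝓝 (e q, e q)) :=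
    hecont.tendsto.prodMk_nhds (hecont.tendsto.comp hgcont)
  filter_upwards [htend.eventually hO, hsrc, hgcont hsrc] with p hp hps hgps
  have hf1 : f (e p) = e (g p) := by simp [hf, e.left_inv hps]
  have hf2 : f (e (g p)) = e p := by
    have : e.symm (e (g p)) = g p := e.left_inv hgps
    simp only [hf, Function.comp_apply, this, hinv p]
  simp only [hf1, hf2, ContinuousLinearMap.id_apply, one_mul] at hp
  have h2 : e (g p) - e p - (e p - e (g p)) = (2 : ℝ) • (e (g p) - e p) := by
    module
  rw [h2, norm_smul, norm_sub_rev (e p)] at hp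
  have h3 : ‖e (g p) - e p‖ = 0 := by
    have := norm_nonneg (e (g p) - e p)
    norm_num at hp
    linarith
  exact e.injOn hgps hps (sub_eq_zero.1 (norm_eq_zero.1 h3))

theorem interior_fixedPoints_eq_empty [T2Space X] [ConnectedSpace X] {g : X → X}
    (hg : ContMDiff (𝓡 4) (𝓡 4) 1 g) (hinv : Function.Involutive g) (hne : ∃ p, g p ≠ p) :
    interior {p | g p = p} = ∅ := by
  have hcl : IsClopen (interior {p | g p = p}) := by
    refine ⟨isClosed_of_closure_subset fun q hq ↦ ?_, isOpen_interior⟩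
    exact mem_interior_iff_mem_nhds.2 (eventually_eq_self_of_involutive hg hinv hq)
  rcases isClopen_iff.1 hcl with h | h
  · exact h
  · obtain ⟨p, hp⟩ := hne
    exact absurd (interior_subset (h ▸ Set.mem_univ p : p ∈ interior {p | g p = p})) hp

end Involution

/-! ### Torus actions -/

section Action

open Set

variable {X : Type*} [TopologicalSpace X] [ChartedSpace (EuclideanSpace ℝ (Fin 4)) X]

namespace TorusAction

variable (τ : TorusAction X)

theorem act_comm (s t : Plane) (p : X) :
    τ.act s (τ.act t p) = τ.act t (τ.act s p) := by
  rw [← τ.add_act, ← τ.add_act, add_comm]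

theorem contMDiff_orbit (p : X) :
    ContMDiff 𝓘(ℝ, Plane) (𝓡 4) ∞ (fun t : Plane ↦ τ.act t p) :=
  τ.smooth.comp (contMDiff_id.prodMk contMDiff_const)

theorem contMDiff_act (t : Plane) : ContMDiff (𝓡 4) (𝓡 4) ∞ (τ.act t) :=
  τ.smooth.comp (contMDiff_const.prodMk contMDiff_id)

theorem mdifferentiable_orbit (p : X) :
    MDifferentiable 𝓘(ℝ, Plane) (𝓡 4) (fun t : Plane ↦ τ.act t p) :=
  (τ.contMDiff_orbit p).mdifferentiable (by simp)

theorem mdifferentiable_act (t : Plane) : MDifferentiable (𝓡 4) (𝓡 4) (τ.act t) :=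
  (τ.contMDiff_act t).mdifferentiable (by simp)

/-- The vector field on `X` that generates the one-parameter subgroup `s ↦ s • b` of the torus. -/
def field (b : Plane) : VField X := fun p ↦
  mfderiv 𝓘(ℝ, Plane) (𝓡 4) (fun t : Plane ↦ τ.act t p) 0 b

theorem generator_eq_field (k : Fin 2) : τ.generator k = τ.field (Pi.single k 1) := by
  funext p
  have h0 : (ContinuousLinearMap.single ℝ (fun _ : Fin 2 ↦ ℝ) k) 0 = (0 : Plane) := by simp
  have h : HasMFDerivAt 𝓘(ℝ, ℝ) 𝓘(ℝ, Plane)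
      (ContinuousLinearMap.single ℝ (fun _ : Fin 2 ↦ ℝ) k) (0 : ℝ)
      (ContinuousLinearMap.single ℝ (fun _ : Fin 2 ↦ ℝ) k) :=
    (ContinuousLinearMap.hasFDerivAt _).hasMFDerivAt
  have h2 : HasMFDerivAt 𝓘(ℝ, Plane) (𝓡 4) (fun t : Plane ↦ τ.act t p)
      ((ContinuousLinearMap.single ℝ (fun _ : Fin 2 ↦ ℝ) k) (0 : ℝ)) _ :=
    (τ.mdifferentiable_orbit p _).hasMFDerivAt
  have h3 := (h2.comp (0 : ℝ) h).mfderiv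
  have h4 : τ.generator k p = mfderiv 𝓘(ℝ, ℝ) (𝓡 4) ((fun t : Plane ↦ τ.act t p) ∘
      (ContinuousLinearMap.single ℝ (fun _ : Fin 2 ↦ ℝ) k)) 0 (1 : ℝ) := rfl
  rw [h4, h3, h0]
  rfl

theorem mfderiv_act_field (t b : Plane) (p : X) :
    mfderiv (𝓡 4) (𝓡 4) (τ.act t) p (τ.field b p) = τ.field b (τ.act t p) := by
  have h1 : HasMFDerivAt 𝓘(ℝ, Plane) (𝓡 4) (fun s : Plane ↦ τ.act s p) 0 _ :=
    (τ.mdifferentiable_orbit p 0).hasMFDerivAt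
  have h2 : HasMFDerivAt (𝓡 4) (𝓡 4) (τ.act t) ((fun s : Plane ↦ τ.act s p) 0) _ :=
    (τ.mdifferentiable_act t _).hasMFDerivAt
  have h3 := (h2.comp (0 : Plane) h1).mfderiv
  have h4 : τ.act t ∘ (fun s : Plane ↦ τ.act s p) = fun s ↦ τ.act s (τ.act t p) := by
    funext s
    exact τ.act_comm t s p
  rw [h4] at h3
  have h5 : τ.field b (τ.act t p)
      = mfderiv 𝓘(ℝ, Plane) (𝓡 4) (fun s ↦ τ.act s (τ.act t p)) 0 b := rfl
  rw [h5, h3]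
  have h6 : (fun s : Plane ↦ τ.act s p) 0 = p := τ.zero_act p
  rw [h6]
  rfl

theorem hasMFDerivAt_orbit (b : Plane) (p : X) (s : ℝ) :
    HasMFDerivAt 𝓘(ℝ, ℝ) (𝓡 4) (fun s : ℝ ↦ τ.act (s • b) p) s
      ((1 : ℝ →L[ℝ] ℝ).smulRight (τ.field b (τ.act (s • b) p))) := by
  set q := τ.act (s • b) p with hq
  have h : HasMFDerivAt 𝓘(ℝ, ℝ) 𝓘(ℝ, Plane) (fun r : ℝ ↦ (r - s) • b) s
      ((1 : ℝ →L[ℝ] ℝ).smulRight b) := by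
    have : HasDerivAt (fun r : ℝ ↦ (r - s) • b) ((1 : ℝ) • b) s :=
      ((hasDerivAt_id s).sub_const s).smul_const b
    rw [one_smul] at this
    exact this.hasFDerivAt.hasMFDerivAt
  set D : Plane →L[ℝ] EuclideanSpace ℝ (Fin 4) :=
    mfderiv 𝓘(ℝ, Plane) (𝓡 4) (fun t : Plane ↦ τ.act t q) 0 with hD
  have h2 : ∀ y : Plane, y = 0 →
      HasMFDerivAt 𝓘(ℝ, Plane) (𝓡 4) (fun t : Plane ↦ τ.act t q) y D := by
    rintro _ rfl
    exact (τ.mdifferentiable_orbit q _).hasMFDerivAt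
  have h3 := (h2 ((fun r : ℝ ↦ (r - s) • b) s) (by simp)).comp s h
  have h4 : (fun t : Plane ↦ τ.act t q) ∘ (fun r : ℝ ↦ (r - s) • b)
      = fun r : ℝ ↦ τ.act (r • b) p := by
    funext r
    simp only [Function.comp_apply, hq]
    rw [← τ.add_act]
    congr 1
    module
  rw [h4] at h3
  refine h3.congr_mfderiv ?_
  ext
  change D ((1 : ℝ) • b) = (1 : ℝ) • D b
  simp only [one_smul]

theorem smoothVField_field [IsManifold (𝓡 4) ∞ X] (b : Plane) : SmoothVField X (τ.field b) := by
  have h1 : ContMDiff ((𝓘(ℝ, Plane).prod (𝓡 4)).tangent) (𝓡 4).tangent ∞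
      (tangentMap (𝓘(ℝ, Plane).prod (𝓡 4)) (𝓡 4) (fun q : Plane × X ↦ τ.act q.1 q.2)) :=
    τ.smooth.contMDiff_tangentMap (by simp)
  have h2 : ContMDiff (𝓡 4) (𝓡 4).tangent ∞
      (fun p : X ↦ (⟨p, 0⟩ : TangentBundle (𝓡 4) X)) :=
    Bundle.contMDiff_zeroSection ℝ (TangentSpace (𝓡 4) : X → Type _)
  have h3 : ContMDiff (𝓡 4) (𝓘(ℝ, Plane).tangent.prod (𝓡 4).tangent) ∞
      (fun p : X ↦ ((⟨0, b⟩ : TangentBundle 𝓘(ℝ, Plane) Plane),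
        (⟨p, 0⟩ : TangentBundle (𝓡 4) X))) :=
    contMDiff_const.prodMk h2
  have h4 := h1.comp ((contMDiff_equivTangentBundleProd_symm (n := ∞) (I := 𝓘(ℝ, Plane))
    (M := Plane) (I' := 𝓡 4) (M' := X)).comp h3)
  have h5 : (fun p ↦ (⟨p, τ.field b p⟩ : TangentBundle (𝓡 4) X))
      = tangentMap (𝓘(ℝ, Plane).prod (𝓡 4)) (𝓡 4) (fun q : Plane × X ↦ τ.act q.1 q.2) ∘
        ((equivTangentBundleProd 𝓘(ℝ, Plane) Plane (𝓡 4) X).symm ∘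
        (fun p : X ↦ ((⟨0, b⟩ : TangentBundle 𝓘(ℝ, Plane) Plane),
        (⟨p, 0⟩ : TangentBundle (𝓡 4) X)))) := by
    funext p
    have hd : HasMFDerivAt (𝓘(ℝ, Plane).prod (𝓡 4)) (𝓡 4) (fun q : Plane × X ↦ τ.act q.1 q.2)
        (0, p) _ := (τ.smooth.mdifferentiable (by simp) (0, p)).hasMFDerivAt
    have hi : HasMFDerivAt 𝓘(ℝ, Plane) (𝓘(ℝ, Plane).prod (𝓡 4)) (fun t : Plane ↦ (t, p)) 0 _ :=
      (hasMFDerivAt_id (0 : Plane)).prodMk (hasMFDerivAt_const p (0 : Plane))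
    have hc := (HasMFDerivAt.comp (0 : Plane) (f := fun t : Plane ↦ (t, p)) hd hi).mfderiv
    have hact : τ.act 0 p = p := τ.zero_act p
    have hval : τ.field b p = mfderiv (𝓘(ℝ, Plane).prod (𝓡 4)) (𝓡 4)
        (fun q : Plane × X ↦ τ.act q.1 q.2) (0, p) (b, (0 : TangentSpace (𝓡 4) p)) := by
      change mfderiv 𝓘(ℝ, Plane) (𝓡 4) ((fun q : Plane × X ↦ τ.act q.1 q.2) ∘
        fun t : Plane ↦ (t, p)) 0 b = _
      rw [hc]
      rfl
    have : ∀ (y : X) (_ : y = p) (w : EuclideanSpace ℝ (Fin 4)),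
        (⟨p, w⟩ : TangentBundle (𝓡 4) X) = ⟨y, w⟩ := by
      rintro y rfl w
      rfl
    rw [hval]
    exact this _ hact _
  unfold SmoothVField
  rw [h5]
  exact h4

end TorusAction

end Action

/-! ### Stabilizers over the edges and density of the open orbits -/

section Region

variable {d : ℕ} {m : Fin d → Fin 2 → ℤ} {c : Fin d → ℝ}

theorem affineForm_eq (b : Fin 2 → ℤ) (e : ℝ) (x : Plane) :
    affineForm b e x = x 0 * (b 0 : ℝ) + x 1 * (b 1 : ℝ) + e := by
  simp [affineForm, Fin.sum_univ_two]

theorem continuous_affineForm (b : Fin 2 → ℤ) (e : ℝ) : Continuous (affineForm b e) := by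
  unfold affineForm
  fun_prop

theorem interior_region (hm : ∀ i, IsCoprime (m i 0) (m i 1)) :
    interior (region m c) = {x | ∀ i, 0 < affineForm (m i) (c i) x} := by
  apply Set.Subset.antisymm
  · intro x hx i
    refine lt_of_le_of_ne (interior_subset hx i) fun h0 ↦ ?_
    -- moving from `x` against the normal leaves the region
    have hcont : Filter.Tendsto (fun ε : ℝ ↦ x - ε • toPlane (m i)) (𝓝 0) (𝓝 x) := by
      have : Continuous (fun ε : ℝ ↦ x - ε • toPlane (m i)) := by fun_prop
      simpa using this.tendsto 0
    have hev := hcont.eventually (mem_interior_iff_mem_nhds.1 hx)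
    obtain ⟨ε, hε, hε0⟩ := ((hev.filter_mono nhdsWithin_le_nhds).and
      (self_mem_nhdsWithin (s := Set.Ioi (0 : ℝ)))).exists
    have h1 := hε i
    rw [affineForm_eq] at h0 h1
    simp only [Pi.sub_apply, Pi.smul_apply, toPlane, smul_eq_mul] at h1
    have hpos : (0 : ℝ) < (m i 0 : ℝ) ^ 2 + (m i 1 : ℝ) ^ 2 := by
      by_contra hle
      have h00 : (m i 0 : ℝ) = 0 := by nlinarith [sq_nonneg (m i 0 : ℝ), sq_nonneg (m i 1 : ℝ)]
      have h01 : (m i 1 : ℝ) = 0 := by nlinarith [sq_nonneg (m i 0 : ℝ), sq_nonneg (m i 1 : ℝ)]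
      have := hm i
      rw [Int.cast_eq_zero.1 h00, Int.cast_eq_zero.1 h01] at this
      exact not_isCoprime_zero_zero this
    have h2 : 0 < ε * ((m i 0 : ℝ) ^ 2 + (m i 1 : ℝ) ^ 2) := mul_pos hε0 hpos
    nlinarith
  · refine interior_maximal (fun x hx i ↦ (hx i).le) ?_
    simp only [Set.ofPred_forall]
    exact isOpen_iInter_of_finite fun i ↦
      isOpen_lt continuous_const (continuous_affineForm _ _)

theorem not_exists_pi_smul_toPlane {b : Fin 2 → ℤ} (hb : IsCoprime (b 0) (b 1)) :
    ¬ ∃ n : Fin 2 → ℤ, Real.pi • toPlane b = fun k => 2 * Real.pi * (n k : ℝ) := by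
  rintro ⟨n, hn⟩
  have h : ∀ k, b k = 2 * n k := by
    intro k
    have h1 := congrFun hn k
    simp only [Pi.smul_apply, toPlane, smul_eq_mul] at h1
    have h2 : Real.pi * ((b k : ℝ) - 2 * (n k : ℝ)) = 0 := by linarith
    rcases mul_eq_zero.1 h2 with h3 | h3
    · exact absurd h3 Real.pi_ne_zero
    · exact_mod_cast sub_eq_zero.1 h3
  obtain ⟨u, v, huv⟩ := hb
  rw [h 0, h 1] at huv
  have h2 : (2 : ℤ) ∣ 1 := ⟨u * n 0 + v * n 1, by linarith⟩
  norm_num at h2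

end Region

section Toric

open Set

variable {X : Type*} [TopologicalSpace X] [ChartedSpace (EuclideanSpace ℝ (Fin 4)) X]

theorem TorusAction.field_eq_sum (τ : TorusAction X) (b : Plane) (p : X) :
    τ.field b p = b 0 • τ.generator 0 p + b 1 • τ.generator 1 p := by
  rw [τ.generator_eq_field, τ.generator_eq_field]
  set D : Plane →L[ℝ] EuclideanSpace ℝ (Fin 4) :=
    mfderiv 𝓘(ℝ, Plane) (𝓡 4) (fun t : Plane ↦ τ.act t p) 0
  change D b = b 0 • D (Pi.single 0 1) + b 1 • D (Pi.single 1 1)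
  rw [← map_smul, ← map_smul, ← map_add]
  congr 1
  funext k
  fin_cases k <;> simp

variable [IsManifold (𝓡 4) ∞ X] (S : SymplecticToric X)

theorem SymplecticForm.form_swap (Ω : SymplecticForm X) (p : X) (v w : TangentSpace (𝓡 4) p) :
    Ω.form p v w = -Ω.form p w v := by
  have h := Ω.alternating p (v + w)
  have h1 := Ω.alternating p v
  have h2 := Ω.alternating p w
  rw [map_add, map_add, add_apply, add_apply, h1, h2] at h
  linarith

namespace SymplecticToric

theorem hasMFDerivAt_μ (p : X) :
    HasMFDerivAt (𝓡 4) 𝓘(ℝ, Plane) S.μ p (mfderiv (𝓡 4) 𝓘(ℝ, Plane) S.μ p) :=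
  (S.μ_smooth.mdifferentiable (by simp) p).hasMFDerivAt

/-- At a minimum of a component of the moment map the generator of that component vanishes. -/
theorem field_eq_zero_of_affineForm_eq_zero {b : Fin 2 → ℤ} {e : ℝ}
    (hpos : ∀ p, 0 ≤ affineForm b e (S.μ p)) {q : X} (hq : affineForm b e (S.μ q) = 0) :
    S.τ.field (toPlane b) q = 0 := by
  set A : Plane →L[ℝ] ℝ := (b 0 : ℝ) • ContinuousLinearMap.proj (R := ℝ) 0
    + (b 1 : ℝ) • ContinuousLinearMap.proj (R := ℝ) 1 with hA
  have hder : HasFDerivAt (affineForm b e) A (S.μ q) := by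
    have h1 : HasFDerivAt (fun x : Plane ↦ A x + e) A (S.μ q) := A.hasFDerivAt.add_const e
    have h2 : affineForm b e = fun x : Plane ↦ A x + e := by
      funext x
      rw [affineForm_eq]
      simp [hA]
      ring
    rwa [h2]
  have hcomp := (hder.hasMFDerivAt (x := S.μ q)).comp q (S.hasMFDerivAt_μ q)
  set D : EuclideanSpace ℝ (Fin 4) →L[ℝ] Plane := mfderiv (𝓡 4) 𝓘(ℝ, Plane) S.μ q with hD
  have hchart : HasFDerivAt (fun z ↦ affineForm b e (S.μ ((extChartAt (𝓡 4) q).symm z))) (A ∘L D)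
      (extChartAt (𝓡 4) q q) := by
    have h : HasFDerivWithinAt (fun z ↦ affineForm b e (S.μ ((extChartAt (𝓡 4) q).symm z)))
        (A ∘L D) (range (𝓡 4)) (extChartAt (𝓡 4) q q) := hcomp.2
    rwa [ModelWithCorners.range_eq_univ, hasFDerivWithinAt_univ] at h
  have hmin : IsLocalMin (fun z ↦ affineForm b e (S.μ ((extChartAt (𝓡 4) q).symm z)))
      (extChartAt (𝓡 4) q q) := by
    refine Filter.Eventually.of_forall fun z ↦ ?_
    simp only [extChartAt_to_inv, hq]
    exact hpos _
  have hzero := hmin.hasFDerivAt_eq_zero hchart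
  apply S.symp.nondegenerate
  intro w
  rw [S.symp.form_swap, neg_eq_zero, S.τ.field_eq_sum, map_add, map_smul, map_smul,
    ← S.hamiltonian, ← S.hamiltonian]
  have h : A (D w) = 0 := congrArg (fun L : EuclideanSpace ℝ (Fin 4) →L[ℝ] ℝ ↦ L w) hzero
  change (b 0 : ℝ) * D w 0 + (b 1 : ℝ) * D w 1 = 0
  simpa [hA] using h

variable [T2Space X]

/-- Over the edge with normal `b` the circle generated by `b` acts trivially. -/
theorem act_smul_eq_self_of_affineForm_eq_zero {b : Fin 2 → ℤ} {e : ℝ}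
    (hpos : ∀ p, 0 ≤ affineForm b e (S.μ p)) {q : X} (hq : affineForm b e (S.μ q) = 0) (s : ℝ) :
    S.τ.act (s • toPlane b) q = q := by
  have h0 := S.field_eq_zero_of_affineForm_eq_zero hpos hq
  have h1 : IsMIntegralCurve (I := 𝓡 4) (fun s : ℝ ↦ S.τ.act (s • toPlane b) q)
      (S.τ.field (toPlane b)) := fun s ↦ S.τ.hasMFDerivAt_orbit (toPlane b) q s
  have h2 : IsMIntegralCurve (I := 𝓡 4) (fun _ : ℝ ↦ q) (S.τ.field (toPlane b)) :=
    isMIntegralCurve_const h0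
  have h3 := isMIntegralCurve_Ioo_eq_of_contMDiff_boundaryless (t₀ := 0)
    ((S.τ.smoothVField_field (toPlane b)).of_le (by simp)) h1 h2
    (by simp only [zero_smul, S.τ.zero_act])
  exact congrFun h3 s

theorem interior_fixedPoints_pi_smul [ConnectedSpace X] {b : Fin 2 → ℤ}
    (hb : IsCoprime (b 0) (b 1)) :
    interior {p | S.τ.act (Real.pi • toPlane b) p = p} = ∅ := by
  refine interior_fixedPoints_eq_empty ((S.τ.contMDiff_act _).of_le (by simp)) ?_ ?_
  · intro p
    rw [← S.τ.add_act]
    refine (S.τ.effective _).2 ⟨b, ?_⟩ p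
    funext k
    simp only [Pi.add_apply, Pi.smul_apply, toPlane, smul_eq_mul]
    ring
  · by_contra hne
    push Not at hne
    exact not_exists_pi_smul_toPlane hb ((S.τ.effective _).1 hne)

/-- The open orbits are dense: over the edge `i` the torus element `π m_i`, an involution, fixes all
points, and the fixed point set of a nontrivial involution has empty interior. -/
theorem dense_preimage_interior [ConnectedSpace X] {d : ℕ} {m : Fin d → Fin 2 → ℤ}
    {c : Fin d → ℝ} (hm : ∀ i, IsCoprime (m i 0) (m i 1)) (hμ : range S.μ = region m c) :
    Dense (S.μ ⁻¹' interior (range S.μ)) := by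
  set F : Fin d → Set X := fun i ↦ {p | S.τ.act (Real.pi • toPlane (m i)) p = p} with hF
  have hclosed : ∀ i, IsClosed (F i) := fun i ↦
    isClosed_eq (S.τ.contMDiff_act _).continuous continuous_id
  have hdense : Dense (⋂₀ range fun i ↦ (F i)ᶜ) := by
    refine (finite_range _).dense_sInter ?_ ?_
    · rintro _ ⟨i, rfl⟩
      exact (hclosed i).isOpen_compl
    · rintro _ ⟨i, rfl⟩
      exact interior_eq_empty_iff_dense_compl.1 (S.interior_fixedPoints_pi_smul (hm i))
  refine hdense.mono fun p hp ↦ ?_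
  rw [mem_preimage, hμ, interior_region hm]
  intro i
  have hreg : ∀ p, 0 ≤ affineForm (m i) (c i) (S.μ p) := fun p ↦
    (hμ ▸ mem_range_self p : S.μ p ∈ region m c) i
  refine lt_of_le_of_ne (hreg p) fun h0 ↦ ?_
  exact (mem_sInter.1 hp _ ⟨i, rfl⟩)
    (S.act_smul_eq_self_of_affineForm_eq_zero hreg h0.symm Real.pi)

end SymplecticToric

end Toric

/-! ### The vector fields `J Y_k` over the interior of the polygon -/

section ComplexFlow

open Set

variable {X : Type*} [TopologicalSpace X] [ChartedSpace (EuclideanSpace ℝ (Fin 4)) X]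
  [IsManifold (𝓡 4) ∞ X] {S : SymplecticToric X}
  {J : ∀ p : X, TangentSpace (𝓡 4) p →L[ℝ] TangentSpace (𝓡 4) p}

theorem IsToricComplexStructure.contMDiff_generator (hJ : IsToricComplexStructure S J) (k : Fin 2) :
    ContMDiff (𝓡 4) (𝓡 4).tangent 1
      (fun p ↦ (⟨p, J p (S.τ.generator k p)⟩ : TangentBundle (𝓡 4) X)) := by
  have h1 : SmoothVField X (S.τ.generator k) := by
    rw [S.τ.generator_eq_field]
    exact S.τ.smoothVField_field _
  exact (ContMDiff.clm_bundle_apply hJ.smooth h1).of_le (by simp)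

theorem IsToricComplexStructure.isMIntegralCurveOn_act (hJ : IsToricComplexStructure S J)
    {k : Fin 2} {γ : ℝ → X} {s : Set ℝ}
    (hγ : IsMIntegralCurveOn γ (fun p ↦ J p (S.τ.generator k p)) s) (t : Plane) :
    IsMIntegralCurveOn (fun r ↦ S.τ.act t (γ r)) (fun p ↦ J p (S.τ.generator k p)) s := by
  intro r hr
  have h1 : HasMFDerivAt (𝓡 4) (𝓡 4) (S.τ.act t) (γ r) _ :=
    (S.τ.mdifferentiable_act t (γ r)).hasMFDerivAt
  refine (h1.comp_hasMFDerivWithinAt r (hγ r hr)).congr_mfderiv ?_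
  have h2 := hJ.invariant t (γ r) (S.τ.generator k (γ r))
  rw [S.τ.generator_eq_field, S.τ.mfderiv_act_field] at h2
  ext
  rw [S.τ.generator_eq_field]
  set D : EuclideanSpace ℝ (Fin 4) →L[ℝ] EuclideanSpace ℝ (Fin 4) :=
    mfderiv (𝓡 4) (𝓡 4) (S.τ.act t) (γ r)
  have h3 : ∀ v w : EuclideanSpace ℝ (Fin 4), D v = w → D ((1 : ℝ) • v) = (1 : ℝ) • w := by
    rintro v _ rfl
    rw [one_smul, one_smul]
  exact h3 _ _ h2

theorem IsActionAngle.act_eq_self {Φ : Plane × Plane → X} (hΦ : IsActionAngle S Φ) {p : X}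
    (hp : S.μ p ∈ interior (range S.μ)) {t : Plane} (ht : S.τ.act t p = p) :
    ∃ n : Fin 2 → ℤ, t = fun k => 2 * Real.pi * (n k : ℝ) := by
  obtain ⟨θ, hθ⟩ := hΦ.surjective p hp
  have h1 := hΦ.equivariant _ hp θ t
  rw [hθ, ht, ← hθ, hΦ.moment _ hp] at h1
  obtain ⟨n, hn⟩ := hΦ.injective _ hp _ _ h1
  exact ⟨n, by rw [← hn]; simp⟩

/-- Integral curves of `J Y_k` do not leave the open orbits: at a point over an edge the curve would
be fixed by a circle, by uniqueness, but the action is free over the interior. -/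
theorem IsToricComplexStructure.mem_interior_of_isMIntegralCurveOn [T2Space X]
    (hJ : IsToricComplexStructure S J) {Φ : Plane × Plane → X} (hΦ : IsActionAngle S Φ)
    {d : ℕ} {m : Fin d → Fin 2 → ℤ} {c : Fin d → ℝ}
    (hm : ∀ i, IsCoprime (m i 0) (m i 1)) (hμ : range S.μ = region m c)
    {k : Fin 2} {γ : ℝ → X} {a b : ℝ}
    (hγ : IsMIntegralCurveOn γ (fun p ↦ J p (S.τ.generator k p)) (Ioo a b)) {t₀ t : ℝ}
    (ht₀ : t₀ ∈ Ioo a b) (h₀ : S.μ (γ t₀) ∈ interior (range S.μ)) (ht : t ∈ Ioo a b) :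
    S.μ (γ t) ∈ interior (range S.μ) := by
  rw [hμ, interior_region hm]
  intro i
  have hreg : ∀ p, 0 ≤ affineForm (m i) (c i) (S.μ p) := fun p ↦
    (hμ ▸ mem_range_self p : S.μ p ∈ region m c) i
  refine lt_of_le_of_ne (hreg _) fun h0 ↦ ?_
  have hfix := S.act_smul_eq_self_of_affineForm_eq_zero hreg h0.symm Real.pi
  have heq := isMIntegralCurveOn_Ioo_eqOn_of_contMDiff_boundaryless ht
    (hJ.contMDiff_generator k) (hJ.isMIntegralCurveOn_act hγ (Real.pi • toPlane (m i))) hγ hfix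
  exact not_exists_pi_smul_toPlane (hm i) (hΦ.act_eq_self h₀ (heq ht₀))

theorem IsActionAngle.mdifferentiableAt {Φ : Plane × Plane → X} (hΦ : IsActionAngle S Φ)
    {x : Plane} (hx : x ∈ interior (range S.μ)) (θ : Plane) :
    MDifferentiableAt 𝓘(ℝ, Plane × Plane) (𝓡 4) Φ (x, θ) :=
  (hΦ.smooth.contMDiffAt
    ((isOpen_interior.prod isOpen_univ).mem_nhds ⟨hx, mem_univ θ⟩)).mdifferentiableAt (by simp)

theorem IsActionAngle.generator_eq {Φ : Plane × Plane → X} (hΦ : IsActionAngle S Φ)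
    {x : Plane} (hx : x ∈ interior (range S.μ)) (θ : Plane) (k : Fin 2) :
    S.τ.generator k (Φ (x, θ))
      = mfderiv 𝓘(ℝ, Plane × Plane) (𝓡 4) Φ (x, θ) ((0, Pi.single k 1) : Plane × Plane) := by
  have h1 : HasMFDerivAt 𝓘(ℝ, ℝ) 𝓘(ℝ, Plane × Plane)
      (fun s : ℝ ↦ ((x, θ + s • Pi.single k 1) : Plane × Plane)) 0
      ((1 : ℝ →L[ℝ] ℝ).smulRight ((0, Pi.single k 1) : Plane × Plane)) := by
    have h2 : HasDerivAt (fun s : ℝ ↦ ((x, θ + s • Pi.single k 1) : Plane × Plane))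
        (0, (1 : ℝ) • Pi.single k 1) 0 :=
      (hasDerivAt_const (0 : ℝ) x).prodMk
        (((hasDerivAt_id (0 : ℝ)).smul_const (Pi.single k (1 : ℝ) : Plane)).const_add θ)
    rw [one_smul] at h2
    exact h2.hasFDerivAt.hasMFDerivAt
  set D : Plane × Plane →L[ℝ] EuclideanSpace ℝ (Fin 4) :=
    mfderiv 𝓘(ℝ, Plane × Plane) (𝓡 4) Φ (x, θ) with hD
  have h3 : ∀ y : Plane × Plane, y = (x, θ) →
      HasMFDerivAt 𝓘(ℝ, Plane × Plane) (𝓡 4) Φ y D := by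
    rintro _ rfl
    exact (hΦ.mdifferentiableAt hx θ).hasMFDerivAt
  have h4 := ((h3 ((fun s : ℝ ↦ ((x, θ + s • Pi.single k 1) : Plane × Plane)) 0)
    (by simp)).comp (0 : ℝ) h1).mfderiv
  have h5 : Φ ∘ (fun s : ℝ ↦ ((x, θ + s • Pi.single k 1) : Plane × Plane))
      = fun s : ℝ ↦ S.τ.act (Pi.single k s) (Φ (x, θ)) := by
    funext s
    rw [Function.comp_apply, hΦ.equivariant x hx]
    congr 1
    rw [← Pi.single_smul]
    simp
  rw [h5] at h4
  change mfderiv 𝓘(ℝ, ℝ) (𝓡 4) (fun s : ℝ ↦ S.τ.act (Pi.single k s) (Φ (x, θ))) 0 (1 : ℝ) = _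
  rw [h4]
  change D ((1 : ℝ) • ((0, Pi.single k 1) : Plane × Plane)) = _
  rw [one_smul]
  rfl

theorem IsActionAngle.mfderiv_μ {Φ : Plane × Plane → X} (hΦ : IsActionAngle S Φ)
    {x : Plane} (hx : x ∈ interior (range S.μ)) (θ : Plane) (v : Plane × Plane) :
    mfderiv (𝓡 4) 𝓘(ℝ, Plane) S.μ (Φ (x, θ))
      (mfderiv 𝓘(ℝ, Plane × Plane) (𝓡 4) Φ (x, θ) v) = v.1 := by
  have h1 : HasMFDerivAt 𝓘(ℝ, Plane × Plane) (𝓡 4) Φ (x, θ) _ :=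
    (hΦ.mdifferentiableAt hx θ).hasMFDerivAt
  have h2 := (S.hasMFDerivAt_μ (Φ (x, θ))).comp (x, θ) h1
  have h3 : (S.μ ∘ Φ) =ᶠ[𝓝 (x, θ)] Prod.fst := by
    filter_upwards [(isOpen_interior.prod isOpen_univ).mem_nhds ⟨hx, mem_univ θ⟩] with y hy
    exact hΦ.moment y.1 hy.1 y.2
  have h4 : HasFDerivAt (S.μ ∘ Φ) (ContinuousLinearMap.fst ℝ Plane Plane) (x, θ) :=
    (ContinuousLinearMap.fst ℝ Plane Plane).hasFDerivAt.congr_of_eventuallyEq h3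
  have h5 := hasMFDerivAt_unique h2 h4.hasMFDerivAt
  exact congrArg (fun L : Plane × Plane →L[ℝ] Plane ↦ L v) h5

/-- The Hessian is invertible: otherwise `⁻¹` would be the junk value `0`, and `J ∂θ = 0`. -/
theorem hessian_isUnit_det (hJ : IsToricComplexStructure S J) {u : Plane → ℝ}
    {Φ : Plane × Plane → X} (hΦ : IsActionAngle S Φ)
    (hJu : ∀ x ∈ interior (range S.μ), ∀ θ, ∀ v : Plane × Plane,
      J (Φ (x, θ)) (mfderiv 𝓘(ℝ, Plane × Plane) (𝓡 4) Φ (x, θ) v)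
        = mfderiv 𝓘(ℝ, Plane × Plane) (𝓡 4) Φ (x, θ)
            ((-((hessian u x)⁻¹.mulVec v.2), (hessian u x).mulVec v.1) : Plane × Plane))
    {x : Plane} (hx : x ∈ interior (range S.μ)) : IsUnit (hessian u x).det := by
  by_contra hdet
  have hinv : (hessian u x)⁻¹ = 0 := Matrix.nonsing_inv_apply_not_isUnit _ hdet
  have h1 := hJu x hx 0 (0, Pi.single 0 1)
  have h2 := hJ.sq (Φ (x, 0))
    (mfderiv 𝓘(ℝ, Plane × Plane) (𝓡 4) Φ (x, 0) ((0, Pi.single 0 1) : Plane × Plane))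
  rw [h1, hinv, hJu x hx, hinv] at h2
  simp only [Matrix.zero_mulVec, Matrix.mulVec_zero, neg_zero] at h2
  have hne : ((0, Pi.single 0 1) : Plane × Plane) ≠ 0 := by
    intro h
    have := congrFun (congrArg Prod.snd h) 0
    simp at this
  -- the differential of `Φ` is injective because `Φ` is symplectic
  have h3 := hΦ.symplectic x hx 0 (0, Pi.single 0 1) (Pi.single 0 1, 0)
  set D : Plane × Plane →L[ℝ] EuclideanSpace ℝ (Fin 4) :=
    mfderiv 𝓘(ℝ, Plane × Plane) (𝓡 4) Φ (x, 0) with hD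
  have h4 : D (0, Pi.single 0 1) = 0 := by
    have h5 : D ((0, 0) : Plane × Plane) = -D (0, Pi.single 0 1) := h2
    rw [← neg_eq_zero, ← h5, Prod.mk_zero_zero, map_zero]
  have h6 : S.symp.form (Φ (x, 0)) (D (0, Pi.single 0 1)) = 0 := by
    rw [h4]
    exact map_zero _
  change S.symp.form (Φ (x, 0)) (D (0, Pi.single 0 1)) _ = _ at h3
  rw [h6] at h3
  simp [Fin.sum_univ_two] at h3

/-- Along integral curves of `J Y_k` over the interior of the polygon the gradient of the potential
has constant derivative `-e_k`: `J Y_k` projects to `-U⁻¹ e_k`, and `U` is the derivative of the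
gradient. -/
theorem hasDerivAt_gradient_comp (hJ : IsToricComplexStructure S J) {u : Plane → ℝ}
    (hu : ContDiffOn ℝ ∞ u (interior (range S.μ)))
    {Φ : Plane × Plane → X} (hΦ : IsActionAngle S Φ)
    (hJu : ∀ x ∈ interior (range S.μ), ∀ θ, ∀ v : Plane × Plane,
      J (Φ (x, θ)) (mfderiv 𝓘(ℝ, Plane × Plane) (𝓡 4) Φ (x, θ) v)
        = mfderiv 𝓘(ℝ, Plane × Plane) (𝓡 4) Φ (x, θ)
            ((-((hessian u x)⁻¹.mulVec v.2), (hessian u x).mulVec v.1) : Plane × Plane))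
    {k : Fin 2} {γ : ℝ → X} {t : ℝ}
    (hγ : HasMFDerivAt 𝓘(ℝ, ℝ) (𝓡 4) γ t
      ((1 : ℝ →L[ℝ] ℝ).smulRight (J (γ t) (S.τ.generator k (γ t)))))
    (ht : S.μ (γ t) ∈ interior (range S.μ)) (j : Fin 2) :
    HasDerivAt (fun s ↦ fderiv ℝ u (S.μ (γ s)) (Pi.single j 1))
      (-(Pi.single k 1 : Plane) j) t := by
  set x := S.μ (γ t) with hx
  obtain ⟨θ, hθ⟩ := hΦ.surjective _ ht
  have h1 : mfderiv (𝓡 4) 𝓘(ℝ, Plane) S.μ (γ t) (J (γ t) (S.τ.generator k (γ t)))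
      = -((hessian u x)⁻¹.mulVec (Pi.single k 1)) := by
    rw [← hθ, hΦ.generator_eq ht, hJu x ht, hΦ.mfderiv_μ ht]
  have h2 : HasDerivAt (fun s ↦ S.μ (γ s)) (-((hessian u x)⁻¹.mulVec (Pi.single k 1))) t := by
    set D : EuclideanSpace ℝ (Fin 4) →L[ℝ] Plane := mfderiv (𝓡 4) 𝓘(ℝ, Plane) S.μ (γ t)
    set w : EuclideanSpace ℝ (Fin 4) := J (γ t) (S.τ.generator k (γ t))
    have h3 : HasFDerivAt (fun s ↦ S.μ (γ s)) (D ∘L ((1 : ℝ →L[ℝ] ℝ).smulRight w)) t :=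
      hasMFDerivAt_iff_hasFDerivAt.1 ((S.hasMFDerivAt_μ (γ t)).comp t hγ)
    refine h3.hasDerivAt.congr_deriv ?_
    have h4 : D w = -((hessian u x)⁻¹.mulVec (Pi.single k 1)) := h1
    rw [← h4]
    change D ((1 : ℝ) • w) = D w
    rw [one_smul]
  have hcd : ContDiffAt ℝ ∞ u x := hu.contDiffAt (isOpen_interior.mem_nhds ht)
  have hcd1 : ContDiffAt ℝ 1 (fderiv ℝ u) x := hcd.fderiv_right (by norm_cast)
  have hd : DifferentiableAt ℝ (fderiv ℝ u) x := hcd1.differentiableAt (by norm_num)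
  have hd2 : ∀ i : Fin 2, HasFDerivAt (fun y ↦ fderiv ℝ u y (Pi.single i 1))
      ((ContinuousLinearMap.apply ℝ ℝ (Pi.single i 1 : Plane)) ∘L fderiv ℝ (fderiv ℝ u) x) x :=
    fun i ↦ (ContinuousLinearMap.apply ℝ ℝ (Pi.single i 1 : Plane)).hasFDerivAt.comp x
      hd.hasFDerivAt
  have hsymm : IsSymmSndFDerivAt ℝ u x := by
    refine hcd.isSymmSndFDerivAt ?_
    rw [minSmoothness_of_isRCLikeNormedField]
    exact WithTop.coe_le_coe.2 (le_top : (2 : ℕ∞) ≤ ⊤)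
  have hhess : ∀ i l,
      hessian u x i l = fderiv ℝ (fderiv ℝ u) x (Pi.single i 1) (Pi.single l 1) := by
    intro i l
    rw [hessian, Matrix.of_apply, (hd2 l).fderiv]
    rfl
  have h7 : ∀ w : Plane, fderiv ℝ (fderiv ℝ u) x w (Pi.single j 1)
      = (hessian u x).mulVec w j := by
    intro w
    have hw : w = w 0 • Pi.single 0 1 + w 1 • Pi.single 1 1 := by
      funext i
      fin_cases i <;> simp
    conv_lhs => rw [hw]
    simp only [Matrix.mulVec, dotProduct, Fin.sum_univ_two, hhess]
    rw [map_add, map_smul, map_smul, add_apply,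
      smul_apply, smul_apply,
      hsymm.eq (Pi.single j 1), hsymm.eq (Pi.single j 1)]
    simp only [smul_eq_mul]
    ring
  refine ((hd2 j).comp_hasDerivAt t h2).congr_deriv ?_
  change fderiv ℝ (fderiv ℝ u) x _ (Pi.single j 1) = _
  rw [h7, Matrix.mulVec_neg, Matrix.mulVec_mulVec,
    Matrix.mul_nonsing_inv _ (hessian_isUnit_det hJ hΦ hJu ht), Matrix.one_mulVec]
  rfl

end ComplexFlow

/-! ### Axially symmetric potentials on the half-plane -/

section Axial

variable {n : ℕ}

/-- The function `c₀ log r + ½ ∑ (c_{i+1} - c_i) log (H + a_i + √((H + a_i)² + r²)) + κ H` of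
`p = (H, r)`. -/
def axialPotential (a : Fin n → ℝ) (c : Fin (n + 1) → ℝ) (κ : ℝ) (p : ℝ × ℝ) : ℝ :=
  c 0 * Real.log p.2
    + 1 / 2 * ∑ i : Fin n, (c i.succ - c i.castSucc)
        * Real.log (p.1 + a i + Real.sqrt ((p.1 + a i) ^ 2 + p.2 ^ 2))
    + κ * p.1

/-- The explicit primitive of `conjForm (axialPotential a c κ)`. -/
def axialConjugate (a : Fin n → ℝ) (c : Fin (n + 1) → ℝ) (κ : ℝ) (p : ℝ × ℝ) : ℝ :=
  1 / 2 * (c 0 + c (Fin.last n)) * p.1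
    - 1 / 2 * ∑ i : Fin n, (c i.succ - c i.castSucc) * Real.sqrt ((p.1 + a i) ^ 2 + p.2 ^ 2)
    - κ * p.2 ^ 2 / 2

theorem sum_succ_sub_castSucc (c : Fin (n + 1) → ℝ) :
    ∑ i : Fin n, (c i.succ - c i.castSucc) = c (Fin.last n) - c 0 := by
  rw [Finset.sum_sub_distrib]
  have h1 := Fin.sum_univ_succ c
  have h2 := Fin.sum_univ_castSucc c
  linarith

theorem sqrt_sq_add_sq_pos (h : ℝ) {r : ℝ} (hr : 0 < r) : 0 < Real.sqrt (h ^ 2 + r ^ 2) :=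
  Real.sqrt_pos.2 (by positivity)

theorem add_sqrt_sq_add_sq_pos (h : ℝ) {r : ℝ} (hr : 0 < r) :
    0 < h + Real.sqrt (h ^ 2 + r ^ 2) := by
  have : |h| < Real.sqrt (h ^ 2 + r ^ 2) := by
    apply Real.lt_sqrt_of_sq_lt
    rw [sq_abs]
    nlinarith
  linarith [neg_abs_le h]

theorem hasFDerivAt_sqrt (b : ℝ) {p : ℝ × ℝ} (hp : 0 < p.2) :
    HasFDerivAt (fun q : ℝ × ℝ ↦ Real.sqrt ((q.1 + b) ^ 2 + q.2 ^ 2))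
      (((p.1 + b) / Real.sqrt ((p.1 + b) ^ 2 + p.2 ^ 2)) • ContinuousLinearMap.fst ℝ ℝ ℝ
        + (p.2 / Real.sqrt ((p.1 + b) ^ 2 + p.2 ^ 2)) • ContinuousLinearMap.snd ℝ ℝ ℝ) p := by
  have hρ := sqrt_sq_add_sq_pos (p.1 + b) hp
  have hfst : HasFDerivAt (fun q : ℝ × ℝ ↦ q.1) (ContinuousLinearMap.fst ℝ ℝ ℝ) p :=
    hasFDerivAt_fst
  have hsnd : HasFDerivAt (fun q : ℝ × ℝ ↦ q.2) (ContinuousLinearMap.snd ℝ ℝ ℝ) p :=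
    hasFDerivAt_snd
  have h1 : HasFDerivAt (fun q : ℝ × ℝ ↦ (q.1 + b) ^ 2 + q.2 ^ 2) _ p :=
    ((hfst.add_const b).pow 2).add (hsnd.pow 2)
  have h2 := h1.sqrt (by positivity)
  refine h2.congr_fderiv ?_
  ext <;> simp <;> field_simp

theorem hasFDerivAt_axialPotential (a : Fin n → ℝ) (c : Fin (n + 1) → ℝ) (κ : ℝ) {p : ℝ × ℝ}
    (hp : 0 < p.2) :
    HasFDerivAt (axialPotential a c κ)
      ((κ + 1 / 2 * ∑ i : Fin n, (c i.succ - c i.castSucc)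
          * (1 / Real.sqrt ((p.1 + a i) ^ 2 + p.2 ^ 2))) • ContinuousLinearMap.fst ℝ ℝ ℝ
        + (c 0 / p.2 + 1 / 2 * ∑ i : Fin n, (c i.succ - c i.castSucc)
          * ((1 - (p.1 + a i) / Real.sqrt ((p.1 + a i) ^ 2 + p.2 ^ 2)) / p.2))
          • ContinuousLinearMap.snd ℝ ℝ ℝ) p := by
  have hlog : ∀ i : Fin n, HasFDerivAt
      (fun q : ℝ × ℝ ↦ Real.log (q.1 + a i + Real.sqrt ((q.1 + a i) ^ 2 + q.2 ^ 2)))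
      ((1 / Real.sqrt ((p.1 + a i) ^ 2 + p.2 ^ 2)) • ContinuousLinearMap.fst ℝ ℝ ℝ
        + ((1 - (p.1 + a i) / Real.sqrt ((p.1 + a i) ^ 2 + p.2 ^ 2)) / p.2)
          • ContinuousLinearMap.snd ℝ ℝ ℝ) p := by
    intro i
    have hρ := sqrt_sq_add_sq_pos (p.1 + a i) hp
    have hs := add_sqrt_sq_add_sq_pos (p.1 + a i) hp
    have h1 : HasFDerivAt (fun q : ℝ × ℝ ↦ q.1 + a i) (ContinuousLinearMap.fst ℝ ℝ ℝ) p :=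
      hasFDerivAt_fst.add_const (a i)
    have h2 : HasFDerivAt
        (fun q : ℝ × ℝ ↦ Real.log (q.1 + a i + Real.sqrt ((q.1 + a i) ^ 2 + q.2 ^ 2)))
        ((p.1 + a i + Real.sqrt ((p.1 + a i) ^ 2 + p.2 ^ 2))⁻¹ • _) p :=
      (h1.add (hasFDerivAt_sqrt (a i) hp)).log hs.ne'
    refine h2.congr_fderiv ?_
    have hsq : Real.sqrt ((p.1 + a i) ^ 2 + p.2 ^ 2) ^ 2 = (p.1 + a i) ^ 2 + p.2 ^ 2 :=
      Real.sq_sqrt (by positivity)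
    set ρ := Real.sqrt ((p.1 + a i) ^ 2 + p.2 ^ 2)
    set h := p.1 + a i
    have hs' : h + ρ ≠ 0 := hs.ne'
    ext
    · simp
      field_simp
      ring
    · simp
      field_simp
      linarith
  have hsum : HasFDerivAt (fun q : ℝ × ℝ ↦ ∑ i : Fin n, (c i.succ - c i.castSucc)
      * Real.log (q.1 + a i + Real.sqrt ((q.1 + a i) ^ 2 + q.2 ^ 2))) _ p :=
    HasFDerivAt.fun_sum fun i _ ↦ (hlog i).const_mul (c i.succ - c i.castSucc)
  have hr : HasFDerivAt (fun q : ℝ × ℝ ↦ Real.log q.2) _ p := hasFDerivAt_snd.log hp.ne'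
  have hfst : HasFDerivAt (fun q : ℝ × ℝ ↦ q.1) (ContinuousLinearMap.fst ℝ ℝ ℝ) p :=
    hasFDerivAt_fst
  have h := ((hr.const_mul (c 0)).add (hsum.const_mul (1 / 2))).add (hfst.const_mul κ)
  refine h.congr_fderiv ?_
  ext
  · simp
    ring
  · simp
    ring

theorem hasFDerivAt_axialConjugate' (a : Fin n → ℝ) (c : Fin (n + 1) → ℝ) (κ : ℝ) {p : ℝ × ℝ}
    (hp : 0 < p.2) :
    HasFDerivAt (axialConjugate a c κ)
      ((1 / 2 * (c 0 + c (Fin.last n)) - 1 / 2 * ∑ i : Fin n, (c i.succ - c i.castSucc)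
          * ((p.1 + a i) / Real.sqrt ((p.1 + a i) ^ 2 + p.2 ^ 2))) • ContinuousLinearMap.fst ℝ ℝ ℝ
        - (1 / 2 * ∑ i : Fin n, (c i.succ - c i.castSucc)
          * (p.2 / Real.sqrt ((p.1 + a i) ^ 2 + p.2 ^ 2)) + κ * p.2)
          • ContinuousLinearMap.snd ℝ ℝ ℝ) p := by
  have hsum : HasFDerivAt (fun q : ℝ × ℝ ↦ ∑ i : Fin n, (c i.succ - c i.castSucc)
      * Real.sqrt ((q.1 + a i) ^ 2 + q.2 ^ 2)) _ p :=
    HasFDerivAt.fun_sum fun i _ ↦ (hasFDerivAt_sqrt (a i) hp).const_mul (c i.succ - c i.castSucc)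
  have hfst : HasFDerivAt (fun q : ℝ × ℝ ↦ q.1) (ContinuousLinearMap.fst ℝ ℝ ℝ) p :=
    hasFDerivAt_fst
  have hsnd' : HasFDerivAt (fun q : ℝ × ℝ ↦ q.2) (ContinuousLinearMap.snd ℝ ℝ ℝ) p :=
    hasFDerivAt_snd
  have hsnd : HasFDerivAt (fun q : ℝ × ℝ ↦ q.2 ^ 2) _ p := hsnd'.pow 2
  have h := ((hfst.const_mul (1 / 2 * (c 0 + c (Fin.last n)))).sub (hsum.const_mul (1 / 2))).sub
    ((hsnd.const_mul κ).mul_const (2⁻¹))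
  simp only [← div_eq_mul_inv] at h
  refine h.congr_fderiv ?_
  ext
  · simp
  · simp
    ring

theorem hasFDerivAt_axialConjugate (a : Fin n → ℝ) (c : Fin (n + 1) → ℝ) (κ : ℝ) {p : ℝ × ℝ}
    (hp : 0 < p.2) :
    HasFDerivAt (axialConjugate a c κ) (conjForm (axialPotential a c κ) p) p := by
  refine (hasFDerivAt_axialConjugate' a c κ hp).congr_fderiv ?_
  rw [conjForm, (hasFDerivAt_axialPotential a c κ hp).fderiv]
  have hS := sum_succ_sub_castSucc c
  ext
  · simp only [ContinuousLinearMap.coe_comp, Function.comp_apply, ContinuousLinearMap.inl_apply,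
      sub_apply, smul_apply, add_apply, ContinuousLinearMap.coe_fst', ContinuousLinearMap.coe_snd',
      smul_eq_mul, mul_one, mul_zero, add_zero, zero_add, sub_zero]
    have h1 : ∑ i : Fin n, (c i.succ - c i.castSucc)
          * ((1 - (p.1 + a i) / Real.sqrt ((p.1 + a i) ^ 2 + p.2 ^ 2)) / p.2)
        = (∑ i : Fin n, (c i.succ - c i.castSucc) - ∑ i : Fin n, (c i.succ - c i.castSucc)
          * ((p.1 + a i) / Real.sqrt ((p.1 + a i) ^ 2 + p.2 ^ 2))) / p.2 := by
      rw [← Finset.sum_sub_distrib, Finset.sum_div]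
      exact Finset.sum_congr rfl fun i _ ↦ by ring
    rw [h1, hS]
    field_simp
    ring
  · simp only [ContinuousLinearMap.coe_comp, Function.comp_apply, ContinuousLinearMap.inr_apply,
      sub_apply, smul_apply, add_apply, ContinuousLinearMap.coe_fst', ContinuousLinearMap.coe_snd',
      smul_eq_mul, mul_one, mul_zero, add_zero, zero_add, zero_sub]
    have h1 : ∑ i : Fin n, (c i.succ - c i.castSucc)
          * (p.2 / Real.sqrt ((p.1 + a i) ^ 2 + p.2 ^ 2))
        = p.2 * ∑ i : Fin n, (c i.succ - c i.castSucc)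
          * (1 / Real.sqrt ((p.1 + a i) ^ 2 + p.2 ^ 2)) := by
      rw [Finset.mul_sum]
      exact Finset.sum_congr rfl fun i _ ↦ by ring
    rw [h1]
    ring

theorem continuous_axialConjugate (a : Fin n → ℝ) (c : Fin (n + 1) → ℝ) (κ : ℝ) :
    Continuous (axialConjugate a c κ) := by
  unfold axialConjugate
  fun_prop

theorem contDiffAt_axialConjugate (a : Fin n → ℝ) (c : Fin (n + 1) → ℝ) (κ : ℝ) {p : ℝ × ℝ}
    (hp : 0 < p.2) : ContDiffAt ℝ 1 (axialConjugate a c κ) p := by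
  have h : ∀ i, ContDiffAt ℝ 1 (fun q : ℝ × ℝ ↦ Real.sqrt ((q.1 + a i) ^ 2 + q.2 ^ 2)) p :=
    fun i ↦ ContDiffAt.sqrt (by fun_prop) (by positivity)
  unfold axialConjugate
  refine ContDiffAt.sub (ContDiffAt.sub (by fun_prop) ?_) (by fun_prop)
  exact contDiffAt_const.mul (ContDiffAt.sum fun i _ ↦ contDiffAt_const.mul (h i))

theorem axialConjugate_add (a : Fin n → ℝ) (s t : ℝ) (c c' : Fin (n + 1) → ℝ) (κ κ' : ℝ)
    (p : ℝ × ℝ) :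
    axialConjugate a (fun j ↦ s * c j + t * c' j) (s * κ + t * κ') p
      = s * axialConjugate a c κ p + t * axialConjugate a c' κ' p := by
  have h : ∑ i : Fin n, ((s * c i.succ + t * c' i.succ) - (s * c i.castSucc + t * c' i.castSucc))
        * Real.sqrt ((p.1 + a i) ^ 2 + p.2 ^ 2)
      = s * ∑ i : Fin n, (c i.succ - c i.castSucc) * Real.sqrt ((p.1 + a i) ^ 2 + p.2 ^ 2)
        + t * ∑ i : Fin n, (c' i.succ - c' i.castSucc)
          * Real.sqrt ((p.1 + a i) ^ 2 + p.2 ^ 2) := by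
    rw [Finset.mul_sum, Finset.mul_sum, ← Finset.sum_add_distrib]
    exact Finset.sum_congr rfl fun i _ ↦ by ring
  simp only [axialConjugate, h]
  ring

theorem axialPotential_add (a : Fin n → ℝ) (s t : ℝ) (c c' : Fin (n + 1) → ℝ) (κ κ' : ℝ)
    (p : ℝ × ℝ) :
    axialPotential a (fun j ↦ s * c j + t * c' j) (s * κ + t * κ') p
      = s * axialPotential a c κ p + t * axialPotential a c' κ' p := by
  have h : ∑ i : Fin n, ((s * c i.succ + t * c' i.succ) - (s * c i.castSucc + t * c' i.castSucc))
        * Real.log (p.1 + a i + Real.sqrt ((p.1 + a i) ^ 2 + p.2 ^ 2))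
      = s * ∑ i : Fin n, (c i.succ - c i.castSucc)
          * Real.log (p.1 + a i + Real.sqrt ((p.1 + a i) ^ 2 + p.2 ^ 2))
        + t * ∑ i : Fin n, (c' i.succ - c' i.castSucc)
          * Real.log (p.1 + a i + Real.sqrt ((p.1 + a i) ^ 2 + p.2 ^ 2)) := by
    rw [Finset.mul_sum, Finset.mul_sum, ← Finset.sum_add_distrib]
    exact Finset.sum_congr rfl fun i _ ↦ by ring
  simp only [axialPotential, h]
  ring

/-! ### Averaging over the boundary of the half-plane -/

/-- The norm of a planar vector is the average of the absolute values of its projections. -/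
theorem integral_abs_cos_add_sin (h r : ℝ) :
    ∫ θ in -(Real.pi / 2)..(Real.pi / 2), |h * Real.cos θ + r * Real.sin θ|
      = 2 * Real.sqrt (h ^ 2 + r ^ 2) := by
  set z : ℂ := ⟨h, r⟩ with hz
  have hh : h = ‖z‖ * Real.cos z.arg := (Complex.norm_mul_cos_arg z).symm
  have hr : r = ‖z‖ * Real.sin z.arg := (Complex.norm_mul_sin_arg z).symm
  have hn : Real.sqrt (h ^ 2 + r ^ 2) = ‖z‖ := by
    rw [Complex.norm_def, Complex.normSq_apply]
    congr 1
    simp only [hz]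
    ring
  have h1 : ∀ θ, |h * Real.cos θ + r * Real.sin θ| = ‖z‖ * |Real.cos (θ - z.arg)| := by
    intro θ
    have h0 : h * Real.cos θ + r * Real.sin θ = ‖z‖ * Real.cos (θ - z.arg) := by
      rw [Real.cos_sub]
      linear_combination Real.cos θ * hh + Real.sin θ * hr
    rw [h0, abs_mul, abs_norm]
  have hper : Function.Periodic (fun θ ↦ |Real.cos θ|) Real.pi := fun θ ↦ by
    simp [Real.cos_add_pi]
  have h2 : ∫ θ in -(Real.pi / 2)..(Real.pi / 2), |Real.cos θ| = 2 := by
    have h3 : ∫ θ in -(Real.pi / 2)..(Real.pi / 2), |Real.cos θ|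
        = ∫ θ in -(Real.pi / 2)..(Real.pi / 2), Real.cos θ := by
      refine intervalIntegral.integral_congr fun θ hθ ↦ ?_
      rw [Set.uIcc_of_le (by linarith [Real.pi_pos])] at hθ
      exact abs_of_nonneg (Real.cos_nonneg_of_mem_Icc hθ)
    rw [h3, integral_cos]
    simp
    norm_num
  simp only [h1]
  rw [intervalIntegral.integral_const_mul,
    intervalIntegral.integral_comp_sub_right (fun θ ↦ |Real.cos θ|) z.arg, hn]
  have h4 := hper.intervalIntegral_add_eq (-(Real.pi / 2) - z.arg) (-(Real.pi / 2))
  have h5 : -(Real.pi / 2) - z.arg + Real.pi = Real.pi / 2 - z.arg := by ring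
  have h6 : -(Real.pi / 2) + Real.pi = Real.pi / 2 := by ring
  rw [h5, h6] at h4
  rw [h4, h2]
  ring

theorem integral_average (A B : ℝ) (e a : Fin n → ℝ) (H r : ℝ) :
    ∫ θ in -(Real.pi / 2)..(Real.pi / 2),
        (A * Real.cos θ + B * (H * Real.cos θ + r * Real.sin θ)
          + ∑ i, e i * |(H + a i) * Real.cos θ + r * Real.sin θ|)
      = 2 * (A + B * H + ∑ i, e i * Real.sqrt ((H + a i) ^ 2 + r ^ 2)) := by
  have hc : ∀ f : ℝ → ℝ, Continuous f →
      IntervalIntegrable f MeasureTheory.volume (-(Real.pi / 2)) (Real.pi / 2) :=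
    fun f hf ↦ hf.intervalIntegrable _ _
  have h1 : ∀ θ, A * Real.cos θ + B * (H * Real.cos θ + r * Real.sin θ)
      = (A + B * H) * Real.cos θ + (B * r) * Real.sin θ := fun θ ↦ by ring
  simp only [h1]
  rw [intervalIntegral.integral_add (hc _ (by fun_prop)) (hc _ (by fun_prop)),
    intervalIntegral.integral_add (hc _ (by fun_prop)) (hc _ (by fun_prop)),
    intervalIntegral.integral_const_mul, intervalIntegral.integral_const_mul,
    intervalIntegral.integral_finsetSum fun i _ ↦ hc _ (by fun_prop)]
  simp only [intervalIntegral.integral_const_mul, integral_abs_cos_add_sin, integral_cos,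
    integral_sin, Real.cos_neg, Real.sin_neg, Real.sin_pi_div_two, sub_self, mul_zero, add_zero]
  rw [mul_add, Finset.mul_sum]
  have : ∀ i, e i * (2 * Real.sqrt ((H + a i) ^ 2 + r ^ 2))
      = 2 * (e i * Real.sqrt ((H + a i) ^ 2 + r ^ 2)) := fun i ↦ by ring
  simp only [this]
  ring

theorem average_integrand_nonneg {A B : ℝ} {e a : Fin n → ℝ}
    (h : ∀ s, 0 ≤ A + B * s + ∑ i, e i * |s + a i|) (H r : ℝ) {θ : ℝ}
    (hθ : θ ∈ Set.Icc (-(Real.pi / 2)) (Real.pi / 2)) :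
    0 ≤ A * Real.cos θ + B * (H * Real.cos θ + r * Real.sin θ)
      + ∑ i, e i * |(H + a i) * Real.cos θ + r * Real.sin θ| := by
  set f : ℝ → ℝ := fun θ ↦ A * Real.cos θ + B * (H * Real.cos θ + r * Real.sin θ)
      + ∑ i, e i * |(H + a i) * Real.cos θ + r * Real.sin θ| with hf
  have hcl : IsClosed {θ | 0 ≤ f θ} := isClosed_le continuous_const (by fun_prop)
  have hsub : Set.Ioo (-(Real.pi / 2)) (Real.pi / 2) ⊆ {θ | 0 ≤ f θ} := by
    intro θ hθ
    have hcos : 0 < Real.cos θ := Real.cos_pos_of_mem_Ioo hθ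
    have h1 := mul_nonneg hcos.le (h (H + r * Real.tan θ))
    have h2 : ∀ b : ℝ, Real.cos θ * (b + r * Real.tan θ) = b * Real.cos θ + r * Real.sin θ := by
      intro b
      rw [Real.tan_eq_sin_div_cos]
      field_simp
    have h3 : Real.cos θ * (A + B * (H + r * Real.tan θ) + ∑ i, e i * |H + r * Real.tan θ + a i|)
        = f θ := by
      rw [hf, mul_add, Finset.mul_sum]
      congr 1
      · linear_combination B * h2 H
      · refine Finset.sum_congr rfl fun i _ ↦ ?_
        rw [← h2 (H + a i), abs_mul, abs_of_pos hcos]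
        ring_nf
    rw [h3] at h1
    exact h1
  have := closure_minimal hsub hcl
  rw [closure_Ioo (by linarith [Real.pi_pos])] at this
  exact this hθ

/-- If a combination of the functions `1`, `s` and `|s + a i|` is nonnegative on the real line, then
its extension to the half-plane, with `|s + a i|` replaced by `√((H + a i)² + r²)`, is nonnegative:
it is an average of boundary values. -/
theorem average_nonneg {A B : ℝ} {e a : Fin n → ℝ}
    (h : ∀ s, 0 ≤ A + B * s + ∑ i, e i * |s + a i|) (H r : ℝ) :
    0 ≤ A + B * H + ∑ i, e i * Real.sqrt ((H + a i) ^ 2 + r ^ 2) := by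
  have h1 := integral_average A B e a H r
  have h2 := intervalIntegral.integral_nonneg (μ := MeasureTheory.volume)
    (by linarith [Real.pi_pos] : -(Real.pi / 2) ≤ Real.pi / 2)
    fun θ hθ ↦ average_integrand_nonneg h H r hθ
  linarith

theorem average_pos {A B : ℝ} {e a : Fin n → ℝ}
    (h : ∀ s, 0 ≤ A + B * s + ∑ i, e i * |s + a i|)
    (h' : ∃ s, 0 < A + B * s + ∑ i, e i * |s + a i|) (H : ℝ) {r : ℝ} (hr : 0 < r) :
    0 < A + B * H + ∑ i, e i * Real.sqrt ((H + a i) ^ 2 + r ^ 2) := by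
  have h1 := integral_average A B e a H r
  obtain ⟨s, hs⟩ := h'
  set θ := Real.arctan ((s - H) / r) with hθ
  have hcos : 0 < Real.cos θ := Real.cos_arctan_pos _
  have hsin : r * Real.sin θ = (s - H) * Real.cos θ := by
    have h2 : Real.sin θ / Real.cos θ = (s - H) / r := by
      rw [← Real.tan_eq_sin_div_cos, hθ, Real.tan_arctan]
    rw [div_eq_div_iff hcos.ne' hr.ne'] at h2
    linarith
  have h2 : 0 < ∫ θ in -(Real.pi / 2)..(Real.pi / 2),
        (A * Real.cos θ + B * (H * Real.cos θ + r * Real.sin θ)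
          + ∑ i, e i * |(H + a i) * Real.cos θ + r * Real.sin θ|) := by
    refine intervalIntegral.integral_pos (by linarith [Real.pi_pos])
      (Continuous.continuousOn (by fun_prop))
      (fun θ hθ ↦ average_integrand_nonneg h H r (Set.Ioc_subset_Icc_self hθ))
      ⟨θ, ⟨(Real.neg_pi_div_two_lt_arctan _).le, (Real.arctan_lt_pi_div_two _).le⟩, ?_⟩
    have h3 : ∀ b : ℝ, b * Real.cos θ + r * Real.sin θ = Real.cos θ * (s - H + b) := by
      intro b
      rw [hsin]
      ring
    have h4 := mul_pos hcos hs
    rw [mul_add, Finset.mul_sum] at h4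
    refine h4.trans_eq ?_
    congr 1
    · rw [h3]
      ring
    · refine Finset.sum_congr rfl fun i _ ↦ ?_
      rw [h3, abs_mul, abs_of_pos hcos]
      ring_nf
  linarith

/-! ### Summation by parts -/

/-- Abel summation: differences of a nonnegative sequence against a monotone one. -/
theorem sum_succ_sub_mul_le {e : Fin (n + 1) → ℝ} (he : ∀ i, 0 ≤ e i) (h0 : e 0 = 0)
    {g : Fin n → ℝ} (hg : Monotone g) {M : ℝ} (hM : ∀ i, g i ≤ M) :
    ∑ i : Fin n, (e i.succ - e i.castSucc) * g i ≤ e (Fin.last n) * M := by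
  induction n generalizing M with
  | zero => simp [h0]
  | succ n ih =>
    rw [Fin.sum_univ_castSucc]
    have h1 := ih (e := fun i ↦ e i.castSucc) (fun i ↦ he _) h0 (g := fun i ↦ g i.castSucc)
      (fun i j hij ↦ hg (Fin.castSucc_le_castSucc_iff.2 hij)) (M := g (Fin.last n))
      (fun i ↦ hg (Fin.le_last _))
    have h2 := mul_le_mul_of_nonneg_left (hM (Fin.last n)) (he (Fin.last (n + 1)))
    simp only [Fin.succ_last, Fin.succ_castSucc] at h1 h2 ⊢
    linarith

theorem sum_succ_sub_mul_lt {e : Fin (n + 2) → ℝ} (he : ∀ i, 0 ≤ e i) (h0 : e 0 = 0)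
    (h1 : 0 < e 1) {g : Fin (n + 1) → ℝ} (hg : StrictMono g) {M : ℝ} (hM : ∀ i, g i < M) :
    ∑ i : Fin (n + 1), (e i.succ - e i.castSucc) * g i < e (Fin.last (n + 1)) * M := by
  induction n generalizing M with
  | zero =>
    have h2 := mul_lt_mul_of_pos_left (hM 0) h1
    simpa [h0] using h2
  | succ n ih =>
    rw [Fin.sum_univ_castSucc]
    have h2 := ih (e := fun i ↦ e i.castSucc) (fun i ↦ he _) h0 h1 (g := fun i ↦ g i.castSucc)
      (fun i j hij ↦ hg (Fin.castSucc_lt_castSucc_iff.2 hij)) (M := g (Fin.last (n + 1)))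
      (fun i ↦ hg (Fin.castSucc_lt_last _))
    have h3 := mul_le_mul_of_nonneg_left (hM (Fin.last (n + 1))).le (he (Fin.last (n + 2)))
    simp only [Fin.succ_last, Fin.succ_castSucc] at h2 h3 ⊢
    linarith

end Axial

/-! ### Unbounded edges -/

section Edges

theorem det2_toPlane (v w : Fin 2 → ℤ) : det2 (toPlane v) (toPlane w) = ((det2 v w : ℤ) : ℝ) := by
  simp [det2, toPlane]

/-- An unbounded edge `i` contains a ray starting from its vertex on the edge `i'`; since every
`ℓ_j` is nonnegative on the ray, its slope there, `σ * det2 (m j) (m i)`, is nonnegative.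
Here `σ = ±1` takes care of the orientation. -/
theorem mul_det2_nonneg_of_unbounded_edge {d : ℕ} {m : Fin d → Fin 2 → ℤ} {c : Fin d → ℝ}
    {i i' : Fin d} {σ : ℤ} (hσ : det2 (m i') (m i) = σ) (hσ1 : σ * σ = 1) {v : Plane}
    (hv : v ∈ edge m c i ∩ edge m c i') (hunb : ¬ Bornology.IsBounded (edge m c i)) (j : Fin d) :
    0 ≤ σ * det2 (m j) (m i) := by
  by_contra hneg
  have hle : σ * det2 (m j) (m i) ≤ -1 := by omega
  apply hunb
  have hσr : (m i' 0 : ℝ) * (m i 1 : ℝ) - (m i' 1 : ℝ) * (m i 0 : ℝ) = (σ : ℝ) := by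
    rw [← hσ]
    simp [det2]
  have hσ1r : (σ : ℝ) * (σ : ℝ) = 1 := by exact_mod_cast hσ1
  have hler : (σ : ℝ) * ((m j 0 : ℝ) * (m i 1 : ℝ) - (m j 1 : ℝ) * (m i 0 : ℝ)) ≤ -1 := by
    have : ((σ * det2 (m j) (m i) : ℤ) : ℝ) ≤ ((-1 : ℤ) : ℝ) := by exact_mod_cast hle
    simpa [det2] using this
  have hvi := hv.1.2
  have hvi' := hv.2.2
  rw [affineForm_eq] at hvi hvi'
  set ℓ := affineForm (m j) (c j) v with hℓ
  refine (Metric.isBounded_closedBall (x := v)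
    (r := ℓ * (|(m i 0 : ℝ)| + |(m i 1 : ℝ)|))).subset fun y hy ↦ ?_
  have hyi := hy.2
  set s := affineForm (m i') (c i') y with hs
  have hs0 : 0 ≤ s := hy.1 i'
  have hyj := hy.1 j
  rw [affineForm_eq] at hs hyj hyi hℓ
  -- the point `y` is obtained from `v` by moving along the edge by `σ * s`
  have h0 : y 0 - v 0 = σ * s * (m i 1 : ℝ) := by
    have : (σ : ℝ) * (y 0 - v 0) = s * (m i 1 : ℝ) := by
      rw [← hσr]
      linear_combination (m i 1 : ℝ) * (-hs) - (m i 1 : ℝ) * hvi'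
        - (m i' 1 : ℝ) * hyi + (m i' 1 : ℝ) * hvi
    linear_combination (σ : ℝ) * this - (y 0 - v 0) * hσ1r
  have h1 : y 1 - v 1 = -(σ * s * (m i 0 : ℝ)) := by
    have : (σ : ℝ) * (y 1 - v 1) = -(s * (m i 0 : ℝ)) := by
      rw [← hσr]
      linear_combination (m i 0 : ℝ) * hs + (m i 0 : ℝ) * hvi'
        + (m i' 0 : ℝ) * hyi - (m i' 0 : ℝ) * hvi
    linear_combination (σ : ℝ) * this - (y 1 - v 1) * hσ1r
  have hsℓ : s ≤ ℓ := by
    have h2 : y 0 * (m j 0 : ℝ) + y 1 * (m j 1 : ℝ) + c j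
        = ℓ + s * (σ * ((m j 0 : ℝ) * (m i 1 : ℝ) - (m j 1 : ℝ) * (m i 0 : ℝ))) := by
      rw [hℓ]
      linear_combination (m j 0 : ℝ) * h0 + (m j 1 : ℝ) * h1
    have h3 := mul_le_mul_of_nonneg_left hler hs0
    linarith
  have habs : |(σ : ℝ)| = 1 := by
    have : |(σ : ℝ)| * |(σ : ℝ)| = 1 := by rw [← abs_mul, hσ1r, abs_one]
    nlinarith [abs_nonneg (σ : ℝ)]
  have hℓ0 : 0 ≤ ℓ := hs0.trans hsℓ
  rw [Metric.mem_closedBall, dist_pi_le_iff (by positivity)]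
  have hb : ∀ b : ℝ, |σ * s * b| ≤ ℓ * |b| := by
    intro b
    rw [abs_mul, abs_mul, habs, one_mul, abs_of_nonneg hs0]
    exact mul_le_mul_of_nonneg_right hsℓ (abs_nonneg b)
  intro k
  fin_cases k
  · simp only [Fin.zero_eta, Real.dist_eq, h0]
    exact (hb _).trans (by nlinarith [abs_nonneg (m i 0 : ℝ)])
  · simp only [Fin.mk_one, Real.dist_eq, h1, abs_neg]
    exact (hb _).trans (by nlinarith [abs_nonneg (m i 1 : ℝ)])

variable {k : ℕ} {m : Fin (k + 2) → Fin 2 → ℤ} {c : Fin (k + 2) → ℝ}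

namespace IsOrderedUnboundedPolygon

variable (hP : IsOrderedUnboundedPolygon (n := k + 1) m c)
include hP

theorem det2_zero_one : det2 (m 0) (m 1) = -1 := hP.det_eq 0

theorem det2_first_nonneg (j : Fin (k + 2)) : 0 ≤ det2 (m j) (m 0) := by
  obtain ⟨v, hv⟩ := hP.consecutive 0
  have h := mul_det2_nonneg_of_unbounded_edge (i := 0) (i' := 1) (σ := 1)
    (by have := hP.det2_zero_one; unfold det2 at this ⊢; linarith) (by norm_num) hv
    hP.first_unbounded j
  linarith

theorem det2_last_nonneg (j : Fin (k + 2)) : 0 ≤ det2 (m (Fin.last (k + 1))) (m j) := by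
  obtain ⟨v, hv⟩ := hP.consecutive (Fin.last k)
  have h := mul_det2_nonneg_of_unbounded_edge (i := Fin.last (k + 1))
    (i' := (Fin.last k).castSucc) (σ := -1) (hP.det_eq (Fin.last k)) (by norm_num) hv.symm
    hP.last_unbounded j
  unfold det2 at h ⊢
  linarith

theorem det2_toPlane_first_nonneg (i : Fin (k + 2)) :
    0 ≤ det2 (toPlane (m i)) (toPlane (m 0)) := by
  rw [det2_toPlane]
  exact_mod_cast hP.det2_first_nonneg i

theorem det2_toPlane_last_nonneg (i : Fin (k + 2)) :
    0 ≤ det2 (toPlane (m (Fin.last (k + 1)))) (toPlane (m i)) := by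
  rw [det2_toPlane]
  exact_mod_cast hP.det2_last_nonneg i

/-- The functionals of the first two edges do not both stay bounded along the last edge. -/
theorem det2_last_sum_pos :
    1 ≤ det2 (m (Fin.last (k + 1))) (m 0) + det2 (m (Fin.last (k + 1))) (m 1) := by
  have h0 := hP.det2_last_nonneg 0
  have h1 := hP.det2_last_nonneg 1
  by_contra hlt
  have h2 : det2 (m (Fin.last (k + 1))) (m 0) = 0 := by omega
  have h3 : det2 (m (Fin.last (k + 1))) (m 1) = 0 := by omega
  have h4 := hP.det2_zero_one
  have hcop := hP.primitive (Fin.last (k + 1))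
  unfold det2 at h2 h3 h4
  have h5 : m (Fin.last (k + 1)) 0 = 0 := by
    linear_combination m (Fin.last (k + 1)) 0 * h4 + m 1 0 * h2 - m 0 0 * h3
  have h6 : m (Fin.last (k + 1)) 1 = 0 := by
    linear_combination m (Fin.last (k + 1)) 1 * h4 + m 1 1 * h2 - m 0 1 * h3
  rw [h5, h6] at hcop
  exact not_isCoprime_zero_zero hcop

/-- If the unbounded edges are parallel, their interior normals are opposite. -/
theorem eq_neg_of_not_isStrictlyUnbounded (h : ¬ IsStrictlyUnbounded m) :
    m (Fin.last (k + 1)) = -m 0 := by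
  have hdet : det2 (m 0) (m (Fin.last (k + 1))) = 0 := not_not.1 h
  have hle := hP.det2_last_nonneg 1
  have h01 := hP.det2_zero_one
  obtain ⟨s, t, hst⟩ := hP.primitive 0
  obtain ⟨s', t', hst'⟩ := hP.primitive (Fin.last (k + 1))
  -- both normals are primitive, so one is `±` the other
  set q := s * m (Fin.last (k + 1)) 0 + t * m (Fin.last (k + 1)) 1 with hq
  have hd := hdet
  unfold det2 at hdet hle h01
  have e0 : m (Fin.last (k + 1)) 0 = q * m 0 0 := by
    rw [hq]
    linear_combination (-m (Fin.last (k + 1)) 0) * hst - t * hdet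
  have e1 : m (Fin.last (k + 1)) 1 = q * m 0 1 := by
    rw [hq]
    linear_combination (-m (Fin.last (k + 1)) 1) * hst + s * hdet
  have hunit : q * (s' * m 0 0 + t' * m 0 1) = 1 := by
    rw [e0, e1] at hst'
    linarith
  have hq0 : q ≤ 0 := by
    rw [e0, e1] at hle
    nlinarith
  have hq1 : q = -1 := by
    rcases Int.isUnit_iff.1 (IsUnit.of_mul_eq_one _ hunit) with h | h <;> omega
  funext i
  fin_cases i
  · simp [e0, hq1]
  · simp [e1, hq1]

end IsOrderedUnboundedPolygon

end Edges

/-! ### The coordinates as averages of their boundary values -/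

section Coordinates

theorem xi_eq_axialPotential {n : ℕ} (m : Fin (n + 1) → Fin 2 → ℤ) (a : Fin n → ℝ) (ν : Plane)
    (k : Fin 2) : xi m a ν k = axialPotential a (fun j ↦ (m j k : ℝ)) (ν k) := rfl

/-- Primitives of the same form on the open half-plane, continuous up to the boundary, differ by a
constant. -/
theorem exists_eq_add_of_hasFDerivAt_halfPlane {f g : ℝ × ℝ → ℝ} {D : ℝ × ℝ → ℝ × ℝ →L[ℝ] ℝ}
    (hf : ∀ p : ℝ × ℝ, 0 < p.2 → HasFDerivAt f (D p) p)
    (hg : ∀ p : ℝ × ℝ, 0 < p.2 → HasFDerivAt g (D p) p)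
    (hfc : ContinuousOn f {p | 0 ≤ p.2}) (hgc : ContinuousOn g {p | 0 ≤ p.2}) :
    ∃ C : ℝ, ∀ p : ℝ × ℝ, 0 ≤ p.2 → f p = C + g p := by
  have hopen : IsOpen {p : ℝ × ℝ | 0 < p.2} := isOpen_lt continuous_const continuous_snd
  have hconv : Convex ℝ {p : ℝ × ℝ | 0 < p.2} :=
    convex_halfSpace_gt (LinearMap.snd ℝ ℝ ℝ).isLinear 0
  have hd : ∀ p : ℝ × ℝ, 0 < p.2 → HasFDerivAt (fun q : ℝ × ℝ ↦ f q - g q)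
      (0 : ℝ × ℝ →L[ℝ] ℝ) p := by
    intro p hp
    have := (hf p hp).sub (hg p hp)
    rwa [sub_self] at this
  obtain ⟨C, hC⟩ := hopen.exists_is_const_of_fderiv_eq_zero hconv.isPreconnected
    (fun p hp ↦ (hd p hp).differentiableAt.differentiableWithinAt) (fun p hp ↦ (hd p hp).fderiv)
  refine ⟨C, fun p hp ↦ ?_⟩
  have hsub : {p : ℝ × ℝ | 0 ≤ p.2} ⊆ closure {p : ℝ × ℝ | 0 < p.2} := by
    intro p hp
    have h1 : Filter.Tendsto (fun ε : ℝ ↦ (p.1, p.2 + ε)) (𝓝[>] 0) (𝓝 p) := by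
      have : Continuous (fun ε : ℝ ↦ (p.1, p.2 + ε)) := by fun_prop
      have h2 := this.tendsto 0
      simp only [add_zero] at h2
      exact h2.mono_left nhdsWithin_le_nhds
    refine mem_closure_of_tendsto h1 ?_
    filter_upwards [self_mem_nhdsWithin] with ε hε
    have h3 : (0 : ℝ) < ε := hε
    have h4 : 0 ≤ p.2 := hp
    change 0 < p.2 + ε
    linarith
  have heq := Set.EqOn.of_subset_closure (s := {p : ℝ × ℝ | 0 < p.2}) (t := {p : ℝ × ℝ | 0 ≤ p.2})
    (f := fun q ↦ f q - g q) (g := fun _ ↦ C) (fun q hq ↦ hC q hq) (hfc.sub hgc)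
    continuousOn_const (fun q hq ↦ le_of_lt (show 0 < q.2 from hq)) hsub
  have := heq hp
  simp only at this
  linarith

variable {n : ℕ} {m : Fin (n + 1) → Fin 2 → ℤ} {c : Fin (n + 1) → ℝ} {ν : Plane}
  {a : Fin n → ℝ} {x : ℝ × ℝ → Plane}

namespace IsJoyceCoordinates

theorem exists_eq_axialConjugate (hx : IsJoyceCoordinates m c ν a x) :
    ∃ C₀ C₁ : ℝ, ∀ p : ℝ × ℝ, 0 ≤ p.2 →
      x p 0 = C₀ + axialConjugate a (fun j ↦ (m j 1 : ℝ)) (ν 1) p ∧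
      x p 1 = C₁ - axialConjugate a (fun j ↦ (m j 0 : ℝ)) (ν 0) p := by
  have hc : ∀ i : Fin 2, ContinuousOn (fun p ↦ x p i) {p | 0 ≤ p.2} := fun i ↦
    (continuous_apply i).comp_continuousOn hx.continuous
  obtain ⟨C₀, h₀⟩ := exists_eq_add_of_hasFDerivAt_halfPlane hx.primitive_zero
    (fun p hp ↦ hasFDerivAt_axialConjugate a (fun j ↦ (m j 1 : ℝ)) (ν 1) hp)
    (hc 0) (continuous_axialConjugate _ _ _).continuousOn
  obtain ⟨C₁, h₁⟩ := exists_eq_add_of_hasFDerivAt_halfPlane hx.primitive_one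
    (fun p hp ↦ (hasFDerivAt_axialConjugate a (fun j ↦ (m j 0 : ℝ)) (ν 0) hp).neg)
    (hc 1) (continuous_axialConjugate _ _ _).neg.continuousOn
  exact ⟨C₀, C₁, fun p hp ↦ ⟨h₀ p hp, by rw [h₁ p hp, Pi.neg_apply, sub_eq_add_neg]⟩⟩

/-- In the coordinates each functional `ℓ_i` is, up to a constant, the conjugate of an axial
potential. -/
theorem exists_affineForm_eq (hx : IsJoyceCoordinates m c ν a x) :
    ∃ K : Fin (n + 1) → ℝ, ∀ i, ∀ p : ℝ × ℝ, 0 ≤ p.2 → affineForm (m i) (c i) (x p)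
      = K i + axialConjugate a (fun j ↦ det2 (toPlane (m i)) (toPlane (m j)))
          (det2 (toPlane (m i)) ν) p := by
  obtain ⟨C₀, C₁, hC⟩ := hx.exists_eq_axialConjugate
  refine ⟨fun i ↦ C₀ * m i 0 + C₁ * m i 1 + c i, fun i p hp ↦ ?_⟩
  have h := axialConjugate_add a (m i 0 : ℝ) (-(m i 1 : ℝ)) (fun j ↦ (m j 1 : ℝ))
    (fun j ↦ (m j 0 : ℝ)) (ν 1) (ν 0) p
  have h1 : (fun j ↦ det2 (toPlane (m i)) (toPlane (m j)))
      = fun j ↦ (m i 0 : ℝ) * (m j 1 : ℝ) + -(m i 1 : ℝ) * (m j 0 : ℝ) := by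
    funext j
    simp only [det2, toPlane]
    ring
  have h2 : det2 (toPlane (m i)) ν = (m i 0 : ℝ) * ν 1 + -(m i 1 : ℝ) * ν 0 := by
    simp only [det2, toPlane]
    ring
  rw [h1, h2, h, affineForm_eq, (hC p hp).1, (hC p hp).2]
  ring

end IsJoyceCoordinates

/-- On the boundary of the half-plane the conjugate is piecewise linear, with breaks at `-a i`. -/
theorem axialConjugate_boundary (a : Fin n → ℝ) (e : Fin (n + 1) → ℝ) (κ s : ℝ) :
    axialConjugate a e κ (s, 0) = 1 / 2 * (e 0 + e (Fin.last n)) * s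
      - 1 / 2 * ∑ i : Fin n, (e i.succ - e i.castSucc) * |s + a i| := by
  simp [axialConjugate, Real.sqrt_sq_eq_abs]

theorem axialConjugate_boundary_of_ge {a : Fin n → ℝ} {s t : ℝ} (hs : ∀ i, 0 ≤ s + a i)
    (ht : ∀ i, 0 ≤ t + a i) (e : Fin (n + 1) → ℝ) (κ : ℝ) :
    axialConjugate a e κ (s, 0) = axialConjugate a e κ (t, 0) + (s - t) * e 0 := by
  have h : ∑ i : Fin n, (e i.succ - e i.castSucc) * |s + a i|
      = ∑ i : Fin n, (e i.succ - e i.castSucc) * |t + a i|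
        + (s - t) * ∑ i : Fin n, (e i.succ - e i.castSucc) := by
    rw [Finset.mul_sum, ← Finset.sum_add_distrib]
    refine Finset.sum_congr rfl fun i _ ↦ ?_
    rw [abs_of_nonneg (hs i), abs_of_nonneg (ht i)]
    ring
  rw [axialConjugate_boundary, axialConjugate_boundary, h, sum_succ_sub_castSucc]
  ring

theorem axialConjugate_boundary_of_le {a : Fin n → ℝ} {s t : ℝ} (hs : ∀ i, s + a i ≤ 0)
    (ht : ∀ i, t + a i ≤ 0) (e : Fin (n + 1) → ℝ) (κ : ℝ) :
    axialConjugate a e κ (s, 0)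
      = axialConjugate a e κ (t, 0) + (s - t) * e (Fin.last n) := by
  have h : ∑ i : Fin n, (e i.succ - e i.castSucc) * |s + a i|
      = ∑ i : Fin n, (e i.succ - e i.castSucc) * |t + a i|
        - (s - t) * ∑ i : Fin n, (e i.succ - e i.castSucc) := by
    rw [Finset.mul_sum, ← Finset.sum_sub_distrib]
    refine Finset.sum_congr rfl fun i _ ↦ ?_
    rw [abs_of_nonpos (hs i), abs_of_nonpos (ht i)]
    ring
  rw [axialConjugate_boundary, axialConjugate_boundary, h, sum_succ_sub_castSucc]
  ring

theorem axialConjugate_boundary_of_between {a : Fin n → ℝ} {s t : ℝ}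
    (h : ∀ i, (0 ≤ s + a i ∧ 0 ≤ t + a i) ∨ (s + a i ≤ 0 ∧ t + a i ≤ 0)) {θ : ℝ} (hθ : 0 ≤ θ)
    (hθ1 : θ ≤ 1) (e : Fin (n + 1) → ℝ) (κ : ℝ) :
    axialConjugate a e κ ((1 - θ) * s + θ * t, 0)
      = (1 - θ) * axialConjugate a e κ (s, 0) + θ * axialConjugate a e κ (t, 0) := by
  have h1 : ∀ i, |(1 - θ) * s + θ * t + a i| = (1 - θ) * |s + a i| + θ * |t + a i| := by
    intro i
    have h2 : (1 - θ) * s + θ * t + a i = (1 - θ) * (s + a i) + θ * (t + a i) := by ring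
    rcases h i with ⟨hs, ht⟩ | ⟨hs, ht⟩
    · rw [abs_of_nonneg hs, abs_of_nonneg ht, h2, abs_of_nonneg]
      exact add_nonneg (mul_nonneg (by linarith) hs) (mul_nonneg hθ ht)
    · rw [abs_of_nonpos hs, abs_of_nonpos ht, h2, abs_of_nonpos]
      · ring
      · exact add_nonpos (mul_nonpos_of_nonneg_of_nonpos (by linarith) hs)
          (mul_nonpos_of_nonneg_of_nonpos hθ ht)
  have h3 : ∑ i : Fin n, (e i.succ - e i.castSucc) * |(1 - θ) * s + θ * t + a i|
      = (1 - θ) * ∑ i : Fin n, (e i.succ - e i.castSucc) * |s + a i|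
        + θ * ∑ i : Fin n, (e i.succ - e i.castSucc) * |t + a i| := by
    rw [Finset.mul_sum, Finset.mul_sum, ← Finset.sum_add_distrib]
    refine Finset.sum_congr rfl fun i _ ↦ ?_
    rw [h1]
    ring
  rw [axialConjugate_boundary, axialConjugate_boundary, axialConjugate_boundary, h3]
  ring

/-- A point between the first and the last term of a finite sequence lies between two consecutive
terms. -/
theorem exists_mem_Icc_castSucc_succ {k : ℕ} (b : Fin (k + 1) → ℝ) {t : ℝ} (h0 : b 0 ≤ t)
    (h1 : t ≤ b (Fin.last k)) (hk : b 0 < b (Fin.last k)) :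
    ∃ i : Fin k, b i.castSucc ≤ t ∧ t ≤ b i.succ := by
  induction k with
  | zero => exact absurd hk (by simp)
  | succ k ih =>
    by_cases ht : b (Fin.last k).castSucc ≤ t
    · exact ⟨Fin.last k, ht, by simpa using h1⟩
    · rw [not_le] at ht
      obtain ⟨i, hi⟩ := ih (fun j ↦ b j.castSucc) h0 ht.le (lt_of_le_of_lt h0 ht)
      exact ⟨i.castSucc, hi.1, by rw [Fin.succ_castSucc]; exact hi.2⟩

end Coordinates

section Boundary

variable {k : ℕ} {m : Fin (k + 2) → Fin 2 → ℤ} {c : Fin (k + 2) → ℝ} {ν : Plane}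
  {a : Fin (k + 1) → ℝ} {x : ℝ × ℝ → Plane}

namespace IsJoyceCoordinates

variable (hx : IsJoyceCoordinates (n := k + 1) m c ν a x)
include hx

/-- To the right of all `-a i` the boundary curve runs along the first edge, with direction `m 0`
turned by a right angle. -/
theorem affineForm_right {s : ℝ} (hs : -a 0 ≤ s) (i : Fin (k + 2)) :
    affineForm (m i) (c i) (x (s, 0)) = affineForm (m i) (c i) (x (-a 0, 0))
      + (s + a 0) * det2 (toPlane (m i)) (toPlane (m 0)) := by
  obtain ⟨K, hK⟩ := hx.exists_affineForm_eq
  have h : ∀ i, a 0 ≤ a i := fun i ↦ hx.strictMono.monotone (Fin.zero_le i)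
  rw [hK i _ le_rfl, hK i _ le_rfl, axialConjugate_boundary_of_ge (s := s) (t := -a 0)
    (fun i ↦ by linarith [h i]) (fun i ↦ by linarith [h i])]
  ring

/-- To the left of all `-a i` the boundary curve runs along the last edge. -/
theorem affineForm_left {s : ℝ} (hs : s ≤ -a (Fin.last k)) (i : Fin (k + 2)) :
    affineForm (m i) (c i) (x (s, 0)) = affineForm (m i) (c i) (x (-a (Fin.last k), 0))
      + (s + a (Fin.last k)) * det2 (toPlane (m i)) (toPlane (m (Fin.last (k + 1)))) := by
  obtain ⟨K, hK⟩ := hx.exists_affineForm_eq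
  have h : ∀ i, a i ≤ a (Fin.last k) := fun i ↦ hx.strictMono.monotone (Fin.le_last i)
  rw [hK i _ le_rfl, hK i _ le_rfl, axialConjugate_boundary_of_le (s := s) (t := -a (Fin.last k))
    (fun i ↦ by linarith [h i]) (fun i ↦ by linarith [h i])]
  ring

/-- Between two of the `-a i` the boundary curve runs along the segment joining two vertices. -/
theorem affineForm_middle {s : ℝ} (hs : s ≤ -a 0) (hs' : -a (Fin.last k) ≤ s) (hk : k ≠ 0) :
    ∃ j : Fin k, ∃ θ : ℝ, 0 ≤ θ ∧ θ ≤ 1 ∧ ∀ i, affineForm (m i) (c i) (x (s, 0))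
      = (1 - θ) * affineForm (m i) (c i) (x (-a j.succ, 0))
        + θ * affineForm (m i) (c i) (x (-a j.castSucc, 0)) := by
  obtain ⟨K, hK⟩ := hx.exists_affineForm_eq
  have hmono := hx.strictMono.monotone
  obtain ⟨j, hj, hj'⟩ := exists_mem_Icc_castSucc_succ a (t := -s) (by linarith) (by linarith)
    (hx.strictMono (Fin.lt_last_iff_ne_last.2 fun h ↦ hk (by simpa using congrArg Fin.val h.symm)))
  have hlt : a j.castSucc < a j.succ := hx.strictMono Fin.castSucc_lt_succ
  have hpos : 0 < a j.succ - a j.castSucc := by linarith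
  set θ := (s + a j.succ) / (a j.succ - a j.castSucc) with hθ
  have hθs : (1 - θ) * (-a j.succ) + θ * (-a j.castSucc) = s := by
    rw [hθ]
    field_simp
    ring
  have h0 : 0 ≤ θ := div_nonneg (by linarith) hpos.le
  have h1 : θ ≤ 1 := by
    rw [hθ, div_le_one hpos]
    linarith
  refine ⟨j, θ, h0, h1, fun i ↦ ?_⟩
  have h2 := axialConjugate_boundary_of_between (a := a) (s := -a j.succ) (t := -a j.castSucc)
    (fun l ↦ by
      rcases le_or_gt l j.castSucc with hl | hl
      · right
        have := hmono hl
        constructor <;> linarith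
      · left
        have := hmono (Fin.castSucc_lt_iff_succ_le.1 hl)
        constructor <;> linarith) h0 h1
  rw [hK i _ le_rfl, hK i _ le_rfl, hK i _ le_rfl, ← hθs, h2]
  ring

theorem vertex_nonneg (j : Fin (k + 1)) (i : Fin (k + 2)) :
    0 ≤ affineForm (m i) (c i) (x (-a j, 0)) := (hx.vertex j).1.1 i

theorem exists_boundary_eq_zero (s : ℝ) : ∃ i, affineForm (m i) (c i) (x (s, 0)) = 0 := by
  rcases le_total (-a 0) s with hs | hs
  · refine ⟨0, ?_⟩
    have h1 : affineForm (m 0) (c 0) (x (-a 0, 0)) = 0 := (hx.vertex 0).1.2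
    rw [hx.affineForm_right hs, h1]
    simp only [det2]
    ring
  rcases le_total s (-a (Fin.last k)) with hs' | hs'
  · refine ⟨Fin.last (k + 1), ?_⟩
    have h1 : affineForm (m (Fin.last (k + 1))) (c (Fin.last (k + 1)))
      (x (-a (Fin.last k), 0)) = 0 := (hx.vertex (Fin.last k)).2.2
    rw [hx.affineForm_left hs', h1]
    simp only [det2]
    ring
  rcases Nat.eq_zero_or_pos k with hk | hk
  · subst hk
    have : s = -a 0 := le_antisymm hs hs'
    rw [this]
    exact ⟨0, (hx.vertex 0).1.2⟩
  · obtain ⟨j, θ, h0, h1, h⟩ := hx.affineForm_middle hs hs' hk.ne'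
    refine ⟨j.succ.castSucc, ?_⟩
    rw [h, (hx.vertex j.succ).1.2, ← Fin.succ_castSucc, (hx.vertex j.castSucc).2.2]
    ring

variable (hP : IsOrderedUnboundedPolygon (n := k + 1) m c)
include hP

theorem boundary_mem_region (s : ℝ) (i : Fin (k + 2)) :
    0 ≤ affineForm (m i) (c i) (x (s, 0)) := by
  rcases le_total (-a 0) s with hs | hs
  · rw [hx.affineForm_right hs]
    exact add_nonneg (hx.vertex_nonneg 0 i)
      (mul_nonneg (by linarith) (hP.det2_toPlane_first_nonneg i))
  rcases le_total s (-a (Fin.last k)) with hs' | hs'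
  · rw [hx.affineForm_left hs']
    have h := hP.det2_toPlane_last_nonneg i
    have h1 : det2 (toPlane (m i)) (toPlane (m (Fin.last (k + 1))))
        = -det2 (toPlane (m (Fin.last (k + 1)))) (toPlane (m i)) := by
      simp only [det2]
      ring
    rw [h1]
    nlinarith [hx.vertex_nonneg (Fin.last k) i]
  rcases Nat.eq_zero_or_pos k with hk | hk
  · subst hk
    have : s = -a 0 := le_antisymm hs hs'
    rw [this]
    exact hx.vertex_nonneg 0 i
  · obtain ⟨j, θ, h0, h1, h⟩ := hx.affineForm_middle hs hs' hk.ne'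
    rw [h]
    exact add_nonneg (mul_nonneg (by linarith) (hx.vertex_nonneg _ i))
      (mul_nonneg h0 (hx.vertex_nonneg _ i))

/-- No edge contains the whole boundary curve. -/
theorem exists_boundary_pos (i : Fin (k + 2)) : ∃ s, 0 < affineForm (m i) (c i) (x (s, 0)) := by
  by_contra hcon
  push Not at hcon
  have hzero : ∀ s, affineForm (m i) (c i) (x (s, 0)) = 0 := fun s ↦
    le_antisymm (hcon s) (hx.boundary_mem_region hP s i)
  -- the `i`-th edge would meet both unbounded edges while being parallel to them
  have hfirst : det2 (m i) (m 0) = 0 := by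
    have h := hx.affineForm_right (s := -a 0 + 1) (by linarith) i
    rw [hzero, hzero, det2_toPlane] at h
    have h2 : ((det2 (m i) (m 0) : ℤ) : ℝ) = 0 := by linarith
    exact_mod_cast h2
  have hlast : det2 (m i) (m (Fin.last (k + 1))) = 0 := by
    have h := hx.affineForm_left (s := -a (Fin.last k) - 1) (by linarith) i
    rw [hzero, hzero, det2_toPlane] at h
    have h2 : ((det2 (m i) (m (Fin.last (k + 1))) : ℤ) : ℝ) = 0 := by linarith
    exact_mod_cast h2
  by_cases hi : i = 0
  · have hne : i ≠ Fin.last (k + 1) := by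
      rw [hi]
      exact (Fin.last_pos (n := k)).ne
    have hmem : x (-a (Fin.last k), 0) ∈ edge m c i ∩ edge m c (Fin.last (k + 1)) :=
      ⟨⟨(hx.vertex (Fin.last k)).2.1, hzero _⟩, (hx.vertex (Fin.last k)).2⟩
    have := hP.basis _ _ hne ⟨_, hmem⟩
    rw [hlast] at this
    exact not_isUnit_zero this
  · have hmem : x (-a 0, 0) ∈ edge m c i ∩ edge m c 0 :=
      ⟨⟨(hx.vertex 0).1.1, hzero _⟩, (hx.vertex 0).1⟩
    have := hP.basis _ _ hi ⟨_, hmem⟩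
    rw [hfirst] at this
    exact not_isUnit_zero this

end IsJoyceCoordinates

end Boundary

/-! ### The coordinates map the half-plane onto the interior of the polygon -/

section Surjectivity

theorem axialConjugate_eq {n : ℕ} (K : ℝ) (a : Fin n → ℝ) (e : Fin (n + 1) → ℝ) (κ : ℝ)
    (p : ℝ × ℝ) : K + axialConjugate a e κ p = K + 1 / 2 * (e 0 + e (Fin.last n)) * p.1
      + ∑ i : Fin n, (-(1 / 2) * (e i.succ - e i.castSucc)) * Real.sqrt ((p.1 + a i) ^ 2 + p.2 ^ 2)
      - κ * p.2 ^ 2 / 2 := by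
  simp only [axialConjugate, mul_assoc, ← Finset.mul_sum]
  ring

theorem axialConjugate_boundary_eq {n : ℕ} (K : ℝ) (a : Fin n → ℝ) (e : Fin (n + 1) → ℝ) (κ s : ℝ) :
    K + axialConjugate a e κ (s, 0) = K + 1 / 2 * (e 0 + e (Fin.last n)) * s
      + ∑ i : Fin n, (-(1 / 2) * (e i.succ - e i.castSucc)) * |s + a i| := by
  simp [axialConjugate_eq, Real.sqrt_sq_eq_abs]

/-- Positivity on the boundary of the half-plane implies positivity inside; the term `-κ r² / 2` has
the right sign. -/
theorem axialConjugate_pos {n : ℕ} {K κ : ℝ} {a : Fin n → ℝ} {e : Fin (n + 1) → ℝ} (hκ : κ ≤ 0)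
    (h : ∀ s, 0 ≤ K + axialConjugate a e κ (s, 0)) (h' : ∃ s, 0 < K + axialConjugate a e κ (s, 0))
    {p : ℝ × ℝ} (hp : 0 < p.2) : 0 < K + axialConjugate a e κ p := by
  simp only [axialConjugate_boundary_eq] at h h'
  have h1 := average_pos h h' p.1 hp
  have h2 : κ * p.2 ^ 2 ≤ 0 := mul_nonpos_of_nonpos_of_nonneg hκ (sq_nonneg _)
  rw [axialConjugate_eq]
  linarith

theorem sqrt_le_axialConjugate {n : ℕ} {K κ : ℝ} {a : Fin n → ℝ} {e : Fin (n + 1) → ℝ} (hκ : κ ≤ 0)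
    (j : Fin n) (h : ∀ s, |s + a j| ≤ K + axialConjugate a e κ (s, 0)) (p : ℝ × ℝ) :
    Real.sqrt ((p.1 + a j) ^ 2 + p.2 ^ 2) ≤ K + axialConjugate a e κ p := by
  simp only [axialConjugate_boundary_eq] at h
  have h1 := average_nonneg (A := K) (B := 1 / 2 * (e 0 + e (Fin.last n))) (a := a)
    (e := fun i ↦ -(1 / 2) * (e i.succ - e i.castSucc) - if i = j then 1 else 0)
    (fun s ↦ by
      have := h s
      simp only [sub_mul, Finset.sum_sub_distrib, ite_mul, one_mul, zero_mul, Finset.sum_ite_eq',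
        Finset.mem_univ, if_true]
      linarith) p.1 p.2
  simp only [sub_mul, Finset.sum_sub_distrib, ite_mul, one_mul, zero_mul, Finset.sum_ite_eq',
    Finset.mem_univ, if_true] at h1
  have h2 : κ * p.2 ^ 2 ≤ 0 := mul_nonpos_of_nonpos_of_nonneg hκ (sq_nonneg _)
  rw [axialConjugate_eq]
  linarith

variable {k : ℕ} {m : Fin (k + 2) → Fin 2 → ℤ} {c : Fin (k + 2) → ℝ} {ν : Plane}
  {a : Fin (k + 1) → ℝ} {x : ℝ × ℝ → Plane}

theorem det2_swap {R : Type*} [CommRing R] (v w : Fin 2 → R) : det2 v w = -det2 w v := by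
  simp only [det2]
  ring

theorem IsJoyceCoordinates.affineForm_pos (hx : IsJoyceCoordinates (n := k + 1) m c ν a x)
    (hP : IsOrderedUnboundedPolygon (n := k + 1) m c) (hν : ∀ i, 0 ≤ det2 ν (toPlane (m i)))
    {p : ℝ × ℝ} (hp : 0 < p.2) (i : Fin (k + 2)) : 0 < affineForm (m i) (c i) (x p) := by
  obtain ⟨K, hK⟩ := hx.exists_affineForm_eq
  rw [hK i p hp.le]
  refine axialConjugate_pos (by rw [det2_swap]; linarith [hν i]) (fun s ↦ ?_) ?_ hp
  · rw [← hK i (s, 0) le_rfl]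
    exact hx.boundary_mem_region hP s i
  · obtain ⟨s, hs⟩ := hx.exists_boundary_pos hP i
    exact ⟨s, by rwa [← hK i (s, 0) le_rfl]⟩

theorem IsJoyceCoordinates.mem_interior (hx : IsJoyceCoordinates (n := k + 1) m c ν a x)
    (hP : IsOrderedUnboundedPolygon (n := k + 1) m c) (hν : ∀ i, 0 ≤ det2 ν (toPlane (m i)))
    {p : ℝ × ℝ} (hp : 0 < p.2) : x p ∈ interior (region m c) := by
  rw [interior_region hP.primitive]
  exact hx.affineForm_pos hP hν hp

/-- Properness of the coordinates: the sum of the affine functionals of the first two edges grows at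
least linearly on the half-plane, because it does so on the boundary. -/
theorem IsJoyceCoordinates.sqrt_le (hx : IsJoyceCoordinates (n := k + 1) m c ν a x)
    (hP : IsOrderedUnboundedPolygon (n := k + 1) m c) (hν : ∀ i, 0 ≤ det2 ν (toPlane (m i)))
    {p : ℝ × ℝ} (hp : 0 ≤ p.2) : Real.sqrt ((p.1 + a 0) ^ 2 + p.2 ^ 2)
      ≤ affineForm (m 0) (c 0) (x p) + affineForm (m 1) (c 1) (x p) + (a (Fin.last k) - a 0) := by
  obtain ⟨K, hK⟩ := hx.exists_affineForm_eq
  have hsum : ∀ q : ℝ × ℝ, 0 ≤ q.2 → affineForm (m 0) (c 0) (x q) + affineForm (m 1) (c 1) (x q)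
      + (a (Fin.last k) - a 0) = (K 0 + K 1 + (a (Fin.last k) - a 0)) + axialConjugate a
        (fun j ↦ 1 * det2 (toPlane (m 0)) (toPlane (m j))
          + 1 * det2 (toPlane (m 1)) (toPlane (m j)))
        (1 * det2 (toPlane (m 0)) ν + 1 * det2 (toPlane (m 1)) ν) q := by
    intro q hq
    rw [axialConjugate_add, hK 0 q hq, hK 1 q hq]
    ring
  rw [hsum p hp]
  refine sqrt_le_axialConjugate ?_ 0 (fun s ↦ ?_) p
  · rw [det2_swap _ ν, det2_swap _ ν]
    linarith [hν 0, hν 1]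
  rw [← hsum (s, 0) le_rfl]
  have hr0 := hx.boundary_mem_region hP s 0
  have hr1 := hx.boundary_mem_region hP s 1
  have hmono : a 0 ≤ a (Fin.last k) := hx.strictMono.monotone (Fin.zero_le _)
  rcases le_total (-a 0) s with hs | hs
  · have h1 := hx.affineForm_right hs 1
    have h2 : det2 (toPlane (m 1)) (toPlane (m 0)) = 1 := by
      rw [det2_swap, det2_toPlane, hP.det2_zero_one]
      norm_num
    rw [h2] at h1
    rw [abs_of_nonneg (by linarith)]
    linarith [hx.vertex_nonneg 0 1]
  rw [abs_of_nonpos (by linarith)]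
  rcases le_total (-a (Fin.last k)) s with hs' | hs'
  · linarith
  · have h0 := hx.affineForm_left hs' 0
    have h1 := hx.affineForm_left hs' 1
    have h2 : (1 : ℝ) ≤ -det2 (toPlane (m 0)) (toPlane (m (Fin.last (k + 1))))
        + -det2 (toPlane (m 1)) (toPlane (m (Fin.last (k + 1)))) := by
      rw [← det2_swap, ← det2_swap, det2_toPlane, det2_toPlane]
      exact_mod_cast hP.det2_last_sum_pos
    have h3 := mul_le_mul_of_nonpos_left h2 (by linarith : s + a (Fin.last k) ≤ 0)
    linarith [hx.vertex_nonneg (Fin.last k) 0, hx.vertex_nonneg (Fin.last k) 1]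

theorem isCompact_halfDisc (b R : ℝ) :
    IsCompact {p : ℝ × ℝ | 0 ≤ p.2 ∧ Real.sqrt ((p.1 + b) ^ 2 + p.2 ^ 2) ≤ R} := by
  refine ((isCompact_Icc (a := -b - R) (b := -b + R)).prod
    (isCompact_Icc (a := 0) (b := R))).of_isClosed_subset ?_ ?_
  · exact (isClosed_le continuous_const continuous_snd).inter
      (isClosed_le
      (by fun_prop : Continuous fun p : ℝ × ℝ ↦ Real.sqrt ((p.1 + b) ^ 2 + p.2 ^ 2))
      continuous_const)
  · rintro ⟨H, r⟩ ⟨hr, h⟩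
    simp only at hr h
    have h1 : |H + b| ≤ Real.sqrt ((H + b) ^ 2 + r ^ 2) :=
      Real.abs_le_sqrt (by nlinarith [sq_nonneg r])
    have h2 : |r| ≤ Real.sqrt ((H + b) ^ 2 + r ^ 2) :=
      Real.abs_le_sqrt (by nlinarith [sq_nonneg (H + b)])
    have h3 := abs_le.1 (h1.trans h)
    have h4 := abs_le.1 (h2.trans h)
    exact ⟨⟨by simp only; linarith, by simp only; linarith⟩, ⟨hr, h4.2⟩⟩

theorem strictMono_div_sqrt {r : ℝ} (hr : 0 < r) :
    StrictMono fun h : ℝ ↦ h / Real.sqrt (h ^ 2 + r ^ 2) := by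
  have hd : ∀ h : ℝ, HasDerivAt (fun h : ℝ ↦ h / Real.sqrt (h ^ 2 + r ^ 2))
      (r ^ 2 / Real.sqrt (h ^ 2 + r ^ 2) ^ 3) h := by
    intro h
    have hρ := sqrt_sq_add_sq_pos h hr
    have h1 : HasDerivAt (fun h : ℝ ↦ h ^ 2 + r ^ 2) (2 * h) h := by
      simpa using (hasDerivAt_pow 2 h).add_const (r ^ 2)
    have h2 := (hasDerivAt_id h).div (h1.sqrt (by positivity)) hρ.ne'
    refine h2.congr_deriv ?_
    have hsq : Real.sqrt (h ^ 2 + r ^ 2) ^ 2 = h ^ 2 + r ^ 2 := Real.sq_sqrt (by positivity)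
    set ρ := Real.sqrt (h ^ 2 + r ^ 2)
    simp only [id]
    field_simp
    linarith
  refine strictMono_of_deriv_pos fun h ↦ ?_
  rw [(hd h).deriv]
  have hρ := sqrt_sq_add_sq_pos h hr
  positivity

/-- The differentials of the two coordinates do not both vanish: the functional of the first edge
has negative derivative along `H`. -/
theorem IsJoyceCoordinates.conjForm_ne_zero (hx : IsJoyceCoordinates (n := k + 1) m c ν a x)
    (hP : IsOrderedUnboundedPolygon (n := k + 1) m c) {p : ℝ × ℝ} (hp : 0 < p.2) :
    ¬ (conjForm (xi m a ν 1) p = 0 ∧ conjForm (xi m a ν 0) p = 0) := by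
  rintro ⟨h1, h0⟩
  have e1 := hasFDerivAt_axialConjugate a (fun j ↦ (m j 1 : ℝ)) (ν 1) hp
  have e0 := hasFDerivAt_axialConjugate a (fun j ↦ (m j 0 : ℝ)) (ν 0) hp
  rw [← xi_eq_axialPotential, h1] at e1
  rw [← xi_eq_axialPotential, h0] at e0
  -- the functional of the first edge is strictly decreasing in `H`
  set e : Fin (k + 2) → ℝ := fun j ↦ det2 (toPlane (m j)) (toPlane (m 0)) with he
  set κ := (m 0 1 : ℝ) * ν 0 + -(m 0 0 : ℝ) * ν 1 with hκ
  have hcomb : axialConjugate a e κ = fun q ↦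
      (m 0 1 : ℝ) * axialConjugate a (fun j ↦ (m j 0 : ℝ)) (ν 0) q
        + -(m 0 0 : ℝ) * axialConjugate a (fun j ↦ (m j 1 : ℝ)) (ν 1) q := by
    funext q
    rw [← axialConjugate_add]
    congr 1
    funext j
    simp only [he, det2, toPlane]
    ring
  have hd := hasFDerivAt_axialConjugate' a e κ hp
  rw [hcomb] at hd
  have huniq := hd.unique ((e0.const_mul (m 0 1 : ℝ)).add (e1.const_mul (-(m 0 0 : ℝ))))
  have hval := congrArg (fun L : ℝ × ℝ →L[ℝ] ℝ ↦ L (1, 0)) huniq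
  simp only [sub_apply, smul_apply, ContinuousLinearMap.coe_fst', ContinuousLinearMap.coe_snd',
    smul_eq_mul, mul_one, mul_zero, sub_zero, smul_zero, add_zero,
    zero_apply] at hval
  have hlt := sum_succ_sub_mul_lt (e := e) (fun i ↦ hP.det2_toPlane_first_nonneg i)
    (by simp only [he, det2]; ring)
    (by
      simp only [he]
      rw [det2_swap, det2_toPlane, hP.det2_zero_one]
      norm_num)
    (g := fun i ↦ (p.1 + a i) / Real.sqrt ((p.1 + a i) ^ 2 + p.2 ^ 2))
    (fun i j hij ↦ strictMono_div_sqrt hp (by linarith [hx.strictMono hij])) (M := 1)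
    (fun i ↦ by
      rw [div_lt_one (sqrt_sq_add_sq_pos _ hp)]
      exact (le_abs_self _).trans_lt (Real.lt_sqrt_of_sq_lt (by rw [sq_abs]; nlinarith)))
  have hz : e 0 = 0 := by simp only [he, det2]; ring
  rw [hz] at hval
  linarith

theorem IsJoyceCoordinates.hasFDerivAt (hx : IsJoyceCoordinates (n := k + 1) m c ν a x)
    {p : ℝ × ℝ} (hp : 0 < p.2) : HasFDerivAt x
      (ContinuousLinearMap.pi ![conjForm (xi m a ν 1) p, -conjForm (xi m a ν 0) p]) p := by
  rw [hasFDerivAt_pi']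
  intro i
  fin_cases i
  · exact hx.primitive_zero p hp
  · exact hx.primitive_one p hp

theorem IsJoyceCoordinates.contDiffAt (hx : IsJoyceCoordinates (n := k + 1) m c ν a x)
    {p : ℝ × ℝ} (hp : 0 < p.2) : ContDiffAt ℝ 1 x p := by
  obtain ⟨C₀, C₁, hC⟩ := hx.exists_eq_axialConjugate
  rw [contDiffAt_pi]
  have hev : ∀ᶠ q : ℝ × ℝ in 𝓝 p, 0 < q.2 := continuous_snd.continuousAt.eventually_const_lt hp
  intro i
  fin_cases i
  · refine (contDiffAt_const.add (contDiffAt_axialConjugate a _ (ν 1) hp)).congr_of_eventuallyEq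
      (hev.mono fun q hq ↦ (hC q hq.le).1)
  · refine (contDiffAt_const.sub (contDiffAt_axialConjugate a _ (ν 0) hp)).congr_of_eventuallyEq
      (hev.mono fun q hq ↦ (hC q hq.le).2)

theorem fderiv_apply_of_hasFDerivAt_sum {u : Plane → ℝ} {y : Plane} {ξ : Fin 2 → ℝ}
    (h : HasFDerivAt u (∑ k, ξ k • ContinuousLinearMap.proj (R := ℝ) (φ := fun _ ↦ ℝ) k) y)
    (k : Fin 2) : fderiv ℝ u y (Pi.single k 1) = ξ k := by
  rw [h.fderiv]
  fin_cases k <;> simp [Fin.sum_univ_two]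

theorem conjForm_eq_zero {f : ℝ × ℝ → ℝ} {p v : ℝ × ℝ} (hp : 0 < p.2) (hv : v ≠ 0)
    (h : fderiv ℝ f p v = 0) (h' : conjForm f p v = 0) : conjForm f p = 0 := by
  have hdec : v = v.1 • (1, 0) + v.2 • (0, 1) := by ext <;> simp
  rw [hdec, map_add, map_smul, map_smul] at h
  have h2 : fderiv ℝ f p (0, 1) * v.1 - fderiv ℝ f p (1, 0) * v.2 = 0 := by
    have := h'
    simp only [conjForm, sub_apply, smul_apply, ContinuousLinearMap.coe_fst',
      ContinuousLinearMap.coe_snd', smul_eq_mul] at this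
    exact (mul_eq_zero.1 this).resolve_left hp.ne'
  simp only [smul_eq_mul] at h
  have hpos : v.1 ^ 2 + v.2 ^ 2 ≠ 0 := by
    intro h0
    apply hv
    have e1 : v.1 = 0 := by nlinarith [sq_nonneg v.1, sq_nonneg v.2]
    have e2 : v.2 = 0 := by nlinarith [sq_nonneg v.1, sq_nonneg v.2]
    exact Prod.ext e1 e2
  have ha : fderiv ℝ f p (1, 0) = 0 := by
    refine (mul_eq_zero.1 (?_ : (v.1 ^ 2 + v.2 ^ 2) * fderiv ℝ f p (1, 0) = 0)).resolve_left hpos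
    linear_combination v.1 * h - v.2 * h2
  have hb : fderiv ℝ f p (0, 1) = 0 := by
    refine (mul_eq_zero.1 (?_ : (v.1 ^ 2 + v.2 ^ 2) * fderiv ℝ f p (0, 1) = 0)).resolve_left hpos
    linear_combination v.2 * h + v.1 * h2
  rw [conjForm, ha, hb]
  simp

/-- The coordinates are a local diffeomorphism. A vector killed by `dx` is killed by `dξ`, since `ξ`
is the gradient of `u` at `x`; as `dx` is obtained from `dξ` by a rotation, both would vanish. -/
theorem IsJoyceCoordinates.map_nhds (hx : IsJoyceCoordinates (n := k + 1) m c ν a x)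
    (hP : IsOrderedUnboundedPolygon (n := k + 1) m c) (hν : ∀ i, 0 ≤ det2 ν (toPlane (m i)))
    {u : Plane → ℝ} (hu : ContDiffOn ℝ ∞ u (interior (region m c)))
    (hux : ∀ p : ℝ × ℝ, 0 < p.2 →
      HasFDerivAt u (∑ k, xi m a ν k p • ContinuousLinearMap.proj (R := ℝ) k) (x p))
    {p : ℝ × ℝ} (hp : 0 < p.2) : Filter.map x (𝓝 p) = 𝓝 (x p) := by
  have hd := hx.hasFDerivAt hp
  set D := ContinuousLinearMap.pi ![conjForm (xi m a ν 1) p, -conjForm (xi m a ν 0) p] with hD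
  have hstrict : HasStrictFDerivAt x D p := by
    have := (hx.contDiffAt hp).hasStrictFDerivAt (by norm_num)
    rwa [hd.fderiv] at this
  have hcd : ContDiffAt ℝ ∞ u (x p) :=
    hu.contDiffAt (isOpen_interior.mem_nhds (hx.mem_interior hP hν hp))
  have hcd1 : ContDiffAt ℝ 1 (fderiv ℝ u) (x p) := hcd.fderiv_right (by norm_cast)
  have hud : DifferentiableAt ℝ (fderiv ℝ u) (x p) := hcd1.differentiableAt (by norm_num)
  have hxi : ∀ (i : Fin 2) (v : ℝ × ℝ), D v = 0 → fderiv ℝ (xi m a ν i) p v = 0 := by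
    intro i v hv
    have h1 : HasFDerivAt (fun q ↦ fderiv ℝ u (x q) (Pi.single i 1))
        (((ContinuousLinearMap.apply ℝ ℝ (Pi.single i 1 : Plane)) ∘L
          fderiv ℝ (fderiv ℝ u) (x p)) ∘L D) p :=
      HasFDerivAt.comp p ((ContinuousLinearMap.apply ℝ ℝ (Pi.single i 1 : Plane)).hasFDerivAt.comp
        (x p) hud.hasFDerivAt) hd
    have hev : ∀ᶠ q : ℝ × ℝ in 𝓝 p, 0 < q.2 := continuous_snd.continuousAt.eventually_const_lt hp
    have h2 : HasFDerivAt (xi m a ν i) _ p := h1.congr_of_eventuallyEq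
      (hev.mono fun q hq ↦ (fderiv_apply_of_hasFDerivAt_sum (hux q hq) i).symm)
    rw [h2.fderiv, ContinuousLinearMap.comp_apply, hv, map_zero]
  have hinj : Function.Injective D := by
    rw [injective_iff_map_eq_zero]
    intro v hv
    by_contra hne
    have h0 : conjForm (xi m a ν 1) p v = 0 := congrFun hv 0
    have h1 : -conjForm (xi m a ν 0) p v = 0 := congrFun hv 1
    exact hx.conjForm_ne_zero hP hp ⟨conjForm_eq_zero hp hne (hxi 1 v hv) h0,
      conjForm_eq_zero hp hne (hxi 0 v hv) (neg_eq_zero.1 h1)⟩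
  have hsurj : Function.Surjective D :=
    (LinearMap.injective_iff_surjective_of_finrank_eq_finrank (f := D.toLinearMap) (by simp)).1 hinj
  exact hstrict.map_nhds_eq_of_surj (LinearMap.range_eq_top.2 hsurj)

/-- The coordinates map the open half-plane onto the interior of the polygon: the image is open, and
it is closed in the interior of the polygon because the coordinates are proper and map the boundary
of the half-plane into the edges. -/
theorem IsJoyceCoordinates.exists_eq (hx : IsJoyceCoordinates (n := k + 1) m c ν a x)
    (hP : IsOrderedUnboundedPolygon (n := k + 1) m c) (hν : ∀ i, 0 ≤ det2 ν (toPlane (m i)))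
    {u : Plane → ℝ} (hu : ContDiffOn ℝ ∞ u (interior (region m c)))
    (hux : ∀ p : ℝ × ℝ, 0 < p.2 →
      HasFDerivAt u (∑ k, xi m a ν k p • ContinuousLinearMap.proj (R := ℝ) k) (x p))
    {y : Plane} (hy : y ∈ interior (region m c)) : ∃ p : ℝ × ℝ, 0 < p.2 ∧ x p = y := by
  have hconv : Convex ℝ (region m c) := by
    intro y hy z hz s t hs ht hst i
    have h1 : affineForm (m i) (c i) (s • y + t • z)
        = s * affineForm (m i) (c i) y + t * affineForm (m i) (c i) z := by
      simp only [affineForm_eq, Pi.add_apply, Pi.smul_apply, smul_eq_mul]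
      linear_combination (-c i) * hst
    rw [h1]
    exact add_nonneg (mul_nonneg hs (hy i)) (mul_nonneg ht (hz i))
  set V := x '' {p | 0 < p.2} with hV
  have hVopen : IsOpen V := by
    rw [isOpen_iff_mem_nhds]
    rintro _ ⟨p, hp, rfl⟩
    rw [← hx.map_nhds hP hν hu hux hp]
    exact Filter.image_mem_map ((isOpen_lt continuous_const continuous_snd).mem_nhds hp)
  have hsub : interior (region m c) ⊆ V := by
    refine hconv.interior.isPreconnected.subset_of_closure_inter_subset hVopen
      ⟨x (0, 1), hx.mem_interior hP hν one_pos, (0, 1),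
        (one_pos : (0 : ℝ) < 1), rfl⟩ ?_
    rintro z ⟨hz, hzint⟩
    set W : Plane → ℝ := fun y ↦ affineForm (m 0) (c 0) y + affineForm (m 1) (c 1) y with hW
    have hWc : Continuous W := (continuous_affineForm _ _).add (continuous_affineForm _ _)
    set N : Set Plane := {y | W y < W z + 1} with hN
    have hNopen : IsOpen N := isOpen_lt hWc continuous_const
    set R := W z + 1 + (a (Fin.last k) - a 0) with hR
    have hK := isCompact_halfDisc (a 0) R
    have hxK : IsCompact (x '' {p : ℝ × ℝ | 0 ≤ p.2 ∧
        Real.sqrt ((p.1 + a 0) ^ 2 + p.2 ^ 2) ≤ R}) :=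
      hK.image_of_continuousOn (hx.continuous.mono fun p hp ↦ hp.1)
    have hz2 : z ∈ closure (N ∩ V) := hNopen.inter_closure ⟨by simp [hN], hz⟩
    have hsubK : N ∩ V ⊆ x '' {p : ℝ × ℝ | 0 ≤ p.2 ∧
        Real.sqrt ((p.1 + a 0) ^ 2 + p.2 ^ 2) ≤ R} := by
      rintro _ ⟨hy, p, hp, rfl⟩
      have hp' : 0 < p.2 := hp
      refine ⟨p, ⟨hp'.le, (hx.sqrt_le hP hν hp'.le).trans ?_⟩, rfl⟩
      have : W (x p) < W z + 1 := hy
      linarith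
    obtain ⟨p, hp, rfl⟩ := closure_minimal hsubK hxK.isClosed hz2
    rcases hp.1.lt_or_eq with h0 | h0
    · exact ⟨p, h0, rfl⟩
    · obtain ⟨i, hi⟩ := hx.exists_boundary_eq_zero p.1
      have hpe : p = (p.1, 0) := Prod.ext rfl h0.symm
      rw [interior_region hP.primitive] at hzint
      have := hzint i
      rw [hpe, hi] at this
      exact absurd this (lt_irrefl 0)
  obtain ⟨p, hp, rfl⟩ := hsub hy
  exact ⟨p, hp, rfl⟩

end Surjectivity

/-! ### Growth of the gradient of the potential -/

section Growth

/-- The logarithms in the potential are shifted inverse hyperbolic sines, hence odd up to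
`log r`. -/
theorem log_add_sqrt (h : ℝ) {r : ℝ} (hr : 0 < r) :
    Real.log (h + Real.sqrt (h ^ 2 + r ^ 2)) = Real.log r + Real.arsinh (h / r) := by
  have h1 : Real.sqrt (h ^ 2 + r ^ 2) = r * Real.sqrt (1 + (h / r) ^ 2) := by
    have : h ^ 2 + r ^ 2 = r ^ 2 * (1 + (h / r) ^ 2) := by
      field_simp
      ring
    rw [this, Real.sqrt_mul (sq_nonneg r), Real.sqrt_sq hr.le]
  have h2 : h + Real.sqrt (h ^ 2 + r ^ 2) = r * Real.exp (Real.arsinh (h / r)) := by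
    rw [Real.exp_arsinh, h1, mul_add, mul_div_cancel₀ _ hr.ne']
  rw [h2, Real.log_mul hr.ne' (Real.exp_pos _).ne', Real.log_exp]

theorem strictMono_log_add_sqrt {r : ℝ} (hr : 0 < r) :
    StrictMono fun h : ℝ ↦ Real.log (h + Real.sqrt (h ^ 2 + r ^ 2)) := by
  intro h h' hlt
  simp only [log_add_sqrt _ hr]
  have := Real.arsinh_strictMono (div_lt_div_of_pos_right hlt hr)
  linarith

theorem sqrt_add_sq_le (H b r : ℝ) :
    Real.sqrt ((H + b) ^ 2 + r ^ 2) ≤ Real.sqrt (H ^ 2 + r ^ 2) + |b| := by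
  have hρ := Real.sqrt_nonneg (H ^ 2 + r ^ 2)
  have hsq : Real.sqrt (H ^ 2 + r ^ 2) ^ 2 = H ^ 2 + r ^ 2 := Real.sq_sqrt (by positivity)
  have hH : |H| ≤ Real.sqrt (H ^ 2 + r ^ 2) := Real.abs_le_sqrt (by nlinarith [sq_nonneg r])
  refine Real.sqrt_le_iff.2 ⟨by positivity, ?_⟩
  have h1 : H * b ≤ Real.sqrt (H ^ 2 + r ^ 2) * |b| :=
    (le_abs_self _).trans ((abs_mul H b).trans_le (mul_le_mul_of_nonneg_right hH (abs_nonneg b)))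
  nlinarith [sq_abs b]

variable {n : ℕ}

/-- The reflection `H ↦ -H` reverses the order of the edges and the sign of `κ`. -/
theorem axialPotential_reflect (a : Fin n → ℝ) (c : Fin (n + 1) → ℝ) (κ : ℝ) {p : ℝ × ℝ}
    (hp : 0 < p.2) : axialPotential a c κ p
      = axialPotential (fun j ↦ -a j.rev) (fun j ↦ c j.rev) (-κ) (-p.1, p.2) := by
  have h1 : ∑ i : Fin n, (c i.succ.rev - c i.castSucc.rev)
        * Real.log (-p.1 + -a i.rev + Real.sqrt ((-p.1 + -a i.rev) ^ 2 + p.2 ^ 2))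
      = ∑ i : Fin n, (c i.castSucc - c i.succ)
        * Real.log (-p.1 + -a i + Real.sqrt ((-p.1 + -a i) ^ 2 + p.2 ^ 2)) := by
    rw [← Equiv.sum_comp Fin.revPerm]
    refine Finset.sum_congr rfl fun i _ ↦ ?_
    simp only [Fin.revPerm_apply, Fin.rev_succ, Fin.rev_castSucc, Fin.rev_rev]
  have h2 : ∀ i : Fin n, (c i.castSucc - c i.succ)
        * Real.log (-p.1 + -a i + Real.sqrt ((-p.1 + -a i) ^ 2 + p.2 ^ 2))
      = (c i.succ - c i.castSucc) * Real.log (p.1 + a i + Real.sqrt ((p.1 + a i) ^ 2 + p.2 ^ 2))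
        - (c i.succ - c i.castSucc) * (2 * Real.log p.2) := by
    intro i
    have h3 : -p.1 + -a i = -(p.1 + a i) := by ring
    rw [h3, log_add_sqrt _ hp, log_add_sqrt _ hp, neg_div, Real.arsinh_neg]
    ring
  have h4 := sum_succ_sub_castSucc c
  simp only [axialPotential]
  rw [h1, Finset.sum_congr rfl fun i _ ↦ h2 i, Finset.sum_sub_distrib, ← Finset.sum_mul, h4,
    Fin.rev_zero]
  ring

theorem axialPotential_neg {n : ℕ} {a : Fin (n + 1) → ℝ} (ha : StrictMono a) {e : Fin (n + 2) → ℝ}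
    (he : ∀ i, 0 ≤ e i) (h0 : e 0 = 0) (h1 : 0 < e 1) (hl : e (Fin.last (n + 1)) = 0) {p : ℝ × ℝ}
    (hp : 0 < p.2) : axialPotential a e 0 p < 0 := by
  have hmono := strictMono_log_add_sqrt hp
  have h := sum_succ_sub_mul_lt he h0 h1
    (g := fun i ↦ Real.log (p.1 + a i + Real.sqrt ((p.1 + a i) ^ 2 + p.2 ^ 2)))
    (fun i j hij ↦ hmono (by linarith [ha hij]))
    (M := Real.log (p.1 + a (Fin.last n) + Real.sqrt ((p.1 + a (Fin.last n)) ^ 2 + p.2 ^ 2)) + 1)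
    (fun i ↦ lt_add_of_le_of_pos (hmono.monotone
      (by linarith [ha.monotone (Fin.le_last i)])) one_pos)
  rw [hl, zero_mul] at h
  rw [axialPotential, h0]
  linarith

/-- Although the potential is unbounded near the boundary of the half-plane, it is bounded above on
bounded sets if its edge weights are nonnegative and the first one vanishes. -/
theorem axialPotential_le {a : Fin n → ℝ} (ha : Monotone a) {e : Fin (n + 1) → ℝ}
    (he : ∀ i, 0 ≤ e i) (h0 : e 0 = 0) (κ R : ℝ) :
    ∃ M, ∀ p : ℝ × ℝ, 0 < p.2 → |p.1| ≤ R → p.2 ≤ R → axialPotential a e κ p ≤ M := by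
  set β := ∑ i, |a i| with hβ
  have hβi : ∀ i, |a i| ≤ β := fun i ↦
    Finset.single_le_sum (f := fun i ↦ |a i|) (fun i _ ↦ abs_nonneg _) (Finset.mem_univ i)
  refine ⟨1 / 2 * (e (Fin.last n) * Real.log (3 * R + 2 * β)) + |κ| * R, fun p hp hH hr ↦ ?_⟩
  have hmono := (strictMono_log_add_sqrt hp).monotone
  have h := sum_succ_sub_mul_le he h0
    (g := fun i ↦ Real.log (p.1 + a i + Real.sqrt ((p.1 + a i) ^ 2 + p.2 ^ 2)))
    (fun i j hij ↦ hmono (by linarith [ha hij])) (M := Real.log (3 * R + 2 * β))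
    (fun i ↦ by
      refine Real.log_le_log (add_sqrt_sq_add_sq_pos _ hp) ?_
      have h1 := sqrt_add_sq_le 0 (p.1 + a i) p.2
      rw [zero_add, zero_pow two_ne_zero, zero_add, Real.sqrt_sq hp.le] at h1
      have h2 := abs_add_le p.1 (a i)
      have h3 := le_abs_self (p.1 + a i)
      linarith [hβi i])
  have h2 : κ * p.1 ≤ |κ| * R :=
    (le_abs_self _).trans ((abs_mul κ p.1).trans_le (mul_le_mul_of_nonneg_left hH (abs_nonneg κ)))
  rw [axialPotential, h0]
  linarith

/-- If the last edge weight is positive and the first one vanishes, the potential is at least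
`½ e_last log ρ - O(1)` on the quadrant `H ≥ 0`, where `ρ² = H² + r²`; so its sublevel sets are
bounded there. -/
theorem sqrt_le_of_axialPotential_le (a : Fin n → ℝ) {e : Fin (n + 1) → ℝ} (h0 : e 0 = 0)
    (hl : 0 < e (Fin.last n)) {κ : ℝ} (hκ : 0 ≤ κ) (C : ℝ) :
    ∃ R, ∀ p : ℝ × ℝ, 0 < p.2 → 0 ≤ p.1 → axialPotential a e κ p ≤ C →
      Real.sqrt (p.1 ^ 2 + p.2 ^ 2) ≤ R := by
  set β := ∑ i, |a i| with hβ
  have hβi : ∀ i, |a i| ≤ β := fun i ↦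
    Finset.single_le_sum (f := fun i ↦ |a i|) (fun i _ ↦ abs_nonneg _) (Finset.mem_univ i)
  have hβ0 : 0 ≤ β := Finset.sum_nonneg fun i _ ↦ abs_nonneg _
  set T := ∑ i : Fin n, |e i.succ - e i.castSucc| * Real.log 3 with hT
  refine ⟨max (3 * β + 1) (Real.exp ((2 * C + T) / e (Fin.last n))), fun p hp hH hC ↦ ?_⟩
  set ρ := Real.sqrt (p.1 ^ 2 + p.2 ^ 2) with hρ
  rcases le_total ρ (3 * β + 1) with hle | hge
  · exact hle.trans (le_max_left _ _)
  refine le_max_of_le_right ?_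
  have hρ0 : 0 < ρ := by linarith
  -- each logarithm differs from `log ρ` by at most `log 3`
  have hL : ∀ i, |Real.log (p.1 + a i + Real.sqrt ((p.1 + a i) ^ 2 + p.2 ^ 2)) - Real.log ρ|
      ≤ Real.log 3 := by
    intro i
    have h1 := sqrt_add_sq_le p.1 (a i) p.2
    have h2 := sqrt_add_sq_le (p.1 + a i) (-a i) p.2
    rw [add_neg_cancel_right, abs_neg] at h2
    have h3 : p.1 ≤ ρ := (le_abs_self _).trans (Real.abs_le_sqrt (by nlinarith [sq_nonneg p.2]))
    have h4 := abs_le.1 (hβi i)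
    have h5 := hβi i
    have hpos := add_sqrt_sq_add_sq_pos (p.1 + a i) hp
    set s := p.1 + a i + Real.sqrt ((p.1 + a i) ^ 2 + p.2 ^ 2) with hs
    rw [abs_le]
    constructor
    · have h6 : Real.log ρ ≤ Real.log (3 * s) := Real.log_le_log hρ0 (by linarith)
      rw [Real.log_mul (by norm_num) hpos.ne'] at h6
      linarith
    · have h6 : Real.log s ≤ Real.log (3 * ρ) := Real.log_le_log hpos (by linarith)
      rw [Real.log_mul (by norm_num) hρ0.ne'] at h6
      linarith
  have hsum : ∑ i : Fin n, (e i.succ - e i.castSucc)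
        * (Real.log ρ - Real.log (p.1 + a i + Real.sqrt ((p.1 + a i) ^ 2 + p.2 ^ 2))) ≤ T := by
    refine Finset.sum_le_sum fun i _ ↦ (le_abs_self _).trans ?_
    rw [abs_mul, abs_sub_comm (Real.log ρ)]
    exact mul_le_mul_of_nonneg_left (hL i) (abs_nonneg _)
  simp only [mul_sub, Finset.sum_sub_distrib] at hsum
  rw [← Finset.sum_mul, sum_succ_sub_castSucc, h0, sub_zero] at hsum
  rw [axialPotential, h0] at hC
  have h7 : 0 ≤ κ * p.1 := mul_nonneg hκ hH
  rw [← Real.log_le_iff_le_exp hρ0, le_div_iff₀ hl]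
  linarith

end Growth

section Gradient

variable {k : ℕ} {m : Fin (k + 2) → Fin 2 → ℤ} {c : Fin (k + 2) → ℝ} {ν : Plane}
  {a : Fin (k + 1) → ℝ} {x : ℝ × ℝ → Plane}

/-- The gradient of a function on the plane, as the vector of its partial derivatives. -/
def grad (u : Plane → ℝ) (y : Plane) : Plane := fun j ↦ fderiv ℝ u y (Pi.single j 1)

theorem det2_grad_first {u : Plane → ℝ} {p : ℝ × ℝ}
    (h : HasFDerivAt u
      (∑ k, xi m a ν k p • ContinuousLinearMap.proj (R := ℝ) (φ := fun _ ↦ ℝ) k) (x p)) :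
    det2 (grad u (x p)) (toPlane (m 0)) = axialPotential a
      (fun j ↦ det2 (toPlane (m j)) (toPlane (m 0))) (det2 ν (toPlane (m 0))) p := by
  have h1 := axialPotential_add a (m 0 1 : ℝ) (-(m 0 0 : ℝ)) (fun j ↦ (m j 0 : ℝ))
    (fun j ↦ (m j 1 : ℝ)) (ν 0) (ν 1) p
  rw [← xi_eq_axialPotential, ← xi_eq_axialPotential] at h1
  have h2 : (fun j ↦ det2 (toPlane (m j)) (toPlane (m 0)))
      = fun j ↦ (m 0 1 : ℝ) * (m j 0 : ℝ) + -(m 0 0 : ℝ) * (m j 1 : ℝ) := by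
    funext j
    simp only [det2, toPlane]
    ring
  have h3 : det2 ν (toPlane (m 0)) = (m 0 1 : ℝ) * ν 0 + -(m 0 0 : ℝ) * ν 1 := by
    simp only [det2, toPlane]
    ring
  rw [h2, h3, h1]
  simp only [det2, toPlane, grad, fderiv_apply_of_hasFDerivAt_sum h]
  ring

theorem det2_last_grad {u : Plane → ℝ} {p : ℝ × ℝ}
    (h : HasFDerivAt u
      (∑ k, xi m a ν k p • ContinuousLinearMap.proj (R := ℝ) (φ := fun _ ↦ ℝ) k) (x p)) :
    det2 (toPlane (m (Fin.last (k + 1)))) (grad u (x p)) = axialPotential a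
      (fun j ↦ det2 (toPlane (m (Fin.last (k + 1)))) (toPlane (m j)))
      (det2 (toPlane (m (Fin.last (k + 1)))) ν) p := by
  set l := m (Fin.last (k + 1)) with hl
  have h1 := axialPotential_add a (l 0 : ℝ) (-(l 1 : ℝ)) (fun j ↦ (m j 1 : ℝ))
    (fun j ↦ (m j 0 : ℝ)) (ν 1) (ν 0) p
  rw [← xi_eq_axialPotential, ← xi_eq_axialPotential] at h1
  have h2 : (fun j ↦ det2 (toPlane l) (toPlane (m j)))
      = fun j ↦ (l 0 : ℝ) * (m j 1 : ℝ) + -(l 1 : ℝ) * (m j 0 : ℝ) := by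
    funext j
    simp only [det2, toPlane]
    ring
  have h3 : det2 (toPlane l) ν = (l 0 : ℝ) * ν 1 + -(l 1 : ℝ) * ν 0 := by
    simp only [det2, toPlane]
    ring
  rw [h2, h3, h1]
  simp only [det2, toPlane, grad, fderiv_apply_of_hasFDerivAt_sum h]
  ring

/-- If the unbounded edges are parallel, the gradient of the potential stays in an open
half-plane. -/
theorem IsJoyceCoordinates.det2_grad_neg (hx : IsJoyceCoordinates (n := k + 1) m c ν a x)
    (hP : IsOrderedUnboundedPolygon (n := k + 1) m c) (hν : ∀ i, 0 ≤ det2 ν (toPlane (m i)))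
    {u : Plane → ℝ} (hu : ContDiffOn ℝ ∞ u (interior (region m c)))
    (hux : ∀ p : ℝ × ℝ, 0 < p.2 →
      HasFDerivAt u (∑ k, xi m a ν k p • ContinuousLinearMap.proj (R := ℝ) k) (x p))
    (hm : ¬ IsStrictlyUnbounded m) {y : Plane} (hy : y ∈ interior (region m c)) :
    det2 (grad u y) (toPlane (m 0)) < 0 := by
  obtain ⟨p, hp, rfl⟩ := hx.exists_eq hP hν hu hux hy
  have hl := hP.eq_neg_of_not_isStrictlyUnbounded hm
  have hl' : ∀ v : Plane, det2 v (toPlane (m (Fin.last (k + 1)))) = -det2 v (toPlane (m 0)) := by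
    intro v
    rw [hl]
    simp only [det2, toPlane, Pi.neg_apply, Int.cast_neg]
    ring
  have hκ : det2 ν (toPlane (m 0)) = 0 := by
    have h1 := hν (Fin.last (k + 1))
    rw [hl'] at h1
    linarith [hν 0]
  rw [det2_grad_first (hux p hp), hκ]
  refine axialPotential_neg hx.strictMono hP.det2_toPlane_first_nonneg ?_ ?_ ?_ hp
  · simp only [det2]
    ring
  · rw [det2_swap, det2_toPlane, hP.det2_zero_one]
    norm_num
  · rw [det2_swap, hl']
    simp only [det2]
    ring

/-- Near any point of the plane, boundary points of the polygon included, two linear functionals of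
the gradient of the potential are bounded above. -/
theorem IsJoyceCoordinates.exists_eventually_grad_le
    (hx : IsJoyceCoordinates (n := k + 1) m c ν a x)
    (hP : IsOrderedUnboundedPolygon (n := k + 1) m c) (hν : ∀ i, 0 ≤ det2 ν (toPlane (m i)))
    {u : Plane → ℝ} (hu : ContDiffOn ℝ ∞ u (interior (region m c)))
    (hux : ∀ p : ℝ × ℝ, 0 < p.2 →
      HasFDerivAt u (∑ k, xi m a ν k p • ContinuousLinearMap.proj (R := ℝ) k) (x p))
    (y₀ : Plane) : ∃ M, ∀ᶠ y in 𝓝 y₀, y ∈ interior (region m c) →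
      det2 (grad u y) (toPlane (m 0)) ≤ M ∧
      det2 (toPlane (m (Fin.last (k + 1)))) (grad u y) ≤ M := by
  set W : Plane → ℝ := fun y ↦ affineForm (m 0) (c 0) y + affineForm (m 1) (c 1) y with hW
  have hWc : Continuous W := (continuous_affineForm _ _).add (continuous_affineForm _ _)
  set R := W y₀ + 1 + (a (Fin.last k) - a 0) + |a 0| with hR
  obtain ⟨M₁, h₁⟩ := axialPotential_le hx.strictMono.monotone hP.det2_toPlane_first_nonneg
    (by simp only [det2]; ring) (det2 ν (toPlane (m 0))) R
  obtain ⟨M₂, h₂⟩ := axialPotential_le (a := fun j ↦ -a j.rev)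
    (fun i j hij ↦ neg_le_neg (hx.strictMono.monotone (Fin.rev_le_rev.2 hij)))
    (e := fun j ↦ det2 (toPlane (m (Fin.last (k + 1)))) (toPlane (m j.rev)))
    (fun i ↦ hP.det2_toPlane_last_nonneg _) (by simp only [det2, Fin.rev_zero]; ring)
    (-det2 (toPlane (m (Fin.last (k + 1)))) ν) R
  refine ⟨max M₁ M₂, ?_⟩
  filter_upwards [hWc.continuousAt.eventually_lt_const (lt_add_one (W y₀))] with y hy hyint
  obtain ⟨p, hp, rfl⟩ := hx.exists_eq hP hν hu hux hyint
  have hs := hx.sqrt_le hP hν hp.le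
  have hW' : affineForm (m 0) (c 0) (x p) + affineForm (m 1) (c 1) (x p) < W y₀ + 1 := hy
  have h3 : |p.1 + a 0| ≤ Real.sqrt ((p.1 + a 0) ^ 2 + p.2 ^ 2) :=
    Real.abs_le_sqrt (by nlinarith [sq_nonneg p.2])
  have h4 : |p.2| ≤ Real.sqrt ((p.1 + a 0) ^ 2 + p.2 ^ 2) :=
    Real.abs_le_sqrt (by nlinarith [sq_nonneg (p.1 + a 0)])
  have h5 : |p.1| ≤ |p.1 + a 0| + |a 0| := by
    have := abs_sub (p.1 + a 0) (a 0)
    rwa [add_sub_cancel_right] at this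
  have hH : |p.1| ≤ R := by linarith
  have hr : p.2 ≤ R := by linarith [le_abs_self p.2, abs_nonneg (a 0)]
  rw [det2_grad_first (hux p hp), det2_last_grad (hux p hp), axialPotential_reflect a
    (fun j ↦ det2 (toPlane (m (Fin.last (k + 1)))) (toPlane (m j))) _ hp]
  exact ⟨(h₁ p hp hH hr).trans (le_max_left _ _),
    (h₂ (-p.1, p.2) hp (by rwa [abs_neg]) hr).trans (le_max_right _ _)⟩

/-- If the polygon is strictly unbounded, upper bounds on the two functionals of the gradient
confine a point to a compact set: the first one controls the quadrant `H ≥ 0`, the second one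
`H ≤ 0`. -/
theorem IsJoyceCoordinates.exists_isCompact_of_grad_le
    (hx : IsJoyceCoordinates (n := k + 1) m c ν a x)
    (hP : IsOrderedUnboundedPolygon (n := k + 1) m c) (hν : ∀ i, 0 ≤ det2 ν (toPlane (m i)))
    {u : Plane → ℝ} (hu : ContDiffOn ℝ ∞ u (interior (region m c)))
    (hux : ∀ p : ℝ × ℝ, 0 < p.2 →
      HasFDerivAt u (∑ k, xi m a ν k p • ContinuousLinearMap.proj (R := ℝ) k) (x p))
    (hm : IsStrictlyUnbounded m) (C : ℝ) :
    ∃ K : Set Plane, IsCompact K ∧ ∀ y ∈ interior (region m c),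
      det2 (grad u y) (toPlane (m 0)) ≤ C →
      det2 (toPlane (m (Fin.last (k + 1)))) (grad u y) ≤ C → y ∈ K := by
  have hpos : 0 < det2 (toPlane (m (Fin.last (k + 1)))) (toPlane (m 0)) := by
    refine lt_of_le_of_ne (hP.det2_toPlane_last_nonneg 0) fun h ↦ hm ?_
    rw [det2_swap, det2_toPlane] at h
    have : det2 (m 0) (m (Fin.last (k + 1))) = 0 := by
      have h1 : ((det2 (m 0) (m (Fin.last (k + 1))) : ℤ) : ℝ) = 0 := by linarith
      exact_mod_cast h1
    exact this
  obtain ⟨R₁, h₁⟩ := sqrt_le_of_axialPotential_le a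
    (e := fun j ↦ det2 (toPlane (m j)) (toPlane (m 0))) (by simp only [det2]; ring) hpos (hν 0) C
  obtain ⟨R₂, h₂⟩ := sqrt_le_of_axialPotential_le (fun j ↦ -a j.rev)
    (e := fun j ↦ det2 (toPlane (m (Fin.last (k + 1)))) (toPlane (m j.rev)))
    (by simp only [det2, Fin.rev_zero]; ring) (by rwa [Fin.rev_last])
    (κ := -det2 (toPlane (m (Fin.last (k + 1)))) ν) (by rw [← det2_swap]; exact hν _) C
  refine ⟨x '' {p | 0 ≤ p.2 ∧ Real.sqrt ((p.1 + 0) ^ 2 + p.2 ^ 2) ≤ max R₁ R₂},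
    (isCompact_halfDisc 0 _).image_of_continuousOn (hx.continuous.mono fun p hp ↦ hp.1), ?_⟩
  intro y hy hy1 hy2
  obtain ⟨p, hp, rfl⟩ := hx.exists_eq hP hν hu hux hy
  refine ⟨p, ⟨hp.le, ?_⟩, rfl⟩
  rw [det2_grad_first (hux p hp)] at hy1
  rw [det2_last_grad (hux p hp), axialPotential_reflect _ _ _ hp] at hy2
  rw [add_zero]
  rcases le_total 0 p.1 with hH | hH
  · exact (h₁ p hp hH hy1).trans (le_max_left _ _)
  · have := h₂ (-p.1, p.2) hp (by simpa using hH) hy2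
    rw [neg_sq] at this
    exact this.trans (le_max_right _ _)

end Gradient

/-! ### Completeness of the complex structure -/

section Completeness

open Set

variable {X : Type*} [TopologicalSpace X] [ChartedSpace (EuclideanSpace ℝ (Fin 4)) X]
  [IsManifold (𝓡 4) ∞ X] {S : SymplecticToric X}
  {J : ∀ p : X, TangentSpace (𝓡 4) p →L[ℝ] TangentSpace (𝓡 4) p}

/-- In the affine structure given by the gradient of the potential, the flow of `J Y_k` on the open
orbits is the translation by `-e_k`. -/
theorem IsToricComplexStructure.grad_comp_integralCurve [T2Space X]
    (hJ : IsToricComplexStructure S J) {u : Plane → ℝ}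
    (hu : ContDiffOn ℝ ∞ u (interior (range S.μ))) {Φ : Plane × Plane → X} (hΦ : IsActionAngle S Φ)
    (hJu : ∀ x ∈ interior (range S.μ), ∀ θ, ∀ v : Plane × Plane,
      J (Φ (x, θ)) (mfderiv 𝓘(ℝ, Plane × Plane) (𝓡 4) Φ (x, θ) v)
        = mfderiv 𝓘(ℝ, Plane × Plane) (𝓡 4) Φ (x, θ)
            ((-((hessian u x)⁻¹.mulVec v.2), (hessian u x).mulVec v.1) : Plane × Plane))
    {d : ℕ} {m : Fin d → Fin 2 → ℤ} {c : Fin d → ℝ}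
    (hm : ∀ i, IsCoprime (m i 0) (m i 1)) (hμ : range S.μ = region m c)
    {k : Fin 2} {γ : ℝ → X} {a b : ℝ}
    (hγ : IsMIntegralCurveOn γ (fun p ↦ J p (S.τ.generator k p)) (Ioo a b)) {t₀ t : ℝ}
    (ht₀ : t₀ ∈ Ioo a b) (h₀ : S.μ (γ t₀) ∈ interior (range S.μ)) (ht : t ∈ Ioo a b) :
    grad u (S.μ (γ t)) = grad u (S.μ (γ t₀)) + (t - t₀) • (-Pi.single k 1 : Plane) := by
  funext j
  have hd : ∀ s ∈ Ioo a b, HasDerivAt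
      (fun s ↦ grad u (S.μ (γ s)) j - s * (-Pi.single k 1 : Plane) j) 0 s := by
    intro s hs
    have h1 := hasDerivAt_gradient_comp hJ hu hΦ hJu
      ((hγ s hs).hasMFDerivAt (Ioo_mem_nhds hs.1 hs.2))
      (hJ.mem_interior_of_isMIntegralCurveOn hΦ hm hμ hγ ht₀ h₀ hs) j
    refine (h1.sub ((hasDerivAt_id s).mul_const ((-Pi.single k 1 : Plane) j))).congr_deriv ?_
    simp
  have hconst := isOpen_Ioo.is_const_of_deriv_eq_zero isPreconnected_Ioo
    (fun s hs ↦ (hd s hs).differentiableAt.differentiableWithinAt) (fun s hs ↦ (hd s hs).deriv)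
    ht ht₀
  simp only [Pi.add_apply, Pi.smul_apply, smul_eq_mul]
  linarith

theorem isClosed_region {d : ℕ} (m : Fin d → Fin 2 → ℤ) (c : Fin d → ℝ) :
    IsClosed (region m c) := by
  simp only [region, Set.ofPred_forall]
  exact isClosed_iInter fun i ↦ isClosed_le continuous_const (continuous_affineForm _ _)

theorem SymplecticToric.isCompact_preimage (S : SymplecticToric X) {K : Set Plane}
    (hK : IsCompact K) (hcl : IsClosed (range S.μ)) : IsCompact (S.μ ⁻¹' K) := by
  have h1 : IsCompact ((↑) ⁻¹' K : Set (range S.μ)) :=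
    hcl.isClosedEmbedding_subtypeVal.isCompact_preimage hK
  exact S.proper.isCompact_preimage h1

end Completeness

end ToricKahler

open ToricKahler

theorem proposition5p3 {X : Type*} [TopologicalSpace X] [T2Space X] [SecondCountableTopology X]
    [ConnectedSpace X] [ChartedSpace (EuclideanSpace ℝ (Fin 4)) X] [IsManifold (𝓡 4) ∞ X]
    (S : ToricKahler.SymplecticToric X)
    {n : ℕ} (m : Fin (n + 1) → Fin 2 → ℤ) (c : Fin (n + 1) → ℝ)
    (hP : ToricKahler.IsOrderedUnboundedPolygon m c)
    (hμ : Set.range S.μ = ToricKahler.region m c)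
    (ν : ToricKahler.Plane)
    (hν : ∀ i, 0 ≤ ToricKahler.det2 ν (ToricKahler.toPlane (m i)))
    (u : ToricKahler.Plane → ℝ) (hu : ToricKahler.IsJoycePotential m c ν u)
    (J : ∀ p : X, TangentSpace (𝓡 4) p →L[ℝ] TangentSpace (𝓡 4) p)
    (hJ : ToricKahler.IsToricComplexStructure S J)
    (hJu : ToricKahler.IsSymplecticPotential S J u) :
    ToricKahler.IsCompleteComplexStructure S J ↔ ToricKahler.IsStrictlyUnbounded m := by
  obtain ⟨k, rfl⟩ : ∃ k, n = k + 1 := ⟨n - 1, by have := hP.one_le; omega⟩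
  obtain ⟨a, x, hx, hux⟩ := hu
  obtain ⟨hus, Φ, hΦ, hJΦ⟩ := hJu
  have hus' : ContDiffOn ℝ ∞ u (interior (region m c)) := hμ ▸ hus
  constructor
  · intro hcomplete
    by_contra hm
    -- some coordinate vector is not parallel to the unbounded edges
    obtain ⟨i, hi⟩ : ∃ i : Fin 2, det2 (Pi.single i 1) (toPlane (m 0)) ≠ 0 := by
      by_contra hcon
      push Not at hcon
      have h0 := hcon 0
      have h1 := hcon 1
      simp only [det2, toPlane, Pi.single_eq_same, one_mul, ne_eq, one_ne_zero, not_false_eq_true,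
        Pi.single_eq_of_ne, zero_ne_one, zero_mul, sub_zero, zero_sub, neg_eq_zero,
        Int.cast_eq_zero] at h0 h1
      have hcop := hP.primitive 0
      rw [h0, h1] at hcop
      exact not_isCoprime_zero_zero hcop
    obtain ⟨y, hy⟩ := hP.nonempty_interior
    obtain ⟨p, hp⟩ : y ∈ Set.range S.μ := hμ ▸ interior_subset hy
    obtain ⟨γ, hγ0, hγ⟩ := hcomplete i p
    have hγp : S.μ (γ 0) ∈ interior (Set.range S.μ) := by rw [hγ0, hp, hμ]; exact hy
    set f : ℝ := det2 (grad u (S.μ (γ 0))) (toPlane (m 0)) with hf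
    set g : ℝ := det2 (Pi.single i 1) (toPlane (m 0)) with hg
    set t : ℝ := f / g with ht
    have hcurve := hγ.isMIntegralCurveOn (Set.Ioo (-(|t| + 1)) (|t| + 1))
    have h0 : (0 : ℝ) ∈ Set.Ioo (-(|t| + 1)) (|t| + 1) :=
      ⟨by linarith [abs_nonneg t], by linarith [abs_nonneg t]⟩
    have ht' : t ∈ Set.Ioo (-(|t| + 1)) (|t| + 1) :=
      ⟨by linarith [neg_abs_le t], by linarith [le_abs_self t]⟩
    have hgrad := hJ.grad_comp_integralCurve hus hΦ hJΦ hP.primitive hμ hcurve h0 hγp ht'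
    have hmem := hJ.mem_interior_of_isMIntegralCurveOn hΦ hP.primitive hμ hcurve h0 hγp ht'
    rw [hμ] at hmem
    have hneg := hx.det2_grad_neg hP hν hus' hux hm hmem
    have hval : det2 (grad u (S.μ (γ t))) (toPlane (m 0)) = f - t * g := by
      rw [hgrad, hf, hg]
      simp only [det2, Pi.add_apply, Pi.smul_apply, Pi.neg_apply, smul_eq_mul]
      ring
    rw [hval, ht, div_mul_cancel₀ _ hi, sub_self] at hneg
    exact lt_irrefl 0 hneg
  · intro hm i p
    obtain ⟨M, hM⟩ := hx.exists_eventually_grad_le hP hν hus' hux (S.μ p)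
    refine exists_isMIntegralCurve_of_dense_translation (hJ.contMDiff_generator i)
      (S.dense_preimage_interior hP.primitive hμ) (G := fun q ↦ grad u (S.μ q))
      (w := (-Pi.single i 1 : Plane)) ?_
      (A := {v | det2 v (toPlane (m 0)) ≤ M ∧ det2 (toPlane (m (Fin.last (k + 1)))) v ≤ M}) ?_ ?_
    · intro s₁ s₂ γ hγ t₀ ht₀ h₀ t ht
      exact ⟨hJ.mem_interior_of_isMIntegralCurveOn hΦ hP.primitive hμ hγ ht₀ h₀ ht,
        hJ.grad_comp_integralCurve hus hΦ hJΦ hP.primitive hμ hγ ht₀ h₀ ht⟩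
    · filter_upwards [S.μ_smooth.continuous.continuousAt.eventually hM] with q hq hqU
      exact hq (hμ ▸ hqU)
    · intro T
      set B := |det2 (Pi.single i 1) (toPlane (m 0))|
        + |det2 (toPlane (m (Fin.last (k + 1)))) (Pi.single i 1)| with hB
      obtain ⟨K, hK, hKmem⟩ := hx.exists_isCompact_of_grad_le hP hν hus' hux hm (M + T * B)
      have hcl : IsClosed (Set.range S.μ) := by
        rw [hμ]
        exact isClosed_region m c
      refine ⟨S.μ ⁻¹' K, S.isCompact_preimage hK hcl, fun q hq t ht hA ↦ ?_⟩
      have hq' : S.μ q ∈ interior (region m c) := hμ ▸ hq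
      have hb : ∀ b : ℝ, |b| ≤ B → -(t * b) ≤ T * B := by
        intro b hb
        have h1 : -(t * b) ≤ |t| * |b| := by
          rw [← abs_mul]
          exact neg_le_abs _
        exact h1.trans (mul_le_mul ht hb (abs_nonneg b) ((abs_nonneg t).trans ht))
      obtain ⟨h1, h2⟩ := hA
      have e1 : det2 (grad u (S.μ q) - t • (-Pi.single i 1 : Plane)) (toPlane (m 0))
          = det2 (grad u (S.μ q)) (toPlane (m 0))
            + t * det2 (Pi.single i 1) (toPlane (m 0)) := by
        simp only [det2, Pi.sub_apply, Pi.smul_apply, Pi.neg_apply, smul_eq_mul]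
        ring
      have e2 : det2 (toPlane (m (Fin.last (k + 1))))
            (grad u (S.μ q) - t • (-Pi.single i 1 : Plane))
          = det2 (toPlane (m (Fin.last (k + 1)))) (grad u (S.μ q))
            + t * det2 (toPlane (m (Fin.last (k + 1)))) (Pi.single i 1) := by
        simp only [det2, Pi.sub_apply, Pi.smul_apply, Pi.neg_apply, smul_eq_mul]
        ring
      rw [e1] at h1
      rw [e2] at h2
      refine hKmem _ hq' ?_ ?_
      · linarith [hb (det2 (Pi.single i 1) (toPlane (m 0)))
          (le_add_of_nonneg_right (abs_nonneg _))]
      · linarith [hb (det2 (toPlane (m (Fin.last (k + 1)))) (Pi.single i 1))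
          (le_add_of_nonneg_left (abs_nonneg _))]

end
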